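/- Let $L>0$, let $a,\beta\in C^2([0,\infty))$ with $a(0)>0$, and put $\gamma_0=\sqrt{2/L}$ and, for $n=0,1,2,\dots$, $\lambda_n=(n+\tfrac12)\frac{\pi}{L}$, $\phi_n(x)=\gamma_0\sin(\lambda_n x)$ (the normalized eigenfunctions of $d^2/dx^2$ on $(0,L)$ with $\phi(0)=0$, $\phi'(L)=0$). Consider on $(0,L)$ the equation $$\frac{d}{dt}\Big[\theta(t)+\int_0^t\beta(t-s)\theta(s)\,ds\Big]=\int_0^t a(t-s)\,\theta_{xx}(s)\,ds ,\qquad t\ge 0 ,$$ with mixed boundary conditions $\theta(0,t)=f(t)$, $\theta_x(L,t)=0$ and initial condition $\theta(x,0)=\xi(x)$. A solution is a function $\theta\in C([0,\infty);L^2(0,L))$ with $\theta(\cdot,0)=\xi$ such that for every $\varphi\in C^2$ with $\varphi(0)=0$, $\varphi'(L)=0$, and every $t\ge0$, writing $\langle u,v\rangle=\int_0^L uv\,dx$, $$\frac{d}{dt}\Big[\langle\theta(t),\varphi\rangle+\int_0^t\beta(t-s)\langle\theta(s),\varphi\rangle ds\Big]=\int_0^t a(t-s)\big[\langle\theta(s),\varphi''\rangle+\varphi'(0)f(s)\big]ds$$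 (one-sided derivative at $t=0$). The boundary temperature is $\theta(L,t)=\lim_{\varepsilon\to0^+}\frac1\varepsilon\int_{L-\varepsilon}^{L}\theta(x,t)\,dx$. Let $\theta^{1}$ be a solution with $f=0$ and with the initial temperature $\xi\in L^2(0,L)$ whose Fourier coefficients are $\int_0^L\xi\phi_n\,dx=1/\lambda_n$ for all $n\ge 0$. Let $g\in C([0,\infty))$ and let $\theta^{2}$ be a solution with $\xi=0$ and $f(t)=\int_0^t g(s)\,ds$. Then: (1) the boundary temperatures $H(t)=\theta^{1}(L,t)$ and $\theta(L,t):=\theta^{2}(L,t)$ exist for every $t\ge0$; $H$ is integrable on bounded intervals; and $H(t)=\gamma_0\sum_{n=0}^\infty\frac{(-1)^n}{\lambda_n}z_n(t)$ for every $t\ge 0$, where $z_n$ is the continuous solution of $\frac{d}{dt}\big[z_n(t)+\int_0^t\beta(t-s)z_n(s)ds\big]=-\lambda_n^2\int_0^t a(t-s)z_n(s)\,ds$, $z_n(0)=1$; (2) for every $t\ge0$ $$\gamma_0\int_0^t\Big[\int_0^{t-s}g(t-s-r)H(r)\,dr\Big]\beta(s)\,ds=\gamma_0^2\Big(\sum_{n=0}^{\infty}\frac{(-1)^n}{\lambda_n}\Big)\int_0^t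 g(s)\,ds-\gamma_0\int_0^t g(t-s)H(s)\,ds-\theta(L,t);$$ (3) the (conditionally convergent) series in (2) is explicit: $\sum_{n=1}^\infty\frac{(-1)^n}{n+1/2}=\frac{\pi}{2}-2$, and hence, adding the term $n=0$, $\sum_{n=0}^\infty\frac{(-1)^n}{\lambda_n}=\frac L\pi\big(2+(\tfrac\pi2-2)\big)=\frac L2$; (4) the equation in (2) determines $\beta$: if $\tau\ge0$, $g(\tau)\neq0$, $T>0$, and a continuous function $b$ on $[0,T]$ satisfies the equation in (2), with $b$ in place of $\beta$, for all $t\in[0,T]$, then $b=\beta$ on $[0,T-\tau]$ (in particular on all of $[0,T]$ if $g(0)\ne0$). -/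

import Mathlib

open MeasureTheory Set Filter Topology

noncomputable section

namespace HeatMemory

/-- The space `L²(0,L)`. -/
abbrev L2 (L : ℝ) : Type := Lp ℝ 2 (volume.restrict (Ioo (0 : ℝ) L))

/-- The `L²(0,L)` pairing of `u` with a function `φ`. -/
def pairing (L : ℝ) (u : L2 L) (φ : ℝ → ℝ) : ℝ := ∫ x in Ioo (0 : ℝ) L, u x * φ x

/-- Convolution on the half line, `(k * u)(t) = ∫₀ᵗ k(t - s) u(s) ds`. -/
def conv (k u : ℝ → ℝ) (t : ℝ) : ℝ := ∫ s in (0 : ℝ)..t, k (t - s) * u s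

/-- `γ₀ = √(2/L)`. -/
def gamma0 (L : ℝ) : ℝ := Real.sqrt (2 / L)

/-- `λₙ = (n + 1/2) π / L`, `n = 0, 1, 2, …`; the numbers `-λₙ²` are the eigenvalues of `d²/dx²`
on `(0,L)` with the conditions `φ(0) = 0`, `φ'(L) = 0`. -/
def lam (L : ℝ) (n : ℕ) : ℝ := ((n : ℝ) + 1 / 2) * (Real.pi / L)

/-- The normalized eigenfunctions `φₙ(x) = γ₀ sin (λₙ x)`. -/
def phi (L : ℝ) (n : ℕ) (x : ℝ) : ℝ := gamma0 L * Real.sin (lam L n * x)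

/-- `θ ∈ C([0,∞); L²(0,L))` is the (weak) solution of
`d/dt [θ(t) + ∫₀ᵗ β(t-s) θ(s) ds] = ∫₀ᵗ a(t-s) θₓₓ(s) ds` on `(0,L)` with
`θ(x,0) = ξ(x)`, `θ(0,t) = f(t)`, `θₓ(L,t) = 0`: the equation holds after it is multiplied by any
test function `φ` with `φ(0) = 0`, `φ'(L) = 0` and integrated by parts twice on `(0,L)`, which
leaves the boundary term `φ'(0) f`. -/
structure IsSolution (L : ℝ) (a β f : ℝ → ℝ) (ξ : L2 L) (θ : ℝ → L2 L) : Prop where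
  continuousOn : ContinuousOn θ (Ici 0)
  initial : θ 0 = ξ
  equation : ∀ φ : ℝ → ℝ, ContDiff ℝ 2 φ → φ 0 = 0 → deriv φ L = 0 → ∀ t : ℝ, 0 ≤ t →
    HasDerivWithinAt
      (fun τ => pairing L (θ τ) φ + conv β (fun s => pairing L (θ s) φ) τ)
      (conv a (fun s => pairing L (θ s) (deriv (deriv φ)) + deriv φ 0 * f s) t)
      (Ici 0) t

/-- The continuous function `z` on `[0,∞)` solves
`d/dt [z(t) + ∫₀ᵗ β(t-s) z(s) ds] = -l² ∫₀ᵗ a(t-s) z(s) ds`, `z(0) = 1`. -/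
structure IsMode (a β : ℝ → ℝ) (l : ℝ) (z : ℝ → ℝ) : Prop where
  continuousOn : ContinuousOn z (Ici 0)
  initial : z 0 = 1
  equation : ∀ t : ℝ, 0 ≤ t →
    HasDerivWithinAt (fun τ => z τ + conv β z τ) (-(l ^ 2) * conv a z t) (Ici 0) t

/-- `h` is the value of `u ∈ L²(0,L)` at the right end `x = L`:
`h = lim_{ε → 0+} (1/ε) ∫_{L-ε}^L u(x) dx`. -/
def IsRightValue (L : ℝ) (u : L2 L) (h : ℝ) : Prop :=
  Tendsto (fun ε : ℝ => (1 / ε) * ∫ x in Ioo (L - ε) L, u x) (𝓝[>] 0) (𝓝 h)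

/-- The deconvolution equation for the unknown `b` at time `t`, with the measured functions
`H` and `Y` and the constant `S`:
`γ₀ ∫₀ᵗ [∫₀^{t-s} g(t-s-r) H(r) dr] b(s) ds
  = γ₀² S ∫₀ᵗ g(s) ds - γ₀ ∫₀ᵗ g(t-s) H(s) ds - Y(t)`. -/
def Deconvolution (L S : ℝ) (g H Y b : ℝ → ℝ) (t : ℝ) : Prop :=
  gamma0 L * (∫ s in (0 : ℝ)..t, (∫ r in (0 : ℝ)..(t - s), g (t - s - r) * H r) * b s)
    = gamma0 L ^ 2 * S * (∫ s in (0 : ℝ)..t, g s)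
      - gamma0 L * (∫ s in (0 : ℝ)..t, g (t - s) * H s) - Y t

end HeatMemory

end

/-! Testing the weak equation with `phi L n` decouples it into modes. With `f = 0`, λₙ times the
n-th coefficient of θ¹ is the mode zₙ. For θ², Duhamel's formula `IsMode.duhamel` expresses the
coefficient as (γ₀/λₙ)(∫g - g*zₙ - g*zₙ*β). Since φₙ(L) = γ₀(-1)ⁿ, formal summation at x = L gives
the series for H and the deconvolution equation. These manipulations are algebra in the convolution
ring `ConvAlg`, where integrated Volterra equations become linear identities and convolution with 1
can be cancelled (`eq_of_one_conv_eq`).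

The analytic difficulty is that Σ(-1)ⁿzₙ(t)/λₙ converges only conditionally. Writing a = a(0)(1 +
∫σ), a mode satisfies zₙ = cos(ωₙt) - κₙ*zₙ with ωₙ = √a(0)·λₙ and κₙ built from n-independent
functions and cos(ωₙ·) (`IsMode.volterra`). If a cosine factor cos(ωₙy) is carried in the series,
multiplication by cos(ωₙq) becomes the average of the translates y ± q. Estimates uniform in y
therefore survive the Volterra iteration with constants independent of the number of terms
(`TrigSummable.volterra`). The starting series is a square wave, whose partial sums are bounded and
converge everywhere.

The boundary value is a limit of averages over (L-ε, L). Averaging multiplies the n-th term by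
sinc(λₙε), so this is Lebesgue summation. It recovers the ordinary sum because the coefficients are
O(1/n) (`tendsto_of_lebesgue_summation`, `isRightValue_of_tendsto`).

Uniqueness rests on Titchmarsh's convolution theorem. If (g*H)*(b-β) = 0 on [0,T], then g*H vanishes
on some [0,α] and b-β on [0,T-α]. As H is bounded below by a positive constant near 0, a second
application makes g vanish on [0,α], so α ≤ τ (`eq_of_conv_conv_eq`). Titchmarsh's theorem is proved
with Laplace transforms: the Poisson–Jensen inequality on large discs tangent to the imaginary axis
shows that the exponential decay rates of the two transforms add up to at least T
(`log_norm_div_add_le`), and decay at rate α forces vanishing on [0,α]. -/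

section Poisson

/-! ### The Poisson–Jensen inequality. -/

open Metric Real InnerProductSpace

lemma continuousOn_poissonKernel_sphere {c w : ℂ} {R : ℝ} (hw : w ∈ ball c R) :
    ContinuousOn (poissonKernel c w) (sphere c |R|) := by
  rw [poissonKernel_eq_re_herglotzRieszKernel]
  exact Complex.continuous_re.comp_continuousOn (continuousOn_herglotzRieszKernel_sphere hw)

lemma poissonKernel_nonneg {c w z : ℂ} {R : ℝ} (hw : w ∈ ball c R) (hz : z ∈ sphere c R) :
    0 ≤ poissonKernel c w z := by
  rw [poissonKernel_def]
  rw [mem_ball_iff_norm] at hw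
  rw [mem_sphere_iff_norm] at hz
  have : ‖w - c‖ ^ 2 ≤ ‖z - c‖ ^ 2 := by rw [hz]; gcongr
  exact div_nonneg (by linarith) (by positivity)

/-- For `u` inside the disc, replace z - u by the factor with the zero reflected in the circle. The
two have equal modulus on the circle, the reflected one is larger inside, and its logarithm is
harmonic there. For `u` on the circle equality holds. -/
lemma log_norm_sub_le_circleAverage_poissonKernel {c w u : ℂ} {R : ℝ} (hw : w ∈ ball c R)
    (hu : u ∈ closedBall c R) (hwu : w ≠ u) :
    log ‖w - u‖ ≤ circleAverage (poissonKernel c w * (log ‖· - u‖)) c R := by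
  have hR : 0 < R := pos_of_mem_ball hw
  rcases eq_or_lt_of_le (mem_closedBall.1 hu) with h | h
  · rw [poissonKernel_eq_re_herglotzRieszKernel,
      circleAverage_re_herglotzRieszKernel_mul_log (mem_sphere.2 h) hw]
  set a : ℂ := u - c with ha
  have ha' : ‖a‖ < R := by rwa [dist_eq_norm] at h
  let F : ℂ → ℂ := fun z => ((R : ℂ) ^ 2 - (starRingEnd ℂ) a * (z - c)) / R
  have hRc : (R : ℂ) ≠ 0 := by exact_mod_cast hR.ne'
  -- This identity yields both comparisons: the last product vanishes on the circle and is
  -- nonnegative in the disc.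
  have key : ∀ z : ℂ, R ^ 2 * ‖F z‖ ^ 2
      = R ^ 2 * ‖z - u‖ ^ 2 + (R ^ 2 - ‖a‖ ^ 2) * (R ^ 2 - ‖z - c‖ ^ 2) := by
    intro z
    have : z - u = (z - c) - a := by simp [ha]
    simp only [F, norm_div, div_pow, Complex.norm_real, Real.norm_eq_abs, sq_abs]
    rw [this, mul_div_cancel₀ _ (by positivity)]
    simp only [← Complex.normSq_eq_norm_sq, Complex.normSq_apply]
    simp [← Complex.ofReal_pow]
    ring
  have hF0 : ∀ z ∈ closedBall c R, F z ≠ 0 := by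
    intro z hz h0
    rw [mem_closedBall, dist_eq_norm] at hz
    simp only [F, div_eq_zero_iff, hRc, or_false, sub_eq_zero] at h0
    have := congrArg norm h0
    rw [norm_mul, norm_pow, Complex.norm_real, Complex.norm_conj, Real.norm_eq_abs,
      abs_of_pos hR] at this
    nlinarith [norm_nonneg a, norm_nonneg (z - c)]
  have harm : HarmonicOnNhd (fun z => log ‖F z‖) (closedBall c R) := fun z hz =>
    AnalyticAt.harmonicAt_log_norm (by fun_prop (disch := exact hRc)) (hF0 z hz)
  have e1 := harm.circleAverage_poissonKernel_smul hw
  have e2 : circleAverage (poissonKernel c w * (log ‖· - u‖)) c R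
      = circleAverage (poissonKernel c w • fun z => log ‖F z‖) c R := by
    refine circleAverage_congr_sphere fun z hz => ?_
    rw [abs_of_pos hR, mem_sphere_iff_norm] at hz
    have h1 := key z
    rw [hz, sub_self, mul_zero, add_zero] at h1
    have h2 : ‖F z‖ ^ 2 = ‖z - u‖ ^ 2 := mul_left_cancel₀ (by positivity) h1
    have h3 : ‖F z‖ = ‖z - u‖ := (sq_eq_sq₀ (norm_nonneg _) (norm_nonneg _)).1 h2
    simp [h3]
  rw [e2, e1]
  refine log_le_log (norm_pos_iff.2 (sub_ne_zero.2 hwu)) ?_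
  have h1 := key w
  rw [mem_ball_iff_norm] at hw
  have h2 : 0 ≤ (R ^ 2 - ‖a‖ ^ 2) * (R ^ 2 - ‖w - c‖ ^ 2) := by
    apply mul_nonneg <;> nlinarith [norm_nonneg a, norm_nonneg (w - c)]
  have h3 : ‖w - u‖ ^ 2 ≤ ‖F w‖ ^ 2 := by
    have : R ^ 2 * ‖w - u‖ ^ 2 ≤ R ^ 2 * ‖F w‖ ^ 2 := by linarith
    exact le_of_mul_le_mul_left this (by positivity)
  exact le_of_sq_le_sq h3 (norm_nonneg _)

lemma circleIntegrable_poissonKernel_mul {c w : ℂ} {R : ℝ} (hw : w ∈ ball c R) {f : ℂ → ℝ}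
    (hf : CircleIntegrable f c R) : CircleIntegrable (poissonKernel c w * f) c R :=
  hf.continuousOn_smul (continuousOn_poissonKernel_sphere hw)

/-- The Poisson–Jensen inequality for entire functions. -/
theorem log_norm_le_circleAverage_poissonKernel {F : ℂ → ℂ} (hF : Differentiable ℂ F) {c w : ℂ}
    {R : ℝ} (hw : w ∈ ball c R) (hFw : F w ≠ 0) :
    log ‖F w‖ ≤ circleAverage (poissonKernel c w * (log ‖F ·‖)) c R := by
  have hR : 0 < R := pos_of_mem_ball hw
  have hF' : AnalyticOnNhd ℂ F univ := fun z _ => hF.analyticAt z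
  set CB := closedBall c R
  have hwCB : w ∈ CB := ball_subset_closedBall hw
  have h₁ : AnalyticOnNhd ℂ F CB := hF'.mono (subset_univ _)
  have hfin := (MeromorphicOn.divisor F CB).finiteSupport (isCompact_closedBall c R)
  have hord : ∀ u : CB, meromorphicOrderAt F u ≠ ⊤ := by
    rw [← h₁.meromorphicOn.exists_meromorphicOrderAt_ne_top_iff_forall
      ⟨⟨w, hwCB⟩, (convex_closedBall c R).isPreconnected⟩]
    refine ⟨⟨w, hwCB⟩, ?_⟩
    rw [(hF.analyticAt w).meromorphicOrderAt_eq, (hF.analyticAt w).analyticOrderAt_eq_zero.2 hFw]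
    simp
  -- Divide out the finitely many zeros in the closed disc: the logarithm of the zero-free factor
  -- `g` obeys the Poisson formula exactly, and each linear factor contributes an inequality.
  obtain ⟨g, h₁g, h₂g, h₃g⟩ := h₁.meromorphicOn.extract_zeros_poles hord hfin
  have hlog := MeromorphicOn.extract_zeros_poles_log h₂g h₃g
  set D := MeromorphicOn.divisor F CB
  have hDnn : ∀ u, 0 ≤ D u := fun u => MeromorphicOn.AnalyticOnNhd.divisor_nonneg h₁ u
  have hDsupp : ∀ u, D u ≠ 0 → u ∈ CB ∧ u ≠ w := by
    intro u hu
    have huCB : u ∈ CB := D.supportWithinDomain hu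
    refine ⟨huCB, ?_⟩
    rintro rfl
    apply hu
    rw [MeromorphicOn.AnalyticOnNhd.divisor_apply h₁ huCB, (hF.analyticAt u).analyticOrderAt_eq_zero.2 hFw]
    simp
  have acc : AccPt w (𝓟 CB) := by
    apply accPt_iff_frequently_nhdsNE.mpr
    apply compl_notMem
    apply mem_nhdsWithin.mpr
    exact ⟨ball c R, isOpen_ball, hw, fun z hz => ball_subset_closedBall hz.1⟩
  have hval : log ‖F w‖ = ∑ᶠ u, (D u) * log ‖w - u‖ + log ‖g w‖ := by
    rw [← (hF.analyticAt w).meromorphicTrailingCoeffAt_of_ne_zero hFw]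
    exact MeromorphicOn.log_norm_meromorphicTrailingCoeffAt_extract_zeros_poles hfin hwCB acc
      (hF.analyticAt w).meromorphicAt (h₁g w hwCB) (h₂g ⟨w, hwCB⟩) h₃g
  have hsum : (∑ᶠ u, (D u * log ‖· - u‖) : ℂ → ℝ) = ∑ u ∈ hfin.toFinset, (D u * log ‖· - u‖) := by
    rw [finsum_eq_sum_of_support_subset]
    intro u
    contrapose
    aesop
  have hsumw : ∑ᶠ u, (D u) * log ‖w - u‖ = ∑ u ∈ hfin.toFinset, D u * log ‖w - u‖ := by
    rw [finsum_eq_sum_of_support_subset]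
    intro u
    contrapose
    aesop
  have hci : ∀ u : ℂ, CircleIntegrable (fun z => log ‖z - u‖) c R := fun u =>
    (analyticOnNhd_id.sub analyticOnNhd_const).meromorphicOn.circleIntegrable_log_norm
  have hcg : CircleIntegrable (fun z => log ‖g z‖) c R :=
    (h₁g.mono (by rw [abs_of_pos hR]; exact sphere_subset_closedBall)).meromorphicOn.circleIntegrable_log_norm
  have hharm : circleAverage (poissonKernel c w * fun z => log ‖g z‖) c R = log ‖g w‖ :=
    HarmonicOnNhd.circleAverage_poissonKernel_smul
      (fun z hz => (h₁g z hz).harmonicAt_log_norm (h₂g ⟨z, hz⟩)) hw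
  have e1 : circleAverage (poissonKernel c w * (log ‖F ·‖)) c R
      = circleAverage ((∑ u ∈ hfin.toFinset, (D u : ℝ) • (poissonKernel c w * (log ‖· - u‖)))
        + poissonKernel c w * fun z => log ‖g z‖) c R := by
    refine circleAverage_congr_codiscreteWithin ?_ hR.ne'
    rw [abs_of_pos hR]
    have := Filter.codiscreteWithin_mono sphere_subset_closedBall hlog
    filter_upwards [this] with z hz
    simp only [Pi.mul_apply, hz, hsum, Pi.add_apply, Finset.sum_apply, Pi.smul_apply, smul_eq_mul,
      mul_add, Finset.mul_sum]
    congr 1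
    refine Finset.sum_congr rfl fun u _ => ?_
    ring
  rw [e1, circleAverage_add _ (circleIntegrable_poissonKernel_mul hw hcg), hharm, hval, hsumw,
    circleAverage_sum]
  · gcongr with u hu
    rw [circleAverage_smul, smul_eq_mul]
    have hu' := hDsupp u (by simpa using hu)
    refine mul_le_mul_of_nonneg_left
      (log_norm_sub_le_circleAverage_poissonKernel hw hu'.1 hu'.2.symm) (by exact_mod_cast hDnn u)
  · exact fun u _ => (circleIntegrable_poissonKernel_mul hw (hci u)).const_smul
  · exact CircleIntegrable.sum _
      fun u _ => (circleIntegrable_poissonKernel_mul hw (hci u)).const_smul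

end Poisson

/-! ### Decay rates along the real axis of functions on the right half-plane. -/

section LogDecay

open Metric Real InnerProductSpace

/-- On this circle, which touches the imaginary axis at 0, |z|² = 2R·re z, hence |z - t|² = 2·re
z·(R - t) + t². The kernel at t divided by t is (2R - t)/|z - t|², nearly independent of t when t is
small against R; `δ` measures the loss. -/
lemma poissonKernel_tangent_le {R x y : ℝ} {z : ℂ} (hx : 0 < x) (hxy : x ≤ y) {δ : ℝ}
    (hδ : 0 < δ) (hδ1 : δ < 1) (hR : y / δ ≤ R) (hz : z ∈ sphere (R : ℂ) R) :
    (1 - δ) / y * poissonKernel R y z ≤ 1 / x * poissonKernel R x z := by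
  have hy : 0 < y := hx.trans_le hxy
  have hyR : y ≤ δ * R := by rwa [div_le_iff₀ hδ, mul_comm] at hR
  have hRpos : 0 < R := by nlinarith
  have hyR' : y < R := by nlinarith
  rw [mem_sphere_iff_norm] at hz
  have hz2 : (z.re - R) ^ 2 + z.im ^ 2 = R ^ 2 := by
    have h : ‖z - R‖ ^ 2 = R ^ 2 := by rw [hz]
    rw [← h, ← Complex.normSq_eq_norm_sq, Complex.normSq_apply]; simp; ring
  have hform : ∀ t : ℝ, poissonKernel R t z
      = t * (2 * R - t) / ((z.re - t) ^ 2 + z.im ^ 2) := by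
    intro t
    rw [poissonKernel_def, hz]
    have h1 : ‖(t : ℂ) - R‖ ^ 2 = (t - R) ^ 2 := by
      rw [← Complex.ofReal_sub, Complex.norm_real, Real.norm_eq_abs, sq_abs]
    have h2 : ‖z - R - ((t : ℂ) - R)‖ ^ 2 = (z.re - t) ^ 2 + z.im ^ 2 := by
      rw [← Complex.normSq_eq_norm_sq, Complex.normSq_apply]; simp; ring
    rw [h1, h2]; ring_nf
  have hre : 0 ≤ z.re := by nlinarith [sq_nonneg z.re, sq_nonneg z.im]
  have hpos : ∀ t : ℝ, 0 < t → t < R → 0 < (z.re - t) ^ 2 + z.im ^ 2 := by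
    intro t ht htR
    have : (z.re - t) ^ 2 + z.im ^ 2 = 2 * z.re * (R - t) + t ^ 2 := by linarith
    have h2 : 0 ≤ z.re * (R - t) := mul_nonneg hre (by linarith)
    rw [this]; positivity
  rw [hform, hform]
  have e1 : (1 - δ) / y * (y * (2 * R - y) / ((z.re - y) ^ 2 + z.im ^ 2))
      = (1 - δ) * (2 * R - y) / ((z.re - y) ^ 2 + z.im ^ 2) := by field_simp
  have e2 : 1 / x * (x * (2 * R - x) / ((z.re - x) ^ 2 + z.im ^ 2))
      = (2 * R - x) / ((z.re - x) ^ 2 + z.im ^ 2) := by field_simp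
  rw [e1, e2, div_le_div_iff₀ (hpos y hy hyR') (hpos x hx (by linarith))]
  have h3 : (1 - δ) * ((z.re - x) ^ 2 + z.im ^ 2) ≤ (z.re - y) ^ 2 + z.im ^ 2 := by
    have a1 : (z.re - x) ^ 2 + z.im ^ 2 = 2 * z.re * (R - x) + x ^ 2 := by linarith
    have a2 : (z.re - y) ^ 2 + z.im ^ 2 = 2 * z.re * (R - y) + y ^ 2 := by linarith
    have a3 : 0 ≤ z.re * (R - y - (1 - δ) * (R - x)) :=
      mul_nonneg hre (by nlinarith)
    have a4 : x ^ 2 ≤ y ^ 2 := by gcongr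
    nlinarith [sq_nonneg x]
  calc (1 - δ) * (2 * R - y) * ((z.re - x) ^ 2 + z.im ^ 2)
      = (2 * R - y) * ((1 - δ) * ((z.re - x) ^ 2 + z.im ^ 2)) := by ring
    _ ≤ (2 * R - y) * ((z.re - y) ^ 2 + z.im ^ 2) := by gcongr; linarith
    _ ≤ (2 * R - x) * ((z.re - y) ^ 2 + z.im ^ 2) := by gcongr

lemma ofReal_mem_ball_tangent {R x : ℝ} (hx : 0 < x) (hxR : x < R) :
    (x : ℂ) ∈ ball (R : ℂ) R := by
  rw [mem_ball_iff_norm, ← Complex.ofReal_sub, Complex.norm_real, Real.norm_eq_abs, abs_lt]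
  constructor <;> linarith

lemma re_nonneg_of_mem_sphere_tangent {R : ℝ} {z : ℂ} (hz : z ∈ sphere (R : ℂ) R) : 0 ≤ z.re := by
  rw [mem_sphere_iff_norm] at hz
  have := Complex.abs_re_le_norm (z - R)
  rw [hz] at this
  have := (abs_le.1 this).1
  simp at this
  linarith

lemma circleIntegrable_log_norm_of_differentiable {F : ℂ → ℂ} (hF : Differentiable ℂ F) (c : ℂ)
    (R : ℝ) : CircleIntegrable (fun z => Real.log ‖F z‖) c R :=
  MeromorphicOn.circleIntegrable_log_norm fun z _ => (hF.analyticAt z).meromorphicAt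

/-- Since log‖F‖ ≤ 0 on the circle, the comparison of kernels is reversed when multiplied by it.
Poisson–Jensen at `x` can thus be read at a common point `y`, so that different points `x` for `F`
and `G` become comparable. -/
lemma log_norm_div_le_circleAverage {F : ℂ → ℂ} (hF : Differentiable ℂ F)
    (hb : ∀ z : ℂ, 0 ≤ z.re → ‖F z‖ ≤ 1) {R x y : ℝ} (hx : 0 < x) (hxy : x ≤ y) {δ : ℝ}
    (hδ : 0 < δ) (hδ1 : δ < 1) (hR : y / δ ≤ R) (hFx : F x ≠ 0) :
    log ‖F x‖ / x ≤ (1 - δ) / y * circleAverage (poissonKernel R y * (log ‖F ·‖)) R R := by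
  have hy : 0 < y := hx.trans_le hxy
  have hyR : y ≤ δ * R := by rwa [div_le_iff₀ hδ, mul_comm] at hR
  have hRpos : 0 < R := by nlinarith
  have hyR' : y < R := by nlinarith
  have bx := ofReal_mem_ball_tangent hx (hxy.trans_lt hyR')
  have bY := ofReal_mem_ball_tangent hy hyR'
  have h1 := log_norm_le_circleAverage_poissonKernel hF bx hFx
  have hI := circleIntegrable_log_norm_of_differentiable hF R R
  calc log ‖F x‖ / x = 1 / x * log ‖F x‖ := by ring
    _ ≤ 1 / x * circleAverage (poissonKernel R x * (log ‖F ·‖)) R R := by gcongr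
    _ = circleAverage ((1 / x) • (poissonKernel R x * (log ‖F ·‖))) R R := by
      rw [circleAverage_smul, smul_eq_mul]
    _ ≤ circleAverage (((1 - δ) / y) • (poissonKernel R y * (log ‖F ·‖))) R R := by
      refine circleAverage_mono (circleIntegrable_poissonKernel_mul bx hI).const_smul
        (circleIntegrable_poissonKernel_mul bY hI).const_smul fun z hz => ?_
      rw [abs_of_pos hRpos] at hz
      have k := poissonKernel_tangent_le hx hxy hδ hδ1 hR hz
      have l : log ‖F z‖ ≤ 0 :=
        log_nonpos (norm_nonneg _) (hb z (re_nonneg_of_mem_sphere_tangent hz))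
      simp only [Pi.smul_apply, Pi.mul_apply, smul_eq_mul, ← mul_assoc]
      exact mul_le_mul_of_nonpos_right k l
    _ = _ := by rw [circleAverage_smul, smul_eq_mul]

/-- The majorant log C - T·re z of log‖F G‖ is harmonic, so its Poisson average is its value at `y`.
-/
lemma circleAverage_log_norm_add_le {F G : ℂ → ℂ} (hF : Differentiable ℂ F)
    (hG : Differentiable ℂ G) {a b : ℂ} (hFa : F a ≠ 0) (hGb : G b ≠ 0) {T C : ℝ} (hC : 0 < C)
    (hFG : ∀ z : ℂ, 0 ≤ z.re → ‖F z * G z‖ ≤ C * exp (-T * z.re)) {R y : ℝ} (hy : 0 < y)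
    (hyR : y < R) :
    circleAverage (poissonKernel R y * (log ‖F ·‖)) R R
      + circleAverage (poissonKernel R y * (log ‖G ·‖)) R R ≤ log C - T * y := by
  have hRpos : 0 < R := hy.trans hyR
  have bY := ofReal_mem_ball_tangent hy hyR
  have iF := circleIntegrable_poissonKernel_mul bY (circleIntegrable_log_norm_of_differentiable hF R R)
  have iG := circleIntegrable_poissonKernel_mul bY (circleIntegrable_log_norm_of_differentiable hG R R)
  let A : ℂ → ℂ := fun z => (log C : ℂ) - T * z
  have hA : HarmonicOnNhd (fun z => (A z).re) (closedBall (R : ℂ) R) := fun z _ =>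
    AnalyticAt.harmonicAt_re (by fun_prop)
  have e := hA.circleAverage_poissonKernel_smul bY
  have hA' : ∀ z, (A z).re = log C - T * z.re := fun z => by simp [A]
  rw [hA', Complex.ofReal_re] at e
  rw [← e, ← circleAverage_add iF iG]
  -- Because `log 0 = 0`, the majorant can fail at zeros of F G. There `u` is given the value of the
  -- majorant; zeros are discrete and do not affect the average.
  set u : ℂ → ℝ := fun z => if F z * G z = 0 then (A z).re else log ‖F z‖ + log ‖G z‖ with hu
  have hcod : (poissonKernel R y * (log ‖F ·‖) + poissonKernel R y * (log ‖G ·‖))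
      =ᶠ[codiscreteWithin (sphere (R : ℂ) |R|)] poissonKernel R y * u := by
    have zF := AnalyticOnNhd.preimage_zero_mem_codiscrete (fun z _ => hF.analyticAt z) hFa
    have zG := AnalyticOnNhd.preimage_zero_mem_codiscrete (fun z _ => hG.analyticAt z) hGb
    refine Filter.codiscreteWithin_mono (subset_univ _) ?_
    filter_upwards [zF, zG] with z h1 h2
    have : ¬ (F z * G z = 0) := mul_ne_zero h1 h2
    simp only [hu, Pi.add_apply, Pi.mul_apply, if_neg this, mul_add]
  rw [circleAverage_congr_codiscreteWithin hcod hRpos.ne']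
  refine circleAverage_mono ((iF.add iG).congr_codiscreteWithin hcod)
    (circleIntegrable_poissonKernel_mul bY ?_) fun z hz => ?_
  · refine ContinuousOn.circleIntegrable hRpos.le (Continuous.continuousOn ?_)
    fun_prop
  · rw [abs_of_pos hRpos] at hz
    refine mul_le_mul_of_nonneg_left ?_ (poissonKernel_nonneg bY hz)
    by_cases h0 : F z * G z = 0
    · simp only [hu, if_pos h0, le_refl]
    · simp only [hu, h0, if_false, hA']
      have h1 := hFG z (re_nonneg_of_mem_sphere_tangent hz)
      have h2 := log_le_log (norm_pos_iff.2 h0) h1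
      rw [norm_mul, log_mul (norm_ne_zero_iff.2 (left_ne_zero_of_mul h0))
        (norm_ne_zero_iff.2 (right_ne_zero_of_mul h0)), log_mul hC.ne' (exp_ne_zero _),
        log_exp] at h2
      linarith

/-- If `F`, `G` are entire, bounded by `1` on the right half-plane, and `F G` decays like
`exp (-T re z)` there, then the decay rates of `F` and `G` along the real axis add up to at
least `T`. -/
theorem log_norm_div_add_le {F G : ℂ → ℂ} (hF : Differentiable ℂ F)
    (hG : Differentiable ℂ G) (hFb : ∀ z : ℂ, 0 ≤ z.re → ‖F z‖ ≤ 1)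
    (hGb : ∀ z : ℂ, 0 ≤ z.re → ‖G z‖ ≤ 1) {T C : ℝ} (hC : 0 < C)
    (hFG : ∀ z : ℂ, 0 ≤ z.re → ‖F z * G z‖ ≤ C * exp (-T * z.re)) {x x' : ℝ} (hx : 0 < x)
    (hx' : 0 < x') (hFx : F x ≠ 0) (hGx' : G x' ≠ 0) :
    log ‖F x‖ / x + log ‖G x'‖ / x' ≤ -T := by
  -- Take δ = 1/y and radius y/δ = y², then let y tend to infinity.
  have key : ∀ᶠ y : ℝ in atTop,
      log ‖F x‖ / x + log ‖G x'‖ / x' ≤ (1 - y⁻¹) * (log C * y⁻¹ - T) := by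
    filter_upwards [eventually_ge_atTop x, eventually_ge_atTop x', eventually_gt_atTop 1]
      with y h1 h2 h3
    have hy : 0 < y := by linarith
    have hδ : 0 < y⁻¹ := inv_pos.2 hy
    have hδ1 : y⁻¹ < 1 := inv_lt_one_of_one_lt₀ h3
    have hyR : y < y / y⁻¹ := by rw [div_inv_eq_mul]; nlinarith
    have a1 := log_norm_div_le_circleAverage hF hFb hx h1 hδ hδ1 le_rfl hFx
    have a2 := log_norm_div_le_circleAverage hG hGb hx' h2 hδ hδ1 le_rfl hGx'
    have a3 := circleAverage_log_norm_add_le hF hG hFx hGx' hC hFG hy hyR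
    have h4 : 0 ≤ (1 - y⁻¹) / y := div_nonneg (by linarith) hy.le
    have a4 := mul_le_mul_of_nonneg_left a3 h4
    have a5 : (1 - y⁻¹) / y * (log C - T * y) = (1 - y⁻¹) * (log C * y⁻¹ - T) := by field_simp
    rw [← a5]
    linarith
  have lim : Tendsto (fun y : ℝ => (1 - y⁻¹) * (log C * y⁻¹ - T)) atTop
      (𝓝 ((1 - 0) * (log C * 0 - T))) :=
    (tendsto_const_nhds.sub tendsto_inv_atTop_zero).mul
      ((tendsto_const_nhds.mul tendsto_inv_atTop_zero).sub tendsto_const_nhds)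
  have := ge_of_tendsto lim key
  simpa using this

end LogDecay

/-! ### Titchmarsh's convolution theorem via truncated Laplace transforms. -/

section Titchmarsh

open intervalIntegral

/-- The Laplace transform of the restriction of `f` to `[0,T]`. -/
noncomputable def truncLaplace (T : ℝ) (f : ℝ → ℝ) (z : ℂ) : ℂ :=
  ∫ x in (0 : ℝ)..T, Complex.exp (-z * x) * f x

variable {T : ℝ} {f g : ℝ → ℝ}

lemma norm_exp_neg_mul_ofReal (z : ℂ) (x : ℝ) :
    ‖Complex.exp (-z * x)‖ = Real.exp (-z.re * x) := by
  rw [Complex.norm_exp]; simp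

lemma intervalIntegrable_exp_mul (z : ℂ) {a b : ℝ} (hf : IntervalIntegrable f volume a b) :
    IntervalIntegrable (fun x : ℝ => Complex.exp (-z * x) * (f x : ℂ)) volume a b := by
  have : IntervalIntegrable (fun x => (f x : ℂ)) volume a b :=
    ⟨hf.1.ofReal, hf.2.ofReal⟩
  exact this.continuousOn_mul (by fun_prop)

lemma differentiable_truncLaplace (hT : 0 ≤ T) (hf : IntervalIntegrable f volume 0 T) :
    Differentiable ℂ (truncLaplace T f) := by
  intro z₀
  have hfc : IntervalIntegrable (fun x => (f x : ℂ)) volume 0 T := ⟨hf.1.ofReal, hf.2.ofReal⟩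
  have := hasDerivAt_integral_of_dominated_loc_of_deriv_le (μ := volume) (a := 0) (b := T)
    (F := fun z (x : ℝ) => Complex.exp (-z * x) * (f x : ℂ))
    (F' := fun z (x : ℝ) => (-x * Complex.exp (-z * x)) * (f x : ℂ))
    (bound := fun x => T * Real.exp ((‖z₀‖ + 1) * T) * |f x|)
    (x₀ := z₀) (Metric.ball_mem_nhds z₀ one_pos)
    (Eventually.of_forall fun z => by
      have := (intervalIntegrable_exp_mul z hf).aestronglyMeasurable
      rwa [uIoc_of_le hT])
    (intervalIntegrable_exp_mul z₀ hf)
    (by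
      have : IntervalIntegrable (fun x : ℝ => (-x * Complex.exp (-z₀ * x)) * (f x : ℂ))
        volume 0 T := hfc.continuousOn_mul (by fun_prop)
      have := this.aestronglyMeasurable
      rwa [uIoc_of_le hT])
    (Eventually.of_forall fun x hx z hz => by
      rw [uIoc_of_le hT] at hx
      rw [norm_mul, norm_mul, norm_exp_neg_mul_ofReal, norm_neg, Complex.norm_real,
        Complex.norm_real, Real.norm_eq_abs, Real.norm_eq_abs, abs_of_pos hx.1]
      have h1 : ‖z‖ ≤ ‖z₀‖ + 1 := by
        rw [Metric.mem_ball, dist_eq_norm] at hz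
        have := norm_sub_norm_le z z₀
        linarith
      have h2 : -z.re * x ≤ (‖z₀‖ + 1) * T := by
        have : -z.re ≤ ‖z‖ := (neg_le_abs _).trans (Complex.abs_re_le_norm z)
        calc -z.re * x ≤ (‖z₀‖ + 1) * x := mul_le_mul_of_nonneg_right (this.trans h1) hx.1.le
          _ ≤ _ := by gcongr; exact hx.2
      gcongr
      exact hx.2)
    (hf.abs.const_mul _)
    (Eventually.of_forall fun x _ z _ => by
      have : HasDerivAt (fun z : ℂ => Complex.exp (-z * x)) (Complex.exp (-z * x) * (-1 * x)) z :=
        (((hasDerivAt_id z).neg).mul_const (x : ℂ)).cexp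
      convert! this.mul_const (f x : ℂ) using 1
      ring)
  exact this.2.differentiableAt

lemma norm_truncLaplace_le (hT : 0 ≤ T) (hf : IntervalIntegrable f volume 0 T) {z : ℂ}
    (hz : 0 ≤ z.re) : ‖truncLaplace T f z‖ ≤ ∫ x in (0 : ℝ)..T, |f x| := by
  refine norm_integral_le_of_norm_le hT (Eventually.of_forall fun x hx => ?_) hf.abs
  rw [norm_mul, norm_exp_neg_mul_ofReal, Complex.norm_real, Real.norm_eq_abs]
  have : Real.exp (-z.re * x) ≤ 1 := Real.exp_le_one_iff.2 (by nlinarith [hx.1])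
  exact mul_le_of_le_one_left (abs_nonneg _) this


lemma integral_indicator_Ioc_ofReal (hT : 0 ≤ T) (φ : ℝ → ℂ) :
    ∫ x, (Ioc 0 T).indicator φ x = ∫ x in (0 : ℝ)..T, φ x := by
  rw [MeasureTheory.integral_indicator measurableSet_Ioc, intervalIntegral.integral_of_le hT]

/-- If `f * g` vanishes on `[0,T]`, then the product of the truncated transforms decays like
`exp (-T re z)`. -/
lemma norm_truncLaplace_mul_le (hT : 0 ≤ T) (hf : IntervalIntegrable f volume 0 T)
    (hg : IntervalIntegrable g volume 0 T)
    (hfg : ∀ t ∈ Icc 0 T, HeatMemory.conv f g t = 0) {z : ℂ} (hz : 0 ≤ z.re) :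
    ‖truncLaplace T f z * truncLaplace T g z‖
      ≤ ((∫ x in (0 : ℝ)..T, |f x|) * ∫ x in (0 : ℝ)..T, |g x|) * Real.exp (-T * z.re) := by
  -- Extension by zero makes the product of the transforms the integral of a single convolution on
  -- the line; `ab` supplies the majorant.
  let tr : (ℝ → ℝ) → ℝ → ℂ := fun u => (Ioc 0 T).indicator fun x => Complex.exp (-z * x) * u x
  let ab : (ℝ → ℝ) → ℝ → ℝ := fun u => (Ioc 0 T).indicator fun x => |u x|
  have itr : ∀ u : ℝ → ℝ, IntervalIntegrable u volume 0 T → Integrable (tr u) := fun u hu =>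
    (integrable_indicator_iff measurableSet_Ioc).2
      ((intervalIntegrable_iff_integrableOn_Ioc_of_le hT).1 (intervalIntegrable_exp_mul z hu))
  have iab : ∀ u : ℝ → ℝ, IntervalIntegrable u volume 0 T → Integrable (ab u) := fun u hu =>
    (integrable_indicator_iff measurableSet_Ioc).2
      ((intervalIntegrable_iff_integrableOn_Ioc_of_le hT).1 hu.abs)
  have e1 := integral_convolution (μ := volume) (ν := volume) (ContinuousLinearMap.mul ℝ ℂ)
    (itr g hg) (itr f hf)
  have e2 := integral_convolution (μ := volume) (ν := volume) (ContinuousLinearMap.mul ℝ ℝ)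
    (iab g hg) (iab f hf)
  have Ltr : ∀ u : ℝ → ℝ, ∫ x, tr u x = truncLaplace T u z := fun u =>
    integral_indicator_Ioc_ofReal hT _
  have Lab : ∀ u : ℝ → ℝ, ∫ x, ab u x = ∫ x in (0 : ℝ)..T, |u x| := fun u => by
    rw [MeasureTheory.integral_indicator measurableSet_Ioc, intervalIntegral.integral_of_le hT]
  simp only [ContinuousLinearMap.mul_apply', Ltr, Lab] at e1 e2
  rw [mul_comm, ← e1, mul_comm (∫ x in (0 : ℝ)..T, |f x|), ← e2,
    ← MeasureTheory.integral_mul_const]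
  have ic : Integrable (convolution (ab g) (ab f) (ContinuousLinearMap.mul ℝ ℝ) volume) :=
    (iab g hg).integrable_convolution _ (iab f hf)
  refine norm_integral_le_of_norm_le (ic.mul_const _) ?_
  have hae := (iab g hg).ae_convolution_exists (ContinuousLinearMap.mul ℝ ℝ) (iab f hf)
  filter_upwards [hae] with t ht
  have hpt : ∀ s, ‖tr g s * tr f (t - s)‖ = (ab g s * ab f (t - s)) * Real.exp (-t * z.re) := by
    intro s
    by_cases h1 : s ∈ Ioc 0 T
    · by_cases h2 : t - s ∈ Ioc 0 T
      · simp only [tr, ab, indicator_of_mem h1, indicator_of_mem h2, norm_mul,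
          norm_exp_neg_mul_ofReal, Complex.norm_real, Real.norm_eq_abs]
        rw [show -t * z.re = -z.re * s + -z.re * (t - s) by ring, Real.exp_add]
        ring
      · simp [tr, ab, indicator_of_notMem h2]
    · simp [tr, ab, indicator_of_notMem h1]
  have hnn : ∀ s, 0 ≤ ab g s * ab f (t - s) := fun s =>
    mul_nonneg (indicator_nonneg (fun _ _ => abs_nonneg _) _)
      (indicator_nonneg (fun _ _ => abs_nonneg _) _)
  -- Up to `T` the truncations do not matter and the convolution is exp(-zt)(f*g)(t) = 0. Beyond `T`
  -- the factor exp(-t·re z) is already below exp(-T·re z).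
  rcases le_or_gt t T with h | h
  · have : convolution (tr g) (tr f) (ContinuousLinearMap.mul ℝ ℂ) volume t = 0 := by
      rw [convolution_def]
      simp only [ContinuousLinearMap.mul_apply']
      have hind : ∀ s, tr g s * tr f (t - s)
          = (Ioo 0 t).indicator (fun s => Complex.exp (-z * t) * ((f (t - s) * g s : ℝ) : ℂ)) s := by
        intro s
        by_cases h1 : s ∈ Ioo 0 t
        · have h2 : s ∈ Ioc 0 T := ⟨h1.1, h1.2.le.trans h⟩
          have h3 : t - s ∈ Ioc 0 T := ⟨by linarith [h1.2], by linarith [h1.1]⟩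
          simp only [tr, indicator_of_mem h1, indicator_of_mem h2, indicator_of_mem h3]
          rw [show -z * (t : ℂ) = -z * s + -z * ((t - s : ℝ) : ℂ) by push_cast; ring,
            Complex.exp_add]
          push_cast
          ring
        · rw [indicator_of_notMem h1]
          by_cases h2 : s ∈ Ioc 0 T
          · have h3 : t - s ∉ Ioc 0 T := fun h3 => h1 ⟨h2.1, by linarith [h3.1]⟩
            simp [tr, indicator_of_notMem h3]
          · simp [tr, indicator_of_notMem h2]
      simp only [hind]
      rw [MeasureTheory.integral_indicator measurableSet_Ioo, MeasureTheory.integral_const_mul,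
        integral_complex_ofReal]
      rcases le_or_gt t 0 with h0 | h0
      · simp [Ioo_eq_empty (not_lt.2 h0)]
      · have := hfg t ⟨h0.le, h⟩
        rw [HeatMemory.conv, intervalIntegral.integral_of_le h0.le, integral_Ioc_eq_integral_Ioo]
          at this
        rw [this]; simp
    rw [this, norm_zero]
    exact mul_nonneg (integral_nonneg hnn) (Real.exp_nonneg _)
  · rw [convolution_def, convolution_def]
    simp only [ContinuousLinearMap.mul_apply']
    calc ‖∫ s, tr g s * tr f (t - s)‖ ≤ ∫ s, ‖tr g s * tr f (t - s)‖ :=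
          norm_integral_le_integral_norm _
      _ = (∫ s, ab g s * ab f (t - s)) * Real.exp (-t * z.re) := by
          simp only [hpt, MeasureTheory.integral_mul_const]
      _ ≤ _ := by
          refine mul_le_mul_of_nonneg_left (Real.exp_le_exp.2 ?_) (integral_nonneg hnn)
          nlinarith

lemma truncLaplace_ofReal (x : ℝ) :
    truncLaplace T f x = ((∫ s in (0 : ℝ)..T, Real.exp (-x * s) * f s : ℝ) : ℂ) := by
  rw [truncLaplace, ← intervalIntegral.integral_ofReal]
  refine intervalIntegral.integral_congr fun s _ => ?_
  simp

lemma hasSum_one_sub_exp_neg (y : ℝ) :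
    HasSum (fun k : ℕ => -((-1) ^ (k + 1) / ((k + 1).factorial : ℝ)) * y ^ (k + 1))
      (1 - Real.exp (-y)) := by
  have h := NormedSpace.expSeries_div_hasSum_exp (𝔸 := ℝ) (-y)
  rw [← Real.exp_eq_exp_ℝ] at h
  have h2 := ((hasSum_nat_add_iff' 1).2 h).neg
  simp only [Finset.range_one, Finset.sum_singleton, pow_zero, Nat.factorial_zero, Nat.cast_one,
    div_one, neg_sub] at h2
  refine h2.congr_fun fun k => ?_
  rw [neg_pow]
  ring

/-- A function whose Laplace transform decays like `exp (-α x)` along the positive axis vanishes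
on `[0,α]`. -/
lemma integral_eq_zero_of_truncLaplace_le {α C : ℝ} (hα : 0 ≤ α) (hαT : α ≤ T)
    (hf : IntervalIntegrable f volume 0 T)
    (h : ∀ x : ℝ, 0 < x → ‖truncLaplace T f x‖ ≤ C * Real.exp (-α * x)) :
    ∀ x ∈ Icc 0 α, ∫ s in (0 : ℝ)..x, f s = 0 := by
  have hT : 0 ≤ T := hα.trans hαT
  have hC : 0 ≤ C := by
    have := (norm_nonneg _).trans (h 1 one_pos)
    exact nonneg_of_mul_nonneg_left this (Real.exp_pos _)
  have main : ∀ x ∈ Ico 0 α, ∫ s in (0 : ℝ)..x, f s = 0 := by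
    intro x hx
    -- These smooth out the indicator of s < x. Expanding the outer exponential gives a series in
    -- exp(-(k+1)(n+1)s), so the integral against `f` only involves the transform at the points
    -- (k+1)(n+1).
    let φ : ℕ → ℝ → ℝ := fun n s => 1 - Real.exp (-Real.exp ((n + 1) * (x - s)))
    have φ_nonneg : ∀ n s, 0 ≤ φ n s := fun n s =>
      sub_nonneg.2 (Real.exp_le_one_iff.2 (neg_nonpos.2 (Real.exp_nonneg _)))
    have φ_le : ∀ n s, φ n s ≤ 1 := fun n s => sub_le_self _ (Real.exp_nonneg _)
    have φ_cont : ∀ n, Continuous (φ n) := fun n => by fun_prop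
    have n_lim : Tendsto (fun n : ℕ => (n : ℝ) + 1) atTop atTop :=
      tendsto_atTop_add_const_right _ _ tendsto_natCast_atTop_atTop
    have lim1 : Tendsto (fun n => ∫ s in (0 : ℝ)..T, φ n s * f s) atTop
        (𝓝 (∫ s in (0 : ℝ)..T, (Iio x).indicator f s)) := by
      refine intervalIntegral.tendsto_integral_filter_of_dominated_convergence (fun s => |f s|)
        (Eventually.of_forall fun n => ?_) (Eventually.of_forall fun n => ?_) hf.abs ?_
      · exact (intervalIntegrable_iff.1
          (hf.continuousOn_mul (φ_cont n).continuousOn)).aestronglyMeasurable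
      · refine Eventually.of_forall fun s _ => ?_
        rw [norm_mul, Real.norm_eq_abs, Real.norm_eq_abs, abs_of_nonneg (φ_nonneg n s)]
        exact mul_le_of_le_one_left (abs_nonneg _) (φ_le n s)
      · have hne : ∀ᵐ s : ℝ, s ≠ x := by simp [ae_iff, measure_singleton]
        filter_upwards [hne] with s hs _
        rcases lt_or_gt_of_ne hs with h1 | h1
        · rw [indicator_of_mem (mem_Iio.2 h1)]
          have l : Tendsto (fun n => φ n s) atTop (𝓝 (1 - 0)) :=
            tendsto_const_nhds.sub (Real.tendsto_exp_neg_atTop_nhds_zero.comp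
              (Real.tendsto_exp_atTop.comp (n_lim.atTop_mul_const (sub_pos.2 h1))))
          simpa using l.mul_const (f s)
        · rw [indicator_of_notMem (by simpa using h1.le)]
          have l0 : Tendsto (fun n : ℕ => Real.exp (((n : ℝ) + 1) * (x - s))) atTop (𝓝 0) :=
            Real.tendsto_exp_atBot.comp (n_lim.atTop_mul_const_of_neg (sub_neg.2 h1))
          have l : Tendsto (fun n => φ n s) atTop (𝓝 (1 - Real.exp (-0))) :=
            tendsto_const_nhds.sub ((Real.continuous_exp.tendsto _).comp l0.neg)
          simpa using l.mul_const (f s)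
    -- Inserting the decay hypothesis term by term leaves an exponential series again, now in
    -- exp((n+1)(x-α)), which tends to 0 as x < α.
    have bd : ∀ n : ℕ, ‖∫ s in (0 : ℝ)..T, φ n s * f s‖
        ≤ C * (Real.exp (Real.exp ((n + 1) * (x - α))) - 1) := by
      intro n
      have hs := intervalIntegral.hasSum_integral_of_dominated_convergence (μ := volume)
        (a := 0) (b := T) (f := fun s => φ n s * f s)
        (F := fun (k : ℕ) s => -((-1) ^ (k + 1) / ((k + 1).factorial : ℝ))
          * Real.exp ((n + 1) * (x - s)) ^ (k + 1) * f s)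
        (fun k s => Real.exp ((n + 1) * x) ^ (k + 1) / ((k + 1).factorial : ℝ) * |f s|)
        (fun k => by
          refine (intervalIntegrable_iff.1 (hf.continuousOn_mul ?_)).aestronglyMeasurable
          fun_prop)
        (fun k => Eventually.of_forall fun s hs => by
          rw [uIoc_of_le hT] at hs
          rw [norm_mul, norm_mul, norm_neg, norm_div, norm_pow, norm_neg, norm_one, one_pow,
            norm_pow, Real.norm_eq_abs, Real.norm_eq_abs, Real.norm_eq_abs, Real.abs_exp,
            Nat.abs_cast, one_div_mul_eq_div]
          have h1 : (n + 1) * (x - s) ≤ ((n : ℝ) + 1) * x := by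
            have := hs.1; gcongr; linarith
          gcongr)
        (Eventually.of_forall fun s _ => by
          refine Summable.mul_right _ ?_
          exact (summable_nat_add_iff 1).2 (Real.summable_pow_div_factorial _))
        (by
          simp only [tsum_mul_right]
          exact hf.abs.const_mul _)
        (Eventually.of_forall fun s _ => (hasSum_one_sub_exp_neg _).mul_right _)
      have hexp : HasSum (fun k : ℕ => Real.exp ((n + 1) * (x - α)) ^ (k + 1)
          / ((k + 1).factorial : ℝ)) (Real.exp (Real.exp ((n + 1) * (x - α))) - 1) := by
        have h := NormedSpace.expSeries_div_hasSum_exp (𝔸 := ℝ) (Real.exp ((n + 1) * (x - α)))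
        rw [← Real.exp_eq_exp_ℝ] at h
        simpa using (hasSum_nat_add_iff' 1).2 h
      refine hs.norm_le_of_bounded (hexp.mul_left C) fun k => ?_
      have hk : (0 : ℝ) < (k + 1) * (n + 1) := by positivity
      have e1 : (∫ s in (0 : ℝ)..T, -((-1) ^ (k + 1) / ((k + 1).factorial : ℝ))
          * Real.exp ((n + 1) * (x - s)) ^ (k + 1) * f s)
          = -((-1) ^ (k + 1) / ((k + 1).factorial : ℝ)) * (Real.exp ((k + 1) * (n + 1) * x) *
            ∫ s in (0 : ℝ)..T, Real.exp (-((k + 1) * (n + 1)) * s) * f s) := by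
        rw [← intervalIntegral.integral_const_mul, ← intervalIntegral.integral_const_mul]
        refine intervalIntegral.integral_congr fun s _ => ?_
        rw [← Real.exp_nat_mul, ← mul_assoc (Real.exp _), ← Real.exp_add]
        push_cast
        ring_nf
      have e2 := h _ hk
      rw [truncLaplace_ofReal, Complex.norm_real] at e2
      rw [e1, norm_mul, norm_mul, norm_neg, norm_div, norm_pow, norm_neg, norm_one, one_pow,
        Real.norm_eq_abs, Real.norm_eq_abs, Real.abs_exp, Nat.abs_cast]
      calc 1 / ((k + 1).factorial : ℝ) * (Real.exp ((k + 1) * (n + 1) * x) *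
            ‖∫ s in (0 : ℝ)..T, Real.exp (-((k + 1) * (n + 1)) * s) * f s‖)
          ≤ 1 / ((k + 1).factorial : ℝ) * (Real.exp ((k + 1) * (n + 1) * x) *
            (C * Real.exp (-α * ((k + 1) * (n + 1))))) := by gcongr
        _ = _ := by
          rw [← Real.exp_nat_mul, mul_left_comm (Real.exp _), ← Real.exp_add]
          push_cast
          ring_nf
    have lim2 : Tendsto (fun n => ∫ s in (0 : ℝ)..T, φ n s * f s) atTop (𝓝 0) := by
      refine squeeze_zero_norm bd ?_
      have l0 : Tendsto (fun n : ℕ => Real.exp (((n : ℝ) + 1) * (x - α))) atTop (𝓝 0) :=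
        Real.tendsto_exp_atBot.comp (n_lim.atTop_mul_const_of_neg (sub_neg.2 hx.2))
      have l1 := (((Real.continuous_exp.tendsto _).comp l0).sub_const 1).const_mul C
      simpa using l1
    have e := tendsto_nhds_unique lim1 lim2
    rw [intervalIntegral.integral_of_le hT, setIntegral_indicator measurableSet_Iio] at e
    rw [intervalIntegral.integral_of_le hx.1, integral_Ioc_eq_integral_Ioo]
    have hset : Ioo 0 x = Ioc 0 T ∩ Iio x := by
      ext s
      simp only [mem_Ioo, mem_inter_iff, mem_Ioc, mem_Iio]
      constructor
      · exact fun h => ⟨⟨h.1, by linarith [h.2, hx.2]⟩, h.2⟩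
      · exact fun h => ⟨h.1.1, h.2⟩
    rw [hset, e]
  intro x hx
  rcases eq_or_lt_of_le hα with h0 | h0
  · have : x = 0 := le_antisymm (by linarith [hx.2]) hx.1
    simp [this]
  have hcont : ContinuousOn (fun x => ∫ s in (0 : ℝ)..x, f s) (Icc 0 α) := by
    have := continuousOn_primitive_interval' (μ := volume) (a := 0)
      (hf.mono_set (by rw [uIcc_of_le hα, uIcc_of_le hT]; exact Icc_subset_Icc_right hαT))
      left_mem_uIcc
    rwa [uIcc_of_le hα] at this
  have : Icc 0 α ⊆ closure (Ico 0 α) := by rw [closure_Ico h0.ne]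
  exact (EqOn.of_subset_closure main hcont continuousOn_const Ico_subset_Icc_self this) hx

/-- **Titchmarsh's convolution theorem** on a finite interval. -/
theorem titchmarsh (hT : 0 ≤ T) (hf : IntervalIntegrable f volume 0 T)
    (hg : IntervalIntegrable g volume 0 T)
    (hfg : ∀ t ∈ Icc 0 T, HeatMemory.conv f g t = 0) :
    ∃ α ∈ Icc 0 T, (∀ x ∈ Icc 0 α, ∫ s in (0 : ℝ)..x, f s = 0) ∧
      ∀ x ∈ Icc 0 (T - α), ∫ s in (0 : ℝ)..x, g s = 0 := by
  by_cases hF0 : ∀ x : ℝ, 0 < x → truncLaplace T f x = 0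
  · refine ⟨T, ⟨hT, le_rfl⟩, integral_eq_zero_of_truncLaplace_le (C := 0) hT le_rfl hf
      fun x hx => by simp [hF0 x hx], fun x hx => ?_⟩
    rw [sub_self, Icc_self, mem_singleton_iff] at hx
    simp [hx]
  by_cases hG0 : ∀ x : ℝ, 0 < x → truncLaplace T g x = 0
  · refine ⟨0, ⟨le_rfl, hT⟩, fun x hx => ?_, ?_⟩
    · rw [Icc_self, mem_singleton_iff] at hx
      simp [hx]
    · rw [sub_zero]
      exact integral_eq_zero_of_truncLaplace_le (C := 0) hT le_rfl hg fun x hx => by simp [hG0 x hx]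
  push Not at hF0 hG0
  obtain ⟨x₀, hx₀, hFx₀⟩ := hF0
  -- Adding 1 keeps the normalising constants positive.
  set A := (∫ x in (0 : ℝ)..T, |f x|) + 1 with hA
  set B := (∫ x in (0 : ℝ)..T, |g x|) + 1 with hB
  have hA0 : 0 < A := by
    have : 0 ≤ ∫ x in (0 : ℝ)..T, |f x| := integral_nonneg hT fun _ _ => abs_nonneg _
    linarith
  have hB0 : 0 < B := by
    have : 0 ≤ ∫ x in (0 : ℝ)..T, |g x| := integral_nonneg hT fun _ _ => abs_nonneg _
    linarith
  let F : ℂ → ℂ := fun z => ((A⁻¹ : ℝ) : ℂ) * truncLaplace T f z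
  let G : ℂ → ℂ := fun z => ((B⁻¹ : ℝ) : ℂ) * truncLaplace T g z
  have nF : ∀ z, ‖F z‖ = A⁻¹ * ‖truncLaplace T f z‖ := fun z => by
    rw [norm_mul, Complex.norm_real, Real.norm_eq_abs, abs_of_pos (inv_pos.2 hA0)]
  have nG : ∀ z, ‖G z‖ = B⁻¹ * ‖truncLaplace T g z‖ := fun z => by
    rw [norm_mul, Complex.norm_real, Real.norm_eq_abs, abs_of_pos (inv_pos.2 hB0)]
  have dF : Differentiable ℂ F := (differentiable_truncLaplace hT hf).const_mul _
  have dG : Differentiable ℂ G := (differentiable_truncLaplace hT hg).const_mul _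
  have bF : ∀ z : ℂ, 0 ≤ z.re → ‖F z‖ ≤ 1 := fun z hz => by
    rw [nF, inv_mul_le_iff₀ hA0, mul_one]
    linarith [norm_truncLaplace_le hT hf hz]
  have bG : ∀ z : ℂ, 0 ≤ z.re → ‖G z‖ ≤ 1 := fun z hz => by
    rw [nG, inv_mul_le_iff₀ hB0, mul_one]
    linarith [norm_truncLaplace_le hT hg hz]
  have bFG : ∀ z : ℂ, 0 ≤ z.re → ‖F z * G z‖ ≤ 1 * Real.exp (-T * z.re) := fun z hz => by
    have h1 := norm_truncLaplace_mul_le hT hf hg hfg hz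
    rw [norm_mul] at h1
    rw [norm_mul, nF, nG, one_mul]
    have h2 : ((∫ x in (0 : ℝ)..T, |f x|) * ∫ x in (0 : ℝ)..T, |g x|) ≤ A * B := by
      have : 0 ≤ ∫ x in (0 : ℝ)..T, |g x| := integral_nonneg hT fun _ _ => abs_nonneg _
      gcongr <;> linarith
    have h3 : ‖truncLaplace T f z‖ * ‖truncLaplace T g z‖ ≤ (A * B) * Real.exp (-T * z.re) :=
      h1.trans (by gcongr)
    calc A⁻¹ * ‖truncLaplace T f z‖ * (B⁻¹ * ‖truncLaplace T g z‖)
        = (A * B)⁻¹ * (‖truncLaplace T f z‖ * ‖truncLaplace T g z‖) := by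
          rw [mul_inv]; ring
      _ ≤ (A * B)⁻¹ * ((A * B) * Real.exp (-T * z.re)) := by gcongr
      _ = _ := by rw [inv_mul_cancel_left₀ (by positivity)]
  have key : ∀ x x' : ℝ, 0 < x → 0 < x' → truncLaplace T f x ≠ 0 → truncLaplace T g x' ≠ 0 →
      Real.log ‖F x‖ / x + Real.log ‖G x'‖ / x' ≤ -T := fun x x' hx hx' h1 h2 =>
    log_norm_div_add_le dF dG bF bG one_pos bFG hx hx'
      (mul_ne_zero (by exact_mod_cast (inv_pos.2 hA0).ne') h1)
      (mul_ne_zero (by exact_mod_cast (inv_pos.2 hB0).ne') h2)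
  have negF : ∀ x : ℝ, 0 < x → Real.log ‖F x‖ / x ≤ 0 := fun x hx =>
    div_nonpos_of_nonpos_of_nonneg (Real.log_nonpos (norm_nonneg _) (bF x (by simpa using hx.le)))
      hx.le
  have negG : ∀ x : ℝ, 0 < x → Real.log ‖G x‖ / x ≤ 0 := fun x hx =>
    div_nonpos_of_nonpos_of_nonneg (Real.log_nonpos (norm_nonneg _) (bG x (by simpa using hx.le)))
      hx.le
  -- The infimum of `S` is the best decay rate of `F` valid at every point. By `key`, every rate of
  -- `G` is at least `T` minus any element of `S`, hence at least T - inf S. The infimum may exceed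
  -- `T`, so it is capped below.
  let S : Set ℝ := {r | ∃ x : ℝ, 0 < x ∧ truncLaplace T f x ≠ 0 ∧ r = -(Real.log ‖F x‖ / x)}
  have hSne : S.Nonempty := ⟨_, x₀, hx₀, hFx₀, rfl⟩
  have hS0 : ∀ r ∈ S, 0 ≤ r := by
    rintro r ⟨x, hx, -, rfl⟩
    linarith [negF x hx]
  have hSb : BddBelow S := ⟨0, hS0⟩
  have decay : ∀ (u : ℝ) (v D x : ℝ), 0 < x → 0 < D → 0 < u → Real.log (D⁻¹ * u) / x ≤ -v →
      u ≤ D * Real.exp (-v * x) := by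
    intro u v D x hx hD hu h1
    rw [div_le_iff₀ hx] at h1
    have h2 := (Real.log_le_iff_le_exp (by positivity)).1 h1
    rwa [inv_mul_le_iff₀ hD] at h2
  refine ⟨min T (sInf S), ⟨le_min hT (le_csInf hSne hS0), min_le_left _ _⟩,
    integral_eq_zero_of_truncLaplace_le (C := A) (le_min hT (le_csInf hSne hS0))
      (min_le_left _ _) hf fun x hx => ?_,
    integral_eq_zero_of_truncLaplace_le (C := B) (sub_nonneg.2 (min_le_left _ _))
      (sub_le_self _ (le_min hT (le_csInf hSne hS0))) hg fun x hx => ?_⟩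
  · by_cases h0 : truncLaplace T f x = 0
    · rw [h0, norm_zero]; positivity
    refine decay _ _ _ x hx hA0 (norm_pos_iff.2 h0) ?_
    rw [← nF]
    have : sInf S ≤ -(Real.log ‖F x‖ / x) := csInf_le hSb ⟨x, hx, h0, rfl⟩
    linarith [min_le_right T (sInf S)]
  · by_cases h0 : truncLaplace T g x = 0
    · rw [h0, norm_zero]; positivity
    refine decay _ _ _ x hx hB0 (norm_pos_iff.2 h0) ?_
    rw [← nG]
    have h1 : T + Real.log ‖G x‖ / x ≤ sInf S := by
      refine le_csInf hSne ?_
      rintro r ⟨y, hy, hy0, rfl⟩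
      linarith [key y x hy hx hy0 h0]
    have h2 : T + Real.log ‖G x‖ / x ≤ min T (sInf S) := le_min (by linarith [negG x hx]) h1
    linarith

end Titchmarsh

/-! ### Convolution on the half line as a commutative ring. -/

section ConvolutionAlgebra

open scoped NNReal

open HeatMemory

lemma integral_triangle_swap {Φ : ℝ → ℝ → ℝ} (hΦ : Continuous fun p : ℝ × ℝ => Φ p.1 p.2) {t : ℝ}
    (ht : 0 ≤ t) :
    ∫ s in (0 : ℝ)..t, ∫ q in s..t, Φ s q = ∫ q in (0 : ℝ)..t, ∫ s in (0 : ℝ)..q, Φ s q := by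
  let D : Set (ℝ × ℝ) := {p | p.1 < p.2}
  have hD : MeasurableSet D := measurableSet_lt measurable_fst measurable_snd
  have hint : Integrable (fun p : ℝ × ℝ => D.indicator (fun p => Φ p.1 p.2) p)
      ((volume.restrict (Ioc 0 t)).prod (volume.restrict (Ioc 0 t))) := by
    refine Integrable.indicator ?_ hD
    rw [Measure.prod_restrict]
    exact (hΦ.continuousOn.integrableOn_compact (isCompact_Icc.prod isCompact_Icc)).mono_set
      (prod_mono Ioc_subset_Icc_self Ioc_subset_Icc_self)
  have key := integral_integral_swap (f := fun s q => D.indicator (fun p => Φ p.1 p.2) (s, q)) hint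
  rw [intervalIntegral.integral_of_le ht, intervalIntegral.integral_of_le ht]
  convert! key using 1
  · refine setIntegral_congr_fun measurableSet_Ioc fun s hs => ?_
    have : ∀ q, D.indicator (fun p => Φ p.1 p.2) (s, q) = (Ioi s).indicator (Φ s) q := fun q => by
      by_cases h : s < q <;> simp [D, indicator, h]
    simp only [this]
    rw [setIntegral_indicator measurableSet_Ioi, intervalIntegral.integral_of_le hs.2]
    congr 2
    ext q
    simp only [mem_Ioc, mem_inter_iff, mem_Ioi]
    exact ⟨fun h => ⟨⟨hs.1.trans h.1, h.2⟩, h.1⟩, fun h => ⟨h.2, h.1.2⟩⟩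
  · refine setIntegral_congr_fun measurableSet_Ioc fun q hq => ?_
    have : ∀ s, D.indicator (fun p => Φ p.1 p.2) (s, q) = (Iio q).indicator (Φ · q) s := fun s => by
      by_cases h : s < q <;> simp [D, indicator, h]
    simp only [this]
    rw [setIntegral_indicator measurableSet_Iio, intervalIntegral.integral_of_le hq.1.le,
      integral_Ioc_eq_integral_Ioo]
    congr 2
    ext s
    simp only [mem_Ioc, mem_Ioo, mem_inter_iff, mem_Iio]
    exact ⟨fun h => ⟨⟨h.1, h.2.le.trans hq.2⟩, h.2⟩, fun h => ⟨h.1.1, h.2⟩⟩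

lemma conv_comm (u v : ℝ → ℝ) (t : ℝ) : conv u v t = conv v u t := by
  unfold conv
  have := intervalIntegral.integral_comp_sub_left (fun s => v (t - s) * u s) t (a := 0) (b := t)
  simp only [sub_zero, sub_self, sub_sub_cancel] at this
  rw [← this]
  exact intervalIntegral.integral_congr fun s _ => mul_comm _ _

lemma conv_congr {u u' v v' : ℝ → ℝ} {t : ℝ} (ht : 0 ≤ t) (hu : ∀ s ∈ Icc 0 t, u s = u' s)
    (hv : ∀ s ∈ Icc 0 t, v s = v' s) : conv u v t = conv u' v' t := by
  refine intervalIntegral.integral_congr fun s hs => ?_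
  rw [uIcc_of_le ht] at hs
  simp only [hv s hs, hu (t - s) ⟨by linarith [hs.2], by linarith [hs.1]⟩]

lemma continuous_conv {u v : ℝ → ℝ} (hu : Continuous u) (hv : Continuous v) :
    Continuous (conv u v) := by
  unfold conv
  exact intervalIntegral.continuous_parametric_intervalIntegral_of_continuous
    (by fun_prop) continuous_id

lemma conv_assoc_of_continuous {u v w : ℝ → ℝ} (hu : Continuous u) (hv : Continuous v)
    (hw : Continuous w) {t : ℝ} (ht : 0 ≤ t) :
    conv (conv u v) w t = conv u (conv v w) t := by
  have h := integral_triangle_swap (Φ := fun s q => u (t - q) * v (q - s) * w s)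
    (by fun_prop) ht
  unfold conv
  convert! h using 1
  · refine intervalIntegral.integral_congr fun s _ => ?_
    rw [intervalIntegral.integral_mul_const]
    congr 1
    have := intervalIntegral.integral_comp_sub_right (fun r => u (t - s - r) * v r) s
      (a := s) (b := t)
    rw [sub_self] at this
    rw [← this]
    refine intervalIntegral.integral_congr fun q _ => ?_
    simp
  · refine intervalIntegral.integral_congr fun q _ => ?_
    rw [← intervalIntegral.integral_const_mul]
    refine intervalIntegral.integral_congr fun s _ => ?_
    ring

/-- The continuous functions on `[0,∞)`, which form an algebra under convolution. -/
def Causal : Type := C(ℝ≥0, ℝ)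

namespace Causal

instance : AddCommGroup Causal := inferInstanceAs (AddCommGroup C(ℝ≥0, ℝ))
instance : Module ℝ Causal := inferInstanceAs (Module ℝ C(ℝ≥0, ℝ))

/-- The extension of a function on `[0,∞)` to a function on `ℝ`. -/
def ext (u : Causal) (t : ℝ) : ℝ := ContinuousMap.toFun u t.toNNReal

lemma continuous_ext (u : Causal) : Continuous u.ext :=
  (ContinuousMap.continuous_toFun u).comp continuous_real_toNNReal

@[ext] lemma ext_of {u v : Causal} (h : ∀ t : ℝ, 0 ≤ t → u.ext t = v.ext t) : u = v := by
  refine ContinuousMap.ext fun t => ?_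
  have h1 : ContinuousMap.toFun u (t : ℝ).toNNReal = ContinuousMap.toFun v (t : ℝ).toNNReal :=
    h t t.2
  rw [Real.toNNReal_coe] at h1
  exact h1

/-- The restriction to `[0,∞)`. -/
def mk (u : ℝ → ℝ) (hu : ContinuousOn u (Ici 0)) : Causal :=
  (⟨fun t : ℝ≥0 => u t, hu.comp_continuous NNReal.continuous_coe fun t => t.2⟩ : C(ℝ≥0, ℝ))

lemma ext_mk {u : ℝ → ℝ} {hu : ContinuousOn u (Ici 0)} {t : ℝ} (ht : 0 ≤ t) :
    (mk u hu).ext t = u t := by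
  change u (t.toNNReal : ℝ) = u t
  rw [Real.coe_toNNReal _ ht]

@[simp] lemma ext_add (u v : Causal) (t : ℝ) : (u + v).ext t = u.ext t + v.ext t := rfl
@[simp] lemma ext_smul (c : ℝ) (u : Causal) (t : ℝ) : (c • u).ext t = c * u.ext t := rfl

noncomputable instance : Mul Causal :=
  ⟨fun u v => mk (conv u.ext v.ext) (continuous_conv u.continuous_ext v.continuous_ext).continuousOn⟩

lemma ext_mul (u v : Causal) {t : ℝ} (ht : 0 ≤ t) : (u * v).ext t = conv u.ext v.ext t :=
  ext_mk ht

lemma conv_ext_add (u v w : Causal) (t : ℝ) :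
    conv u.ext (v + w).ext t = conv u.ext v.ext t + conv u.ext w.ext t := by
  unfold conv
  rw [← intervalIntegral.integral_add]
  · simp only [ext_add, mul_add]
  all_goals
    refine Continuous.intervalIntegrable ?_ _ _
    have := u.continuous_ext
    have := v.continuous_ext
    have := w.continuous_ext
    fun_prop

lemma mul_comm' (u v : Causal) : u * v = v * u := by
  ext t ht
  rw [ext_mul _ _ ht, ext_mul _ _ ht, conv_comm]

lemma mul_add' (u v w : Causal) : u * (v + w) = u * v + u * w := by
  ext t ht
  rw [ext_mul _ _ ht, ext_add, ext_mul _ _ ht, ext_mul _ _ ht, conv_ext_add]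

lemma mul_smul' (c : ℝ) (u v : Causal) : u * (c • v) = c • (u * v) := by
  ext t ht
  rw [ext_mul _ _ ht, ext_smul, ext_mul _ _ ht]
  unfold conv
  rw [← intervalIntegral.integral_const_mul]
  refine intervalIntegral.integral_congr fun s _ => ?_
  simp only [ext_smul]
  ring

lemma mul_assoc' (u v w : Causal) : u * v * w = u * (v * w) := by
  ext t ht
  rw [ext_mul _ _ ht, ext_mul _ _ ht]
  rw [conv_congr (u' := conv u.ext v.ext) (v' := w.ext) ht
    (fun s hs => ext_mul _ _ hs.1) (fun _ _ => rfl),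
    conv_assoc_of_continuous u.continuous_ext v.continuous_ext w.continuous_ext ht]
  exact (conv_congr ht (fun _ _ => rfl) fun s hs => ext_mul _ _ hs.1).symm

noncomputable instance : NonUnitalCommRing Causal where
  mul := (· * ·)
  left_distrib := mul_add'
  right_distrib u v w := by
    rw [mul_comm', mul_add', mul_comm' w u, mul_comm' w v]
  zero_mul u := by
    have := mul_smul' 0 u u
    rw [mul_comm']
    simpa using this
  mul_zero u := by simpa using mul_smul' 0 u u
  mul_assoc := mul_assoc'
  mul_comm := mul_comm'

instance : SMulCommClass ℝ Causal Causal := ⟨fun c u v => (mul_smul' c u v).symm⟩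

instance : IsScalarTower ℝ Causal Causal :=
  ⟨fun c u v => by
    change (c • u) * v = c • (u * v)
    rw [mul_comm', mul_smul', mul_comm']⟩

end Causal

/-- The convolution algebra of continuous functions on `[0,∞)` with a unit adjoined. -/
abbrev ConvAlg : Type := Unitization ℝ Causal

open Classical in
/-- The class in the convolution algebra of a function that is continuous on `[0,∞)`. -/
noncomputable def toConv (u : ℝ → ℝ) : ConvAlg :=
  -- The junk value 0 makes `toConv` total, so identities can be rewritten without carrying
  -- continuity proofs inside the terms.
  if h : ContinuousOn u (Ici 0) then (Causal.mk u h : Causal) else 0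

section toConv

variable {u v w : ℝ → ℝ}

lemma toConv_of (hu : ContinuousOn u (Ici 0)) : toConv u = (Causal.mk u hu : Causal) :=
  dif_pos hu

lemma continuousOn_conv (hu : ContinuousOn u (Ici 0)) (hv : ContinuousOn v (Ici 0)) :
    ContinuousOn (conv u v) (Ici 0) := by
  have := continuous_conv (Causal.mk u hu).continuous_ext (Causal.mk v hv).continuous_ext
  exact this.continuousOn.congr fun t ht => conv_congr ht
    (fun s hs => (Causal.ext_mk hs.1).symm) fun s hs => (Causal.ext_mk hs.1).symm

lemma toConv_congr (h : ∀ t, 0 ≤ t → u t = v t) : toConv u = toConv v := by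
  by_cases hu : ContinuousOn u (Ici 0)
  · have hv : ContinuousOn v (Ici 0) := hu.congr fun t ht => (h t ht).symm
    rw [toConv_of hu, toConv_of hv]
    congr 1
    ext t ht
    rw [Causal.ext_mk ht, Causal.ext_mk ht, h t ht]
  · have hv : ¬ ContinuousOn v (Ici 0) := fun hv => hu (hv.congr h)
    rw [toConv, toConv, dif_neg hu, dif_neg hv]

lemma eq_of_toConv_eq (hu : ContinuousOn u (Ici 0)) (hv : ContinuousOn v (Ici 0))
    (h : toConv u = toConv v) {t : ℝ} (ht : 0 ≤ t) : u t = v t := by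
  rw [toConv_of hu, toConv_of hv] at h
  have h1 := Unitization.inr_injective h
  rw [← Causal.ext_mk (hu := hu) ht, h1, Causal.ext_mk ht]

lemma toConv_add (hu : ContinuousOn u (Ici 0)) (hv : ContinuousOn v (Ici 0)) :
    toConv (fun t => u t + v t) = toConv u + toConv v := by
  rw [toConv_of hu, toConv_of hv, toConv_of (u := fun t => u t + v t) (hu.add hv),
    ← Unitization.inr_add]
  rfl

lemma toConv_const_mul (c : ℝ) (hu : ContinuousOn u (Ici 0)) :
    toConv (fun t => c * u t) = algebraMap ℝ ConvAlg c * toConv u := by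
  rw [toConv_of hu, toConv_of (u := fun t => c * u t) (hu.const_mul c), ← Algebra.smul_def,
    ← Unitization.inr_smul]
  rfl

lemma toConv_conv (hu : ContinuousOn u (Ici 0)) (hv : ContinuousOn v (Ici 0)) :
    toConv (conv u v) = toConv u * toConv v := by
  rw [toConv_of hu, toConv_of hv, toConv_of (continuousOn_conv hu hv), ← Unitization.inr_mul]
  congr 1
  ext t ht
  rw [Causal.ext_mk ht, Causal.ext_mul _ _ ht]
  exact conv_congr ht (fun s hs => (Causal.ext_mk hs.1).symm) fun s hs => (Causal.ext_mk hs.1).symm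

lemma conv_one (u : ℝ → ℝ) (t : ℝ) : conv (fun _ => 1) u t = ∫ s in (0 : ℝ)..t, u s := by
  simp [conv]

/-- Convolution with the constant `1`, that is integration from `0`, is injective. -/
lemma eq_of_one_conv_eq (hu : ContinuousOn u (Ici 0)) (hv : ContinuousOn v (Ici 0))
    (h : toConv (fun _ => 1) * toConv u = toConv (fun _ => 1) * toConv v) {t : ℝ} (ht : 0 ≤ t) :
    u t = v t := by
  rw [← toConv_conv continuousOn_const hu, ← toConv_conv continuousOn_const hv] at h
  have h1 : ∀ s, 0 ≤ s → ∫ r in (0 : ℝ)..s, (Causal.mk u hu).ext r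
      = ∫ r in (0 : ℝ)..s, (Causal.mk v hv).ext r := by
    intro s hs
    have := eq_of_toConv_eq (continuousOn_conv continuousOn_const hu)
      (continuousOn_conv continuousOn_const hv) h hs
    rw [← conv_one, ← conv_one]
    rw [conv_congr hs (fun _ _ => rfl) fun r hr => Causal.ext_mk hr.1,
      conv_congr hs (fun _ _ => rfl) fun r hr => Causal.ext_mk hr.1, this]
  have d : ∀ x : Causal, HasDerivWithinAt (fun s => ∫ r in (0 : ℝ)..s, x.ext r) (x.ext t)
      (Ici t) t := fun x =>
    (x.continuous_ext.integral_hasStrictDerivAt 0 t).hasDerivAt.hasDerivWithinAt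
  have e := (uniqueDiffWithinAt_Ici t).eq_deriv _
    ((d (Causal.mk u hu)).congr (fun s hs => (h1 s (ht.trans hs)).symm) (h1 t ht).symm)
    (d (Causal.mk v hv))
  rwa [Causal.ext_mk ht, Causal.ext_mk ht] at e

/-- A function with continuous derivative on `[0,∞)`, as an element of the convolution algebra. -/
lemma toConv_eq_of_hasDerivWithinAt (hv : ContinuousOn v (Ici 0))
    (h : ∀ t, 0 ≤ t → HasDerivWithinAt u (v t) (Ici 0) t) :
    toConv u = algebraMap ℝ ConvAlg (u 0) * toConv (fun _ => 1)
      + toConv (fun _ => 1) * toConv v := by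
  rw [← toConv_conv continuousOn_const hv, ← toConv_const_mul _ continuousOn_const,
    ← toConv_add continuousOn_const (continuousOn_conv continuousOn_const hv)]
  refine toConv_congr fun t ht => ?_
  rw [conv_one]
  have hi : IntervalIntegrable v volume 0 t :=
    (hv.mono (by rw [uIcc_of_le ht]; exact Icc_subset_Ici_self)).intervalIntegrable
  have := intervalIntegral.integral_eq_sub_of_hasDeriv_right_of_le ht
    (fun s hs => ((h s hs.1).continuousWithinAt).mono Icc_subset_Ici_self)
    (fun s hs => (h s hs.1.le).mono (Ioi_subset_Ici hs.1.le)) hi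
  rw [this]
  ring

end toConv

end ConvolutionAlgebra

/-! ### Modes: uniqueness, Duhamel's formula, reduction to a Volterra equation. -/

section Modes

open HeatMemory

variable {a β z u g : ℝ → ℝ} {l : ℝ}

/-- Integrate the mode equation from 0, using z(0) = 1. Collected, the left side is z times (unit +
β + l²·1·a): the mode plays the role of a resolvent, and later arguments only use this identity. -/
lemma HeatMemory.IsMode.toConv_eq (hz : IsMode a β l z) (ha : ContinuousOn a (Ici 0))
    (hβ : ContinuousOn β (Ici 0)) :
    toConv z + toConv β * toConv z + algebraMap ℝ ConvAlg (l ^ 2) * toConv (fun _ => 1) * toConv a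
      * toConv z = toConv (fun _ => 1) := by
  have hzc := hz.continuousOn
  have h := toConv_eq_of_hasDerivWithinAt (u := fun τ => z τ + conv β z τ)
    (v := fun t => -(l ^ 2) * conv a z t) ((continuousOn_conv ha hzc).const_mul _) hz.equation
  rw [toConv_add hzc (continuousOn_conv hβ hzc), toConv_conv hβ hzc,
    toConv_const_mul _ (continuousOn_conv ha hzc), toConv_conv ha hzc] at h
  have h0 : z 0 + conv β z 0 = 1 := by simp [conv, hz.initial]
  simp only [h0, map_one, map_neg] at h
  linear_combination h

/-- Multiplying each equation by the other mode gives 1*z = 1*z'. -/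
lemma HeatMemory.IsMode.unique {z' : ℝ → ℝ} (hz : IsMode a β l z) (hz' : IsMode a β l z')
    (ha : ContinuousOn a (Ici 0)) (hβ : ContinuousOn β (Ici 0)) {t : ℝ} (ht : 0 ≤ t) :
    z t = z' t := by
  have h := hz.toConv_eq ha hβ
  have h' := hz'.toConv_eq ha hβ
  refine eq_of_one_conv_eq hz.continuousOn hz'.continuousOn ?_ ht
  linear_combination toConv z' * h - toConv z * h'

/-- Duhamel's formula for a mode driven at the boundary. -/
lemma HeatMemory.IsMode.duhamel (hz : IsMode a β l z) (ha : ContinuousOn a (Ici 0))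
    (hβ : ContinuousOn β (Ici 0)) (hg : ContinuousOn g (Ici 0)) (hu : ContinuousOn u (Ici 0))
    (hu0 : u 0 = 0) {c : ℝ}
    (hequ : ∀ t, 0 ≤ t → HasDerivWithinAt (fun τ => u τ + conv β u τ)
      (conv a (fun s => -(l ^ 2) * u s + c * ∫ r in (0 : ℝ)..s, g r) t) (Ici 0) t)
    {t : ℝ} (ht : 0 ≤ t) :
    l ^ 2 * u t = c * ((∫ s in (0 : ℝ)..t, g s) - conv g z t - conv (conv g z) β t) := by
  have hzc := hz.continuousOn
  have h1c : ContinuousOn (fun _ : ℝ => (1 : ℝ)) (Ici 0) := continuousOn_const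
  have hG : ContinuousOn (fun t => ∫ s in (0 : ℝ)..t, g s) (Ici 0) :=
    (continuousOn_conv h1c hg).congr fun t _ => (conv_one g t).symm
  have eG : toConv (fun t => ∫ s in (0 : ℝ)..t, g s) = toConv (fun _ => 1) * toConv g := by
    rw [← toConv_conv h1c hg]
    exact toConv_congr fun t _ => (conv_one g t).symm
  have hsrc : ContinuousOn (fun s => -(l ^ 2) * u s + c * ∫ r in (0 : ℝ)..s, g r) (Ici 0) :=
    (hu.const_mul _).add (hG.const_mul _)
  have h := toConv_eq_of_hasDerivWithinAt (continuousOn_conv ha hsrc) hequ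
  rw [toConv_add hu (continuousOn_conv hβ hu), toConv_conv hβ hu, toConv_conv ha hsrc,
    toConv_add (hu.const_mul _) (hG.const_mul _), toConv_const_mul _ hu,
    toConv_const_mul _ hG, eG] at h
  have h0 : u 0 + conv β u 0 = 0 := by simp [conv, hu0]
  simp only [h0, map_zero, map_neg, zero_mul, zero_add] at h
  have hm := hz.toConv_eq ha hβ
  have hgz := continuousOn_conv hg hzc
  have hgzβ := continuousOn_conv hgz hβ
  have hd1 : ContinuousOn (fun t => -1 * conv g z t + -1 * conv (conv g z) β t) (Ici 0) :=
    (hgz.const_mul _).add (hgzβ.const_mul _)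
  have hd : ContinuousOn (fun t => (∫ s in (0 : ℝ)..t, g s)
      + (-1 * conv g z t + -1 * conv (conv g z) β t)) (Ici 0) := hG.add hd1
  have := eq_of_one_conv_eq (u := fun t => l ^ 2 * u t) (v := fun t => c *
    ((∫ s in (0 : ℝ)..t, g s) + (-1 * conv g z t + -1 * conv (conv g z) β t)))
    (hu.const_mul _) (hd.const_mul c) ?_ ht
  · rw [this]; ring
  rw [toConv_const_mul _ hu, toConv_const_mul _ hd, toConv_add hG hd1,
    toConv_add (hgz.const_mul _) (hgzβ.const_mul _), toConv_const_mul _ hgz,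
    toConv_const_mul _ hgzβ, toConv_conv hgz hβ, toConv_conv hg hzc, eG]
  simp only [map_neg, map_one]
  -- Multiplying the equation of `u` by z turns (unit + β + l²·1·a)u into 1·u. On the source side,
  -- l²·1·a·z is replaced by 1 - z - βz.
  linear_combination (-algebraMap ℝ ConvAlg (l ^ 2) * toConv u
    + toConv (fun _ => 1) * algebraMap ℝ ConvAlg c * toConv g) * hm
    + algebraMap ℝ ConvAlg (l ^ 2) * toConv z * h

/-- The equation c'' = -ω²c integrated twice, with c(0) = 1 and c'(0) = 0. -/
lemma toConv_cos (ω : ℝ) :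
    algebraMap ℝ ConvAlg (ω ^ 2) * toConv (fun _ => 1) * toConv (fun _ => 1)
      * toConv (fun t => Real.cos (ω * t))
      = toConv (fun _ => 1) - toConv (fun t => Real.cos (ω * t)) := by
  have hc : ContinuousOn (fun t => Real.cos (ω * t)) (Ici 0) := by fun_prop
  have hs : ContinuousOn (fun t => -ω * Real.sin (ω * t)) (Ici 0) := by fun_prop
  have h1 := toConv_eq_of_hasDerivWithinAt (u := fun t => Real.cos (ω * t)) hs fun t _ => by
    have := ((hasDerivAt_id t).const_mul ω).cos
    refine (this.congr_deriv ?_).hasDerivWithinAt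
    simp only [id]
    ring
  have h2 := toConv_eq_of_hasDerivWithinAt (u := fun t => -ω * Real.sin (ω * t))
    (v := fun t => -(ω ^ 2) * Real.cos (ω * t)) (by fun_prop) fun t _ => by
    have := (((hasDerivAt_id t).const_mul ω).sin).const_mul (-ω)
    refine (this.congr_deriv ?_).hasDerivWithinAt
    simp only [id]
    ring
  rw [toConv_const_mul _ hc] at h2
  simp only [mul_zero, Real.sin_zero, Real.cos_zero, map_zero, map_one, map_neg] at h1 h2
  linear_combination h1 + toConv (fun _ => 1) * h2

/-- The kernel of the Volterra equation satisfied by a mode of frequency `ω`. -/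
noncomputable def modeKernel (σ μ : ℝ → ℝ) (μ₀ ω t : ℝ) : ℝ :=
  σ t + (μ₀ * Real.cos (ω * t) + conv μ (fun s => Real.cos (ω * s)) t)

lemma continuousOn_modeKernel {σ μ : ℝ → ℝ} (hσ : ContinuousOn σ (Ici 0))
    (hμ : ContinuousOn μ (Ici 0)) (μ₀ ω : ℝ) : ContinuousOn (modeKernel σ μ μ₀ ω) (Ici 0) :=
  hσ.add (ContinuousOn.add (by fun_prop) (continuousOn_conv hμ (by fun_prop)))

/-- A mode is the sum of the wave `cos (ω t)` and a Volterra perturbation of lower order. -/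
lemma HeatMemory.IsMode.volterra (hz : IsMode a β l z) (ha : ContinuousOn a (Ici 0))
    (hβ : ContinuousOn β (Ici 0)) {σ μ : ℝ → ℝ} (hσ : ContinuousOn σ (Ici 0))
    (hμ : ContinuousOn μ (Ici 0)) {a₀ μ₀ ω : ℝ} (hω : ω ^ 2 = a₀ * l ^ 2)
    (haσ : ∀ t, 0 ≤ t → a t = a₀ * (1 + ∫ s in (0 : ℝ)..t, σ s))
    (hβμ : ∀ t, 0 ≤ t → β t = σ t + (μ₀ + ∫ s in (0 : ℝ)..t, μ s)) {t : ℝ} (ht : 0 ≤ t) :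
    z t = Real.cos (ω * t) - conv (modeKernel σ μ μ₀ ω) z t := by
  have hzc := hz.continuousOn
  have h1c : ContinuousOn (fun _ : ℝ => (1 : ℝ)) (Ici 0) := continuousOn_const
  have hc : ContinuousOn (fun t => Real.cos (ω * t)) (Ici 0) := by fun_prop
  have eI : ∀ v : ℝ → ℝ, ContinuousOn v (Ici 0) →
      ContinuousOn (fun t => ∫ s in (0 : ℝ)..t, v s) (Ici 0) ∧
      toConv (fun t => ∫ s in (0 : ℝ)..t, v s) = toConv (fun _ => 1) * toConv v := by
    intro v hv
    refine ⟨(continuousOn_conv h1c hv).congr fun t _ => (conv_one v t).symm, ?_⟩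
    rw [← toConv_conv h1c hv]
    exact toConv_congr fun t _ => (conv_one v t).symm
  have ea : toConv a = algebraMap ℝ ConvAlg a₀
      * (toConv (fun _ => 1) + toConv (fun _ => 1) * toConv σ) := by
    rw [← (eI σ hσ).2, ← toConv_add h1c (eI σ hσ).1,
      ← toConv_const_mul (u := fun t => 1 + ∫ s in (0 : ℝ)..t, σ s) _ (h1c.add (eI σ hσ).1)]
    exact toConv_congr haσ
  have eβ : toConv β = toConv σ + (algebraMap ℝ ConvAlg μ₀ * toConv (fun _ => 1)
      + toConv (fun _ => 1) * toConv μ) := by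
    rw [← (eI μ hμ).2, ← toConv_const_mul _ h1c,
      ← toConv_add (u := fun _ => μ₀ * 1) continuousOn_const (eI μ hμ).1,
      ← toConv_add (v := fun t => μ₀ * 1 + ∫ s in (0 : ℝ)..t, μ s) hσ
        (ContinuousOn.add continuousOn_const (eI μ hμ).1)]
    exact toConv_congr fun t ht => by simpa using hβμ t ht
  have hκ := continuousOn_modeKernel hσ hμ μ₀ ω
  have eκ : toConv (modeKernel σ μ μ₀ ω) = toConv σ
      + (algebraMap ℝ ConvAlg μ₀ * toConv (fun t => Real.cos (ω * t))
        + toConv μ * toConv (fun t => Real.cos (ω * t))) := by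
    unfold modeKernel
    rw [toConv_add (v := fun t => μ₀ * Real.cos (ω * t) + conv μ (fun s => Real.cos (ω * s)) t) hσ
        ((hc.const_mul _).add (continuousOn_conv hμ hc)),
      toConv_add (hc.const_mul _) (continuousOn_conv hμ hc), toConv_const_mul _ hc,
      toConv_conv hμ hc]
  have hm := hz.toConv_eq ha hβ
  have hcos := toConv_cos ω
  rw [hω, map_mul] at hcos
  rw [ea, eβ] at hm
  have := eq_of_one_conv_eq (u := fun t => z t + conv (modeKernel σ μ μ₀ ω) z t)
    (hzc.add (continuousOn_conv hκ hzc)) hc ?_ ht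
  · linarith
  rw [toConv_add hzc (continuousOn_conv hκ hzc), toConv_conv hκ hzc, eκ]
  -- Multiply the mode equation by c = cos(ω·). The large term is ω²·1·1·(unit + σ)cz, and `hcos`
  -- replaces ω²·1·1·c by 1 - c. The cσz produced cancels the part σ of β, and what remains of β is
  -- 1 convolved with a continuous function plus a constant, so a factor 1 can be cancelled
  -- throughout.
  linear_combination toConv (fun t => Real.cos (ω * t)) * hm
    - toConv z * (1 + toConv σ) * hcos

end Modes

/-! ### Bounded convergence of the square-wave Fourier series. -/

section SquareWave

/-- The partial sums of the Fourier series of a square wave. -/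
noncomputable def oddSineSum (N : ℕ) (u : ℝ) : ℝ :=
  ∑ n ∈ Finset.range N, Real.sin ((2 * n + 1) * u) / (2 * n + 1)

lemma two_mul_sin_mul_sum_cos (N : ℕ) (u : ℝ) :
    2 * Real.sin u * ∑ n ∈ Finset.range N, Real.cos ((2 * n + 1) * u) = Real.sin (2 * N * u) := by
  induction N with
  | zero => simp
  | succ N ih =>
    rw [Finset.sum_range_succ, mul_add, ih, Real.two_mul_sin_mul_cos]
    push_cast
    rw [show u - (2 * N + 1) * u = -(2 * N * u) by ring,
      show u + (2 * N + 1) * u = 2 * (N + 1) * u by ring, Real.sin_neg]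
    ring

lemma hasDerivAt_oddSineSum (N : ℕ) (u : ℝ) :
    HasDerivAt (oddSineSum N) (∑ n ∈ Finset.range N, Real.cos ((2 * n + 1) * u)) u := by
  unfold oddSineSum
  refine HasDerivAt.fun_sum fun n _ => ?_
  have := (((hasDerivAt_id u).const_mul (2 * (n : ℝ) + 1)).sin).div_const (2 * n + 1)
  refine this.congr_deriv ?_
  have : (2 * (n : ℝ) + 1) ≠ 0 := by positivity
  field_simp
  simp

/-- The partial sum has derivative sin(2Nv)/(2 sin v). The O(1/N) correction cancels it, and what is
left has a fixed sign on (0, π/2] for κ = 1 and for κ = -1, which gives monotonicity in place of an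
oscillatory integral estimate. -/
lemma hasDerivAt_oddSineSum_add {N : ℕ} (hN : 0 < N) (κ : ℝ) {v : ℝ} (hv : Real.sin v ≠ 0) :
    HasDerivAt (fun v => oddSineSum N v + (Real.cos (2 * N * v) + κ) / (4 * N * Real.sin v))
      (-(Real.cos (2 * N * v) + κ) * Real.cos v / (4 * N * Real.sin v ^ 2)) v := by
  have hN' : (N : ℝ) ≠ 0 := by positivity
  have h1 := ((((hasDerivAt_id v).const_mul (2 * (N : ℝ))).cos).add_const κ).div
    ((Real.hasDerivAt_sin v).const_mul (4 * (N : ℝ))) (by positivity)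
  refine ((hasDerivAt_oddSineSum N v).add h1).congr_deriv ?_
  have h2 := two_mul_sin_mul_sum_cos N v
  have h3 : ∑ n ∈ Finset.range N, Real.cos ((2 * n + 1) * v)
      = Real.sin (2 * N * v) / (2 * Real.sin v) := by
    rw [← h2, mul_div_cancel_left₀ _ (mul_ne_zero two_ne_zero hv)]
  rw [h3]
  simp only [id]
  field_simp
  ring

lemma abs_oddSineSum_sub_le_aux {N : ℕ} (hN : 0 < N) {u : ℝ} (hu : 0 < u)
    (hu2 : u ≤ Real.pi / 2) :
    |oddSineSum N u - oddSineSum N (Real.pi / 2)| ≤ 1 / (2 * N * Real.sin u) := by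
  have hN' : (0 : ℝ) < N := by exact_mod_cast hN
  have hsin : ∀ v ∈ Icc u (Real.pi / 2), 0 < Real.sin v := fun v hv =>
    Real.sin_pos_of_pos_of_lt_pi (hu.trans_le hv.1) (by linarith [hv.2, Real.pi_pos])
  have hcos : ∀ v ∈ Icc u (Real.pi / 2), 0 ≤ Real.cos v := fun v hv =>
    Real.cos_nonneg_of_neg_pi_div_two_le_of_le (by linarith [hv.1, Real.pi_pos]) hv.2
  have d := fun (κ v : ℝ) (hv : v ∈ Icc u (Real.pi / 2)) =>
    hasDerivAt_oddSineSum_add hN κ (hsin v hv).ne'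
  have cont := fun κ : ℝ => fun v hv => (d κ v hv).continuousAt.continuousWithinAt
    (s := Icc u (Real.pi / 2))
  have hint := fun v (hv : v ∈ interior (Icc u (Real.pi / 2))) => interior_subset hv
  have anti := antitoneOn_of_deriv_nonpos (convex_Icc u (Real.pi / 2)) (cont 1)
    (fun v hv => (d 1 v (hint v hv)).differentiableAt.differentiableWithinAt) fun v hv => by
      rw [(d 1 v (hint v hv)).deriv]
      refine div_nonpos_of_nonpos_of_nonneg ?_ (by positivity)
      have := Real.neg_one_le_cos (2 * N * v)
      exact mul_nonpos_of_nonpos_of_nonneg (by linarith) (hcos v (hint v hv))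
  have mono := monotoneOn_of_deriv_nonneg (convex_Icc u (Real.pi / 2)) (cont (-1))
    (fun v hv => (d (-1) v (hint v hv)).differentiableAt.differentiableWithinAt) fun v hv => by
      rw [(d (-1) v (hint v hv)).deriv]
      refine div_nonneg ?_ (by positivity)
      have := Real.cos_le_one (2 * N * v)
      exact mul_nonneg (by linarith) (hcos v (hint v hv))
  have h1 := anti (left_mem_Icc.2 hu2) (right_mem_Icc.2 hu2) hu2
  have h2 := mono (left_mem_Icc.2 hu2) (right_mem_Icc.2 hu2) hu2
  simp only [Real.sin_pi_div_two, mul_one] at h1 h2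
  have hs := hsin u (left_mem_Icc.2 hu2)
  have b1 : 0 ≤ (Real.cos (2 * N * (Real.pi / 2)) + 1) / (4 * N) :=
    div_nonneg (by linarith [Real.neg_one_le_cos (2 * N * (Real.pi / 2))]) (by positivity)
  have b2 : (Real.cos (2 * N * (Real.pi / 2)) + -1) / (4 * N) ≤ 0 :=
    div_nonpos_of_nonpos_of_nonneg (by linarith [Real.cos_le_one (2 * N * (Real.pi / 2))])
      (by positivity)
  have e : 1 / (2 * N * Real.sin u) = 2 / (4 * N * Real.sin u) := by field_simp; norm_num
  have b3 : (Real.cos (2 * N * u) + 1) / (4 * N * Real.sin u) ≤ 2 / (4 * N * Real.sin u) := by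
    gcongr; linarith [Real.cos_le_one (2 * N * u)]
  have b4 : -(2 / (4 * N * Real.sin u)) ≤ (Real.cos (2 * N * u) + -1) / (4 * N * Real.sin u) := by
    rw [← neg_div]; gcongr; linarith [Real.neg_one_le_cos (2 * N * u)]
  rw [e, abs_le]
  constructor <;> linarith

lemma sin_odd_mul_pi_sub (n : ℕ) (u : ℝ) :
    Real.sin ((2 * n + 1) * (Real.pi - u)) = Real.sin ((2 * n + 1) * u) := by
  rw [show (2 * (n : ℝ) + 1) * (Real.pi - u) = Real.pi - (2 * n + 1) * u + n * (2 * Real.pi) by ring,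
    Real.sin_add_nat_mul_two_pi, Real.sin_pi_sub]

lemma oddSineSum_pi_sub (N : ℕ) (u : ℝ) : oddSineSum N (Real.pi - u) = oddSineSum N u := by
  simp only [oddSineSum, sin_odd_mul_pi_sub]

lemma oddSineSum_add_pi (N : ℕ) (u : ℝ) : oddSineSum N (u + Real.pi) = -oddSineSum N u := by
  simp only [oddSineSum, ← Finset.sum_neg_distrib]
  refine Finset.sum_congr rfl fun n _ => ?_
  rw [show (2 * (n : ℝ) + 1) * (u + Real.pi) = (2 * n + 1) * u + Real.pi + n * (2 * Real.pi) by ring,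
    Real.sin_add_nat_mul_two_pi, Real.sin_add_pi, neg_div]

lemma abs_oddSineSum_sub_le {N : ℕ} (hN : 0 < N) {u : ℝ} (hu : 0 < u) (hu2 : u < Real.pi) :
    |oddSineSum N u - oddSineSum N (Real.pi / 2)| ≤ 1 / (2 * N * Real.sin u) := by
  rcases le_total u (Real.pi / 2) with h | h
  · exact abs_oddSineSum_sub_le_aux hN hu h
  · have := abs_oddSineSum_sub_le_aux hN (u := Real.pi - u) (by linarith) (by linarith)
    rwa [oddSineSum_pi_sub, Real.sin_pi_sub] at this

lemma oddSineSum_pi_div_two (N : ℕ) :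
    oddSineSum N (Real.pi / 2) = ∑ n ∈ Finset.range N, (-1 : ℝ) ^ n / (2 * n + 1) := by
  refine Finset.sum_congr rfl fun n _ => ?_
  rw [show (2 * (n : ℝ) + 1) * (Real.pi / 2) = Real.pi / 2 + n * Real.pi by ring,
    Real.sin_add_nat_mul_pi, Real.sin_pi_div_two, mul_one]

/-- The difference from the value at π/2 is O(1/N), and at π/2 the series is Leibniz's series for
π/4. -/
lemma tendsto_oddSineSum {u : ℝ} (hu : 0 < u) (hu2 : u < Real.pi) :
    Tendsto (fun N => oddSineSum N u) atTop (𝓝 (Real.pi / 4)) := by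
  have h0 : Tendsto (fun N => oddSineSum N (Real.pi / 2)) atTop (𝓝 (Real.pi / 4)) := by
    simp only [oddSineSum_pi_div_two]
    exact Real.tendsto_sum_pi_div_four
  have hs := Real.sin_pos_of_pos_of_lt_pi hu hu2
  have h1 : Tendsto (fun N => oddSineSum N u - oddSineSum N (Real.pi / 2)) atTop (𝓝 0) := by
    refine squeeze_zero_norm' (a := fun N : ℕ => 1 / (2 * N * Real.sin u)) ?_ ?_
    · filter_upwards [eventually_gt_atTop 0] with N hN
      exact abs_oddSineSum_sub_le hN hu hu2
    · refine tendsto_const_nhds.div_atTop ?_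
      exact (tendsto_natCast_atTop_atTop.const_mul_atTop two_pos).atTop_mul_const hs
  simpa using h1.add h0

lemma abs_sin_nat_mul_le (n : ℕ) (u : ℝ) : |Real.sin (n * u)| ≤ n * |Real.sin u| := by
  induction n with
  | zero => simp
  | succ n ih =>
    push_cast
    rw [add_mul, one_mul, Real.sin_add]
    calc |Real.sin (n * u) * Real.cos u + Real.cos (n * u) * Real.sin u|
        ≤ |Real.sin (n * u)| * |Real.cos u| + |Real.cos (n * u)| * |Real.sin u| := by
          rw [← abs_mul, ← abs_mul]; exact abs_add_le _ _
      _ ≤ (n * |Real.sin u|) * 1 + 1 * |Real.sin u| := by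
          gcongr
          · exact Real.abs_cos_le_one _
          · exact Real.abs_cos_le_one _
      _ = _ := by ring

/-- Two regimes: if N sin v ≤ 1, each of the N terms is at most sin v in modulus; otherwise the
distance to the value at π/2 is at most 1/(2N sin v) < 1. -/
lemma exists_abs_oddSineSum_le : ∃ B : ℝ, 0 < B ∧ ∀ N u, |oddSineSum N u| ≤ B := by
  have h0 : Tendsto (fun N => oddSineSum N (Real.pi / 2)) atTop (𝓝 (Real.pi / 4)) :=
    tendsto_oddSineSum (by linarith [Real.pi_pos]) (by linarith [Real.pi_pos])
  obtain ⟨C, hC⟩ := h0.abs.bddAbove_range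
  have hC' : ∀ N, |oddSineSum N (Real.pi / 2)| ≤ C := fun N => hC ⟨N, rfl⟩
  have hC0 : 0 ≤ C := (abs_nonneg _).trans (hC' 0)
  refine ⟨C + 1, by linarith, fun N => ?_⟩
  have per : Function.Periodic (fun u => |oddSineSum N u|) Real.pi := fun u => by
    simp only [oddSineSum_add_pi, abs_neg]
  intro u
  obtain ⟨v, hv, e⟩ := per.exists_mem_Ico₀ Real.pi_pos u
  rw [e]
  have hs : 0 ≤ Real.sin v := Real.sin_nonneg_of_nonneg_of_le_pi hv.1 hv.2.le
  rcases le_or_gt (N * Real.sin v) 1 with h | h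
  · calc |oddSineSum N v| ≤ ∑ n ∈ Finset.range N, |Real.sin ((2 * n + 1) * v) / (2 * n + 1)| :=
        Finset.abs_sum_le_sum_abs _ _
      _ ≤ ∑ n ∈ Finset.range N, Real.sin v := by
        refine Finset.sum_le_sum fun n _ => ?_
        have hn : (0 : ℝ) < 2 * n + 1 := by positivity
        rw [abs_div, abs_of_pos hn, div_le_iff₀ hn, mul_comm (Real.sin v)]
        have := abs_sin_nat_mul_le (2 * n + 1) v
        push_cast at this
        rwa [abs_of_nonneg hs] at this
      _ = N * Real.sin v := by simp
      _ ≤ C + 1 := by linarith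
  · have hN : 0 < N := Nat.pos_of_ne_zero fun h0 => by simp [h0] at h; linarith
    have hN' : (0 : ℝ) < N := by exact_mod_cast hN
    have hs' : 0 < Real.sin v := pos_of_mul_pos_right (by linarith) hN'.le
    have hv0 : 0 < v := lt_of_le_of_ne hv.1 fun h0 => by rw [← h0] at hs'; simp at hs'
    have h1 := abs_oddSineSum_sub_le hN hv0 hv.2
    have h2 : 1 / (2 * N * Real.sin v) ≤ 1 := by
      rw [div_le_one (by positivity)]; linarith
    have h3 := hC' N
    have h4 := abs_sub_abs_le_abs_sub (oddSineSum N v) (oddSineSum N (Real.pi / 2))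
    linarith

lemma exists_tendsto_oddSineSum (u : ℝ) : ∃ s, Tendsto (fun N => oddSineSum N u) atTop (𝓝 s) := by
  have per : Function.Periodic (fun u => ∃ s, Tendsto (fun N => oddSineSum N u) atTop (𝓝 s))
      Real.pi := fun u => by
    simp only [oddSineSum_add_pi, eq_iff_iff]
    exact ⟨fun ⟨s, h⟩ => ⟨-s, by simpa using h.neg⟩, fun ⟨s, h⟩ => ⟨-s, h.neg⟩⟩
  obtain ⟨v, hv, e⟩ := per.exists_mem_Ico₀ Real.pi_pos u
  rw [e]
  rcases eq_or_lt_of_le hv.1 with h | h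
  · exact ⟨0, by simp [← h, oddSineSum]⟩
  · exact ⟨_, tendsto_oddSineSum h hv.2⟩

end SquareWave

/-! ### The square wave in the frequencies λₙ, and the constant of the equation. -/

section Eigenfunctions

open HeatMemory

variable {L : ℝ}

/-- The partial sums of `∑ (-1)ⁿ cos (λₙ y) / λₙ`. -/
noncomputable def squareWave (L : ℝ) (N : ℕ) (y : ℝ) : ℝ :=
  ∑ n ∈ Finset.range N, (-1 : ℝ) ^ n / lam L n * Real.cos (lam L n * y)

lemma lam_pos (hL : 0 < L) (n : ℕ) : 0 < lam L n := by
  unfold lam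
  have := Real.pi_pos
  positivity

lemma squareWave_eq (hL : 0 < L) (N : ℕ) (y : ℝ) :
    squareWave L N y = 2 * L / Real.pi * oddSineSum N (Real.pi / 2 + Real.pi * y / (2 * L)) := by
  have hpi := Real.pi_ne_zero
  rw [squareWave, oddSineSum, Finset.mul_sum]
  refine Finset.sum_congr rfl fun n _ => ?_
  have e : (2 * (n : ℝ) + 1) * (Real.pi / 2 + Real.pi * y / (2 * L))
      = lam L n * y + Real.pi / 2 + n * Real.pi := by
    unfold lam; field_simp; ring
  rw [e, Real.sin_add_nat_mul_pi, Real.sin_add_pi_div_two]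
  unfold lam
  have : (2 * (n : ℝ) + 1) ≠ 0 := by positivity
  have h2 : ((n : ℝ) + 1 / 2) ≠ 0 := by positivity
  field_simp

lemma tendsto_squareWave (hL : 0 < L) {y : ℝ} (hy : |y| < L) :
    Tendsto (fun N => squareWave L N y) atTop (𝓝 (L / 2)) := by
  have hpi := Real.pi_pos
  obtain ⟨h1, h2⟩ := abs_lt.1 hy
  have e : Real.pi / 2 + Real.pi * y / (2 * L) = Real.pi * ((L + y) / (2 * L)) := by
    field_simp
  have l := tendsto_oddSineSum (u := Real.pi / 2 + Real.pi * y / (2 * L))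
    (by rw [e]; exact mul_pos hpi (div_pos (by linarith) (by linarith)))
    (by rw [e]; exact mul_lt_of_lt_one_right hpi ((div_lt_one (by linarith)).2 (by linarith)))
  simp only [squareWave_eq hL]
  convert! l.const_mul (2 * L / Real.pi) using 2
  field_simp
  norm_num

/-- The partial sums change sign under translation by 2L. -/
lemma tendsto_squareWave_of_gt (hL : 0 < L) {y : ℝ} (hy : L < y) (hy2 : y < 3 * L) :
    Tendsto (fun N => squareWave L N y) atTop (𝓝 (-(L / 2))) := by
  have hpi := Real.pi_pos
  have e : ∀ N, squareWave L N y = -squareWave L N (y - 2 * L) := fun N => by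
    rw [squareWave_eq hL, squareWave_eq hL, ← mul_neg, ← oddSineSum_add_pi]
    congr 2
    field_simp
    ring
  simp only [e]
  exact (tendsto_squareWave hL (abs_lt.2 ⟨by linarith, by linarith⟩)).neg

lemma exists_tendsto_squareWave (hL : 0 < L) (y : ℝ) :
    ∃ s, Tendsto (fun N => squareWave L N y) atTop (𝓝 s) := by
  obtain ⟨s, hs⟩ := exists_tendsto_oddSineSum (Real.pi / 2 + Real.pi * y / (2 * L))
  refine ⟨2 * L / Real.pi * s, ?_⟩
  simp only [squareWave_eq hL]
  exact hs.const_mul _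

lemma exists_abs_squareWave_le (hL : 0 < L) :
    ∃ B : ℝ, 0 < B ∧ ∀ N y, |squareWave L N y| ≤ B := by
  obtain ⟨B, hB, h⟩ := exists_abs_oddSineSum_le
  have hpi := Real.pi_pos
  refine ⟨2 * L / Real.pi * B, by positivity, fun N y => ?_⟩
  rw [squareWave_eq hL, abs_mul, abs_of_pos (by positivity : 0 < 2 * L / Real.pi)]
  gcongr
  exact h _ _

lemma tendsto_sum_Icc_alternating :
    Tendsto (fun N : ℕ => ∑ n ∈ Finset.Icc 1 N, (-1 : ℝ) ^ n / ((n : ℝ) + 1 / 2))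
      atTop (𝓝 (Real.pi / 2 - 2)) := by
  have h := ((Real.tendsto_sum_pi_div_four.comp (tendsto_add_atTop_nat 1)).const_mul 2).sub_const 2
  rw [show 2 * (Real.pi / 4) - 2 = Real.pi / 2 - 2 by ring] at h
  refine h.congr fun N => ?_
  simp only [Function.comp]
  rw [Finset.range_eq_Ico, Finset.sum_eq_sum_Ico_succ_bot (by omega), mul_add, Finset.mul_sum]
  rw [show Finset.Ico (0 + 1) (N + 1) = Finset.Icc 1 N by ext; simp]
  simp only [pow_zero, Nat.cast_zero, mul_zero, zero_add, div_one, mul_one, add_sub_cancel_left]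
  refine Finset.sum_congr rfl fun n _ => ?_
  have : (2 * (n : ℝ) + 1) ≠ 0 := by positivity
  have h2 : ((n : ℝ) + 1 / 2) ≠ 0 := by positivity
  field_simp

end Eigenfunctions

/-! ### Stability of conditionally convergent cosine series under Volterra equations. -/

section TrigFamilies

open HeatMemory

variable {w ω : ℕ → ℝ}

/-- The partial sums of the cosine series with coefficients `w n * x n` and frequencies `ω n`. -/
noncomputable def trigSum (w ω x : ℕ → ℝ) (N : ℕ) (y : ℝ) : ℝ :=
  ∑ n ∈ Finset.range N, w n * Real.cos (ω n * y) * x n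

lemma continuous_trigSum (w ω x : ℕ → ℝ) (N : ℕ) : Continuous (trigSum w ω x N) := by
  unfold trigSum
  fun_prop

/-- The product formula for cosines. An n-dependent multiplier becomes an n-independent operation on
functions of `y`; this is why `y` is carried along although only y = 0 is needed in the end. -/
lemma trigSum_cos_mul (x : ℕ → ℝ) (N : ℕ) (y q : ℝ) :
    trigSum w ω (fun n => Real.cos (ω n * q) * x n) N y
      = (trigSum w ω x N (y + q) + trigSum w ω x N (y - q)) / 2 := by
  simp only [trigSum, ← Finset.sum_add_distrib, Finset.sum_div]
  refine Finset.sum_congr rfl fun n _ => ?_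
  rw [mul_add, mul_sub, Real.cos_add, Real.cos_sub]
  ring

lemma trigSum_sub (x x' : ℕ → ℝ) (N : ℕ) (y : ℝ) :
    trigSum w ω (fun n => x n - x' n) N y = trigSum w ω x N y - trigSum w ω x' N y := by
  simp only [trigSum, ← Finset.sum_sub_distrib, mul_sub]

variable {σ μ : ℝ → ℝ} {μ₀ : ℝ}

/-- The mode kernels combine n-independent functions with cosines, so they act on the partial sums
by averaging translates in `y`. Bounds uniform in `y` and pointwise limits for all `y` are
preserved, with constants independent of `N`. -/
lemma trigSum_modeKernel_mul (hμ : ContinuousOn μ (Ici 0)) (x : ℕ → ℝ) (N : ℕ) (y : ℝ) {r : ℝ}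
    (hr : 0 ≤ r) :
    trigSum w ω (fun n => modeKernel σ μ μ₀ (ω n) r * x n) N y
      = σ r * trigSum w ω x N y
        + μ₀ * ((trigSum w ω x N (y + r) + trigSum w ω x N (y - r)) / 2)
        + ∫ q in (0 : ℝ)..r, μ (r - q)
          * ((trigSum w ω x N (y + q) + trigSum w ω x N (y - q)) / 2) := by
  have hμr : ContinuousOn (fun q => μ (r - q)) (uIcc 0 r) := by
    rw [uIcc_of_le hr]
    exact hμ.comp (by fun_prop) fun q hq => sub_nonneg.2 hq.2
  have e : (∫ q in (0 : ℝ)..r, μ (r - q)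
      * ((trigSum w ω x N (y + q) + trigSum w ω x N (y - q)) / 2))
      = ∑ n ∈ Finset.range N, w n * Real.cos (ω n * y)
        * (conv μ (fun s => Real.cos (ω n * s)) r * x n) := by
    simp only [← trigSum_cos_mul]
    simp only [trigSum, Finset.mul_sum]
    rw [intervalIntegral.integral_finsetSum]
    · refine Finset.sum_congr rfl fun n _ => ?_
      rw [conv, ← intervalIntegral.integral_mul_const, ← intervalIntegral.integral_const_mul]
      exact intervalIntegral.integral_congr fun q _ => by ring
    · exact fun n _ => (hμr.mul (by fun_prop)).intervalIntegrable
  rw [e, ← trigSum_cos_mul]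
  simp only [trigSum, Finset.mul_sum, ← Finset.sum_add_distrib, modeKernel]
  exact Finset.sum_congr rfl fun n _ => by ring

lemma abs_trigSum_modeKernel_mul_le (hμ : ContinuousOn μ (Ici 0)) {x : ℕ → ℝ} {N : ℕ} {A S M T : ℝ}
    (hS : ∀ r ∈ Icc 0 T, |σ r| ≤ S) (hM : ∀ r ∈ Icc 0 T, |μ r| ≤ M)
    (hA : ∀ y, |trigSum w ω x N y| ≤ A) (y : ℝ) {r : ℝ} (hr : r ∈ Icc 0 T) :
    |trigSum w ω (fun n => modeKernel σ μ μ₀ (ω n) r * x n) N y| ≤ (S + |μ₀| + M * T) * A := by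
  have hA0 : 0 ≤ A := (abs_nonneg _).trans (hA 0)
  have hM0 : 0 ≤ M := (abs_nonneg _).trans (hM r hr)
  have hP : ∀ q, |(trigSum w ω x N (y + q) + trigSum w ω x N (y - q)) / 2| ≤ A := fun q => by
    rw [abs_div, abs_two, div_le_iff₀ two_pos]
    linarith [abs_add_le (trigSum w ω x N (y + q)) (trigSum w ω x N (y - q)), hA (y + q), hA (y - q)]
  rw [trigSum_modeKernel_mul hμ _ _ _ hr.1]
  have h3 : |∫ q in (0 : ℝ)..r, μ (r - q)
      * ((trigSum w ω x N (y + q) + trigSum w ω x N (y - q)) / 2)| ≤ M * A * |r - 0| := by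
    simp only [← Real.norm_eq_abs]
    refine intervalIntegral.norm_integral_le_of_norm_le_const fun q hq => ?_
    rw [uIoc_of_le hr.1] at hq
    rw [norm_mul]
    exact mul_le_mul (hM _ ⟨by linarith [hq.2], by linarith [hq.1, hr.2]⟩) (hP q) (abs_nonneg _) hM0
  have h3' : M * A * |r - 0| ≤ M * T * A := by
    rw [sub_zero, abs_of_nonneg hr.1, mul_right_comm]
    gcongr
    exact hr.2
  have h1 : |σ r * trigSum w ω x N y| ≤ S * A := by
    rw [abs_mul]; exact mul_le_mul (hS r hr) (hA y) (abs_nonneg _) ((abs_nonneg _).trans (hS r hr))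
  have h2 : |μ₀ * ((trigSum w ω x N (y + r) + trigSum w ω x N (y - r)) / 2)| ≤ |μ₀| * A := by
    rw [abs_mul]; exact mul_le_mul_of_nonneg_left (hP r) (abs_nonneg _)
  have h4 := abs_add_three (σ r * trigSum w ω x N y)
    (μ₀ * ((trigSum w ω x N (y + r) + trigSum w ω x N (y - r)) / 2))
    (∫ q in (0 : ℝ)..r, μ (r - q) * ((trigSum w ω x N (y + q) + trigSum w ω x N (y - q)) / 2))
  linarith

lemma exists_tendsto_trigSum_modeKernel_mul (hμ : ContinuousOn μ (Ici 0)) {x : ℕ → ℝ} {A : ℝ}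
    (hA : ∀ N y, |trigSum w ω x N y| ≤ A)
    (hx : ∀ y, ∃ s, Tendsto (fun N => trigSum w ω x N y) atTop (𝓝 s)) (y : ℝ) {r : ℝ}
    (hr : 0 ≤ r) :
    ∃ s, Tendsto (fun N => trigSum w ω (fun n => modeKernel σ μ μ₀ (ω n) r * x n) N y)
      atTop (𝓝 s) := by
  choose X hX using hx
  have hμr : ContinuousOn (fun q => μ (r - q)) (uIcc 0 r) := by
    rw [uIcc_of_le hr]
    exact hμ.comp (by fun_prop) fun q hq => sub_nonneg.2 hq.2
  refine ⟨σ r * X y + μ₀ * ((X (y + r) + X (y - r)) / 2)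
    + ∫ q in (0 : ℝ)..r, μ (r - q) * ((X (y + q) + X (y - q)) / 2), ?_⟩
  simp only [trigSum_modeKernel_mul hμ _ _ _ hr]
  refine (((hX y).const_mul _).add ((((hX _).add (hX _)).div_const 2).const_mul _)).add ?_
  refine intervalIntegral.tendsto_integral_filter_of_dominated_convergence
    (fun q => |μ (r - q)| * A) (Eventually.of_forall fun N => ?_)
    (Eventually.of_forall fun N => Eventually.of_forall fun q _ => ?_) ?_
    (Eventually.of_forall fun q _ => (((hX _).add (hX _)).div_const 2).const_mul _)
  · have := continuous_trigSum w ω x N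
    exact (intervalIntegrable_iff.1
      (hμr.mul (by fun_prop)).intervalIntegrable).aestronglyMeasurable
  · rw [norm_mul, Real.norm_eq_abs, Real.norm_eq_abs]
    refine mul_le_mul_of_nonneg_left ?_ (abs_nonneg _)
    rw [abs_div, abs_two, div_le_iff₀ two_pos]
    linarith [abs_add_le (trigSum w ω x N (y + q)) (trigSum w ω x N (y - q)), hA N (y + q),
      hA N (y - q)]
  · exact (hμr.abs.mul continuousOn_const).intervalIntegrable

lemma continuousOn_conv_integrand {k u : ℝ → ℝ} (hk : ContinuousOn k (Ici 0))
    (hu : ContinuousOn u (Ici 0)) {t : ℝ} (ht : 0 ≤ t) :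
    ContinuousOn (fun s => k (t - s) * u s) (uIcc 0 t) := by
  rw [uIcc_of_le ht]
  exact (hk.comp (by fun_prop) fun q hq => sub_nonneg.2 hq.2).mul (hu.mono Icc_subset_Ici_self)

lemma trigSum_conv {k x : ℕ → ℝ → ℝ} (hk : ∀ n, ContinuousOn (k n) (Ici 0))
    (hx : ∀ n, ContinuousOn (x n) (Ici 0)) (N : ℕ) (y : ℝ) {t : ℝ} (ht : 0 ≤ t) :
    trigSum w ω (fun n => conv (k n) (x n) t) N y
      = ∫ s in (0 : ℝ)..t, trigSum w ω (fun n => k n (t - s) * x n s) N y := by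
  simp only [trigSum]
  rw [intervalIntegral.integral_finsetSum]
  · exact Finset.sum_congr rfl fun n _ => by rw [conv, ← intervalIntegral.integral_const_mul]
  · exact fun n _ =>
      (continuousOn_const.mul (continuousOn_conv_integrand (hk n) (hx n) ht)).intervalIntegrable

lemma continuousOn_trigSum_conv_integrand {k x : ℕ → ℝ → ℝ} (hk : ∀ n, ContinuousOn (k n) (Ici 0))
    (hx : ∀ n, ContinuousOn (x n) (Ici 0)) (N : ℕ) (y : ℝ) {t : ℝ} (ht : 0 ≤ t) :
    ContinuousOn (fun s => trigSum w ω (fun n => k n (t - s) * x n s) N y) (uIcc 0 t) := by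
  unfold trigSum
  exact continuousOn_finsetSum _ fun n _ =>
    continuousOn_const.mul (continuousOn_conv_integrand (hk n) (hx n) ht)

lemma abs_trigSum_conv_le (hσ : ContinuousOn σ (Ici 0)) (hμ : ContinuousOn μ (Ici 0))
    {x : ℕ → ℝ → ℝ} (hx : ∀ n, ContinuousOn (x n) (Ici 0)) {N : ℕ} {S M T : ℝ}
    (hS : ∀ r ∈ Icc 0 T, |σ r| ≤ S) (hM : ∀ r ∈ Icc 0 T, |μ r| ≤ M) {φ : ℝ → ℝ}
    (hφ : Continuous φ) {t : ℝ} (ht : t ∈ Icc 0 T)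
    (hb : ∀ s ∈ Icc 0 t, ∀ y, |trigSum w ω (x · s) N y| ≤ φ s) (y : ℝ) :
    |trigSum w ω (fun n => conv (modeKernel σ μ μ₀ (ω n)) (x n) t) N y|
      ≤ ∫ s in (0 : ℝ)..t, (S + |μ₀| + M * T) * φ s := by
  rw [trigSum_conv (fun n => continuousOn_modeKernel hσ hμ μ₀ (ω n)) hx N y ht.1]
  have hi : IntervalIntegrable (fun s => (S + |μ₀| + M * T) * φ s) volume 0 t :=
    (continuous_const.mul hφ).intervalIntegrable _ _
  rw [← Real.norm_eq_abs (∫ _ in (0 : ℝ)..t, _)]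
  refine intervalIntegral.norm_integral_le_of_norm_le ht.1 (Eventually.of_forall fun s hs => ?_) hi
  exact abs_trigSum_modeKernel_mul_le hμ hS hM (hb s ⟨hs.1.le, hs.2⟩) y
    ⟨by linarith [hs.2], by linarith [hs.1, ht.2]⟩

/-- Families of functions whose cosine series converge boundedly. -/
structure TrigSummable (w ω : ℕ → ℝ) (x : ℕ → ℝ → ℝ) : Prop where
  continuousOn : ∀ n, ContinuousOn (x n) (Ici 0)
  bounded : ∀ T, ∃ A, ∀ N y, ∀ s ∈ Icc 0 T, |trigSum w ω (x · s) N y| ≤ A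
  tendsto : ∀ y s, 0 ≤ s → ∃ l, Tendsto (fun N => trigSum w ω (x · s) N y) atTop (𝓝 l)

lemma ContinuousOn.exists_abs_le_Icc {u : ℝ → ℝ} (hu : ContinuousOn u (Ici 0)) (T : ℝ) :
    ∃ S, ∀ r ∈ Icc 0 T, |u r| ≤ S := by
  obtain ⟨S, hS⟩ := isCompact_Icc.exists_bound_of_continuousOn (hu.mono Icc_subset_Ici_self)
  exact ⟨S, hS⟩

lemma TrigSummable.conv (hσ : ContinuousOn σ (Ici 0)) (hμ : ContinuousOn μ (Ici 0))
    {x : ℕ → ℝ → ℝ} (hx : TrigSummable w ω x) :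
    TrigSummable w ω fun n t => HeatMemory.conv (modeKernel σ μ μ₀ (ω n)) (x n) t := by
  have hk := fun n => continuousOn_modeKernel hσ hμ μ₀ (ω n)
  refine ⟨fun n => continuousOn_conv (hk n) (hx.continuousOn n), fun T => ?_, fun y t ht => ?_⟩
  · obtain ⟨S, hS⟩ := hσ.exists_abs_le_Icc T
    obtain ⟨M, hM⟩ := hμ.exists_abs_le_Icc T
    obtain ⟨A, hA⟩ := hx.bounded T
    obtain ⟨C, hC⟩ := isCompact_Icc.exists_bound_of_continuousOn (s := Icc 0 T)
      (f := fun t => ∫ _ in (0 : ℝ)..t, (S + |μ₀| + M * T) * A) (by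
        simp only [intervalIntegral.integral_const]; fun_prop)
    refine ⟨C, fun N y t ht => ?_⟩
    refine (abs_trigSum_conv_le hσ hμ hx.continuousOn hS hM (φ := fun _ => A) continuous_const ht
      (fun s hs y => hA N y s ⟨hs.1, hs.2.trans ht.2⟩) y).trans ((le_abs_self _).trans (hC t ht))
  · obtain ⟨S, hS⟩ := hσ.exists_abs_le_Icc t
    obtain ⟨M, hM⟩ := hμ.exists_abs_le_Icc t
    obtain ⟨A, hA⟩ := hx.bounded t
    have key : ∀ s, ∃ l, s ∈ Icc 0 t → Tendsto (fun N =>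
        trigSum w ω (fun n => modeKernel σ μ μ₀ (ω n) (t - s) * x n s) N y) atTop (𝓝 l) := by
      intro s
      by_cases hs : s ∈ Icc 0 t
      · obtain ⟨l, hl⟩ := exists_tendsto_trigSum_modeKernel_mul (σ := σ) (μ₀ := μ₀) hμ
          (fun N y => hA N y s hs) (fun y => hx.tendsto y s hs.1) y (sub_nonneg.2 hs.2)
        exact ⟨l, fun _ => hl⟩
      · exact ⟨0, fun h => absurd h hs⟩
    choose l hl using key
    refine ⟨∫ s in (0 : ℝ)..t, l s, ?_⟩
    simp only [trigSum_conv hk hx.continuousOn _ y ht]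
    refine intervalIntegral.tendsto_integral_filter_of_dominated_convergence
      (fun _ => (S + |μ₀| + M * t) * A) (Eventually.of_forall fun N => ?_)
      (Eventually.of_forall fun N => Eventually.of_forall fun s hs => ?_)
      intervalIntegrable_const (Eventually.of_forall fun s hs => ?_)
    · exact (intervalIntegrable_iff.1 (continuousOn_trigSum_conv_integrand hk hx.continuousOn N y
        ht).intervalIntegrable).aestronglyMeasurable
    · rw [uIoc_of_le ht] at hs
      exact abs_trigSum_modeKernel_mul_le hμ hS hM (fun y => hA N y s ⟨hs.1.le, hs.2⟩) y
        ⟨by linarith [hs.2], by linarith [hs.1]⟩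
    · rw [uIoc_of_le ht] at hs
      exact hl s ⟨hs.1.le, hs.2⟩

lemma TrigSummable.sub {x x' : ℕ → ℝ → ℝ} (hx : TrigSummable w ω x) (hx' : TrigSummable w ω x') :
    TrigSummable w ω fun n t => x n t - x' n t := by
  refine ⟨fun n => (hx.continuousOn n).sub (hx'.continuousOn n), fun T => ?_, fun y s hs => ?_⟩
  · obtain ⟨A, hA⟩ := hx.bounded T
    obtain ⟨A', hA'⟩ := hx'.bounded T
    refine ⟨A + A', fun N y s hs => ?_⟩
    rw [trigSum_sub]
    exact (abs_sub _ _).trans (add_le_add (hA N y s hs) (hA' N y s hs))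
  · obtain ⟨l, hl⟩ := hx.tendsto y s hs
    obtain ⟨l', hl'⟩ := hx'.tendsto y s hs
    refine ⟨l - l', ?_⟩
    simp only [trigSum_sub]
    exact hl.sub hl'

lemma trigSum_cos (N : ℕ) (y t : ℝ) :
    trigSum w ω (fun n => Real.cos (ω n * t)) N y
      = (trigSum w ω (fun _ => 1) N (y + t) + trigSum w ω (fun _ => 1) N (y - t)) / 2 := by
  simpa using trigSum_cos_mul (w := w) (ω := ω) (fun _ => 1) N y t

lemma abs_trigSum_cos_le {N : ℕ} {B : ℝ} (hB : ∀ y, |trigSum w ω (fun _ => 1) N y| ≤ B) (y t : ℝ) :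
    |trigSum w ω (fun n => Real.cos (ω n * t)) N y| ≤ B := by
  rw [trigSum_cos, abs_div, abs_two, div_le_iff₀ two_pos]
  linarith [abs_add_le (trigSum w ω (fun _ => 1) N (y + t)) (trigSum w ω (fun _ => 1) N (y - t)),
    hB (y + t), hB (y - t)]

lemma trigSummable_cos {B : ℝ} (hB : ∀ N y, |trigSum w ω (fun _ => 1) N y| ≤ B)
    (hlim : ∀ y, ∃ s, Tendsto (fun N => trigSum w ω (fun _ => 1) N y) atTop (𝓝 s)) :
    TrigSummable w ω fun n t => Real.cos (ω n * t) := by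
  refine ⟨fun n => by fun_prop, fun T => ⟨B, fun N y s _ => abs_trigSum_cos_le (hB N) y s⟩,
    fun y s _ => ?_⟩
  obtain ⟨l, hl⟩ := hlim (y + s)
  obtain ⟨l', hl'⟩ := hlim (y - s)
  simp only [trigSum_cos]
  exact ⟨_, (hl.add hl').div_const 2⟩

/-- In a norm with a sufficiently large exponential weight, convolution with the mode kernels is a
contraction. -/
lemma abs_trigSum_conv_le_half (hσ : ContinuousOn σ (Ici 0)) (hμ : ContinuousOn μ (Ici 0))
    {x : ℕ → ℝ → ℝ} (hx : ∀ n, ContinuousOn (x n) (Ici 0)) {N : ℕ} {S M T ρ A : ℝ}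
    (hS : ∀ r ∈ Icc 0 T, |σ r| ≤ S) (hM : ∀ r ∈ Icc 0 T, |μ r| ≤ M)
    (hρ : 0 < ρ) (hK : 2 * (S + |μ₀| + M * T) ≤ ρ) (hA : 0 ≤ A)
    (hb : ∀ s ∈ Icc 0 T, ∀ y, |trigSum w ω (x · s) N y| ≤ A * Real.exp (ρ * s)) {t : ℝ}
    (ht : t ∈ Icc 0 T) (y : ℝ) :
    |trigSum w ω (fun n => conv (modeKernel σ μ μ₀ (ω n)) (x n) t) N y|
      ≤ A / 2 * Real.exp (ρ * t) := by
  refine (abs_trigSum_conv_le hσ hμ hx hS hM (φ := fun s => A * Real.exp (ρ * s)) (by fun_prop) ht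
    (fun s hs y => hb s ⟨hs.1, hs.2.trans ht.2⟩ y) y).trans ?_
  rw [intervalIntegral.integral_const_mul, intervalIntegral.integral_const_mul,
    intervalIntegral.integral_comp_mul_left _ hρ.ne', integral_exp, mul_zero, Real.exp_zero,
    smul_eq_mul]
  have h1 : ρ⁻¹ * (Real.exp (ρ * t) - 1) ≤ ρ⁻¹ * Real.exp (ρ * t) := by
    gcongr; linarith
  calc (S + |μ₀| + M * T) * (A * (ρ⁻¹ * (Real.exp (ρ * t) - 1)))
      ≤ (ρ / 2) * (A * (ρ⁻¹ * Real.exp (ρ * t))) := by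
        gcongr
        · exact mul_nonneg hA (mul_nonneg (inv_nonneg.2 hρ.le)
            (sub_nonneg.2 (Real.one_le_exp (mul_nonneg hρ.le ht.1))))
        · linarith
    _ = _ := by field_simp

/-- A crude bound depending on `N`; it only starts an iteration that halves it away. -/
lemma exists_abs_trigSum_le (w ω : ℕ → ℝ) {x : ℕ → ℝ → ℝ} (hx : ∀ n, ContinuousOn (x n) (Ici 0))
    (N : ℕ) (T : ℝ) : ∃ A, 0 ≤ A ∧ ∀ s ∈ Icc 0 T, ∀ y, |trigSum w ω (x · s) N y| ≤ A := by
  choose C hC using fun n => (hx n).exists_abs_le_Icc T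
  refine ⟨∑ n ∈ Finset.range N, |w n| * |C n|,
    Finset.sum_nonneg fun n _ => mul_nonneg (abs_nonneg _) (abs_nonneg _), fun s hs y => ?_⟩
  refine (Finset.abs_sum_le_sum_abs _ _).trans (Finset.sum_le_sum fun n _ => ?_)
  rw [abs_mul, abs_mul]
  calc |w n| * |Real.cos (ω n * y)| * |x n s| ≤ |w n| * 1 * |C n| := by
        exact mul_le_mul (mul_le_mul_of_nonneg_left (Real.abs_cos_le_one _) (abs_nonneg _))
          ((hC n s hs).trans (le_abs_self _)) (abs_nonneg _) (by positivity)
    _ = _ := by ring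

/-- A priori bound for solutions of a family of Volterra equations. -/
lemma abs_trigSum_volterra_le (hσ : ContinuousOn σ (Ici 0)) (hμ : ContinuousOn μ (Ici 0))
    {v z : ℕ → ℝ → ℝ} (hz : ∀ n, ContinuousOn (z n) (Ici 0)) {N : ℕ} {S M T ρ B : ℝ}
    (hS : ∀ r ∈ Icc 0 T, |σ r| ≤ S) (hM : ∀ r ∈ Icc 0 T, |μ r| ≤ M)
    (hρ : 0 < ρ) (hK : 2 * (S + |μ₀| + M * T) ≤ ρ)
    (hvz : ∀ n t, 0 ≤ t → z n t = v n t - conv (modeKernel σ μ μ₀ (ω n)) (z n) t)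
    (hB : ∀ s ∈ Icc 0 T, ∀ y, |trigSum w ω (v · s) N y| ≤ B * Real.exp (ρ * s)) (hB0 : 0 ≤ B)
    {t : ℝ} (ht : t ∈ Icc 0 T) (y : ℝ) :
    |trigSum w ω (z · t) N y| ≤ 2 * B * Real.exp (ρ * t) := by
  obtain ⟨A, hA0, hA⟩ := exists_abs_trigSum_le w ω hz N T
  -- Each use of the Volterra equation halves the excess over 2B, so the N-dependent `A` disappears
  -- in the limit.
  have key : ∀ k : ℕ, ∀ s ∈ Icc 0 T, ∀ y,
      |trigSum w ω (z · s) N y| ≤ (2 * B + A / 2 ^ k) * Real.exp (ρ * s) := by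
    intro k
    induction k with
    | zero =>
      intro s hs y
      have h1 := Real.one_le_exp (mul_nonneg hρ.le hs.1)
      refine (hA s hs y).trans ?_
      rw [pow_zero, div_one]
      nlinarith
    | succ k ih =>
      intro s hs y
      have e : trigSum w ω (z · s) N y = trigSum w ω (v · s) N y
          - trigSum w ω (fun n => conv (modeKernel σ μ μ₀ (ω n)) (z n) s) N y := by
        rw [← trigSum_sub]
        simp only [← hvz _ s hs.1]
      have h1 := abs_trigSum_conv_le_half hσ hμ hz hS hM hρ hK (by positivity) ih hs y
      rw [e]
      refine (abs_sub _ _).trans ((add_le_add (hB s hs y) h1).trans (le_of_eq ?_))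
      rw [pow_succ]
      field_simp
      ring
  have lim : Tendsto (fun k : ℕ => (2 * B + A / 2 ^ k) * Real.exp (ρ * t)) atTop
      (𝓝 ((2 * B + 0) * Real.exp (ρ * t))) :=
    (tendsto_const_nhds.add (tendsto_const_nhds.div_atTop
      (tendsto_pow_atTop_atTop_of_one_lt one_lt_two))).mul_const _
  rw [add_zero] at lim
  exact ge_of_tendsto' lim fun k => key k t ht y

variable {z : ℕ → ℝ → ℝ}

/-- The solutions of the Volterra equations are uniformly bounded. -/
lemma exists_abs_volterra_le (hσ : ContinuousOn σ (Ici 0)) (hμ : ContinuousOn μ (Ici 0))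
    (hz : ∀ n, ContinuousOn (z n) (Ici 0))
    (hvz : ∀ n t, 0 ≤ t →
      z n t = Real.cos (ω n * t) - conv (modeKernel σ μ μ₀ (ω n)) (z n) t) (T : ℝ) :
    ∃ C, ∀ n, ∀ t ∈ Icc 0 T, |z n t| ≤ C := by
  obtain ⟨S, hS⟩ := hσ.exists_abs_le_Icc T
  obtain ⟨M, hM⟩ := hμ.exists_abs_le_Icc T
  let ρ := max (2 * (S + |μ₀| + M * T)) 1
  have hρ : 0 < ρ := lt_max_of_lt_right one_pos
  refine ⟨2 * 1 * Real.exp (ρ * T), fun n t ht => ?_⟩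
  -- Concentrating the weights at `n` extracts the bound for a single mode from the bound for sums.
  have hs : ∀ (x : ℕ → ℝ) y, trigSum (Pi.single n 1) ω x (n + 1) y = Real.cos (ω n * y) * x n := by
    intro x y
    rw [trigSum, Finset.sum_eq_single n]
    · simp
    · intro m _ hm
      simp [hm]
    · intro h; simp at h
  have := abs_trigSum_volterra_le (w := Pi.single n 1) (v := fun n t => Real.cos (ω n * t))
    (N := n + 1) (B := 1) hσ hμ hz hS hM hρ (le_max_left _ _) hvz (fun s hs' y => ?_) zero_le_one
    ht 0
  · rw [hs] at this
    simp only [mul_zero, Real.cos_zero, one_mul] at this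
    refine this.trans ?_
    gcongr
    exact ht.2
  · rw [hs, abs_mul, one_mul]
    have h1 := Real.one_le_exp (mul_nonneg hρ.le hs'.1)
    nlinarith [Real.abs_cos_le_one (ω n * y), Real.abs_cos_le_one (ω n * s),
      abs_nonneg (Real.cos (ω n * y)), abs_nonneg (Real.cos (ω n * s))]

/-- The iterates that approximate the solutions of the Volterra equations. -/
noncomputable def volterraIter (σ μ : ℝ → ℝ) (μ₀ : ℝ) (ω : ℕ → ℝ) : ℕ → ℕ → ℝ → ℝ
  | 0 => fun n t => Real.cos (ω n * t)
  | m + 1 => fun n t => Real.cos (ω n * t)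
      - conv (modeKernel σ μ μ₀ (ω n)) (volterraIter σ μ μ₀ ω m n) t

/-- The cosine series of the solutions of the Volterra equations converge boundedly if that with
constant coefficients does. -/
lemma TrigSummable.volterra (hσ : ContinuousOn σ (Ici 0)) (hμ : ContinuousOn μ (Ici 0))
    (hz : ∀ n, ContinuousOn (z n) (Ici 0))
    (hvz : ∀ n t, 0 ≤ t →
      z n t = Real.cos (ω n * t) - HeatMemory.conv (modeKernel σ μ μ₀ (ω n)) (z n) t)
    {B : ℝ} (hB : ∀ N y, |trigSum w ω (fun _ => 1) N y| ≤ B)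
    (hlim : ∀ y, ∃ s, Tendsto (fun N => trigSum w ω (fun _ => 1) N y) atTop (𝓝 s)) :
    TrigSummable w ω z := by
  have hB0 : 0 ≤ B := (abs_nonneg _).trans (hB 0 0)
  have hcos := trigSummable_cos hB hlim
  have hit : ∀ m, TrigSummable w ω (volterraIter σ μ μ₀ ω m) := fun m => by
    induction m with
    | zero => exact hcos
    | succ m ih => exact hcos.sub (ih.conv hσ hμ)
  -- The iterates approximate the solution uniformly in `N`, and each has a convergent series, so
  -- the partial sums for `z` are Cauchy. The constant 3B is 2B for the solution plus B for the
  -- zeroth iterate.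
  have param : ∀ T, ∃ ρ, 0 < ρ ∧ (∀ N, ∀ t ∈ Icc 0 T, ∀ y,
      |trigSum w ω (z · t) N y| ≤ 2 * B * Real.exp (ρ * t)) ∧ ∀ m N, ∀ t ∈ Icc 0 T, ∀ y,
      |trigSum w ω (fun n => z n t - volterraIter σ μ μ₀ ω m n t) N y|
        ≤ 3 * B / 2 ^ m * Real.exp (ρ * t) := by
    intro T
    obtain ⟨S, hS⟩ := hσ.exists_abs_le_Icc T
    obtain ⟨M, hM⟩ := hμ.exists_abs_le_Icc T
    let ρ := max (2 * (S + |μ₀| + M * T)) 1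
    have hρ : 0 < ρ := lt_max_of_lt_right one_pos
    have hcosb : ∀ N, ∀ s ∈ Icc 0 T, ∀ y,
        |trigSum w ω (fun n => Real.cos (ω n * s)) N y| ≤ B * Real.exp (ρ * s) :=
      fun N s hs y => (abs_trigSum_cos_le (hB N) y s).trans
        (le_mul_of_one_le_right hB0 (Real.one_le_exp (mul_nonneg hρ.le hs.1)))
    have hzb : ∀ N, ∀ t ∈ Icc 0 T, ∀ y,
        |trigSum w ω (z · t) N y| ≤ 2 * B * Real.exp (ρ * t) := fun N t ht y =>
      abs_trigSum_volterra_le hσ hμ hz hS hM hρ (le_max_left _ _) hvz (hcosb N) hB0 ht y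
    refine ⟨ρ, hρ, hzb, fun m => ?_⟩
    induction m with
    | zero =>
      intro N t ht y
      rw [trigSum_sub]
      refine (abs_sub _ _).trans ((add_le_add (hzb N t ht y) (hcosb N t ht y)).trans (le_of_eq ?_))
      ring
    | succ m ih =>
      intro N t ht y
      have h1 := abs_trigSum_conv_le_half (x := fun n t => z n t - volterraIter σ μ μ₀ ω m n t)
        hσ hμ (fun n => (hz n).sub ((hit m).continuousOn n)) hS hM hρ (le_max_left _ _)
        (by positivity) (ih N) ht y
      have e : ∀ n, z n t - volterraIter σ μ μ₀ ω (m + 1) n t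
          = 0 - HeatMemory.conv (modeKernel σ μ μ₀ (ω n))
            (fun t => z n t - volterraIter σ μ μ₀ ω m n t) t := fun n => by
        have hk := continuousOn_modeKernel hσ hμ μ₀ (ω n)
        have : HeatMemory.conv (modeKernel σ μ μ₀ (ω n))
            (fun t => z n t - volterraIter σ μ μ₀ ω m n t) t
            = HeatMemory.conv (modeKernel σ μ μ₀ (ω n)) (z n) t
              - HeatMemory.conv (modeKernel σ μ μ₀ (ω n)) (volterraIter σ μ μ₀ ω m n) t := by
          unfold HeatMemory.conv
          rw [← intervalIntegral.integral_sub
            (continuousOn_conv_integrand hk (hz n) ht.1).intervalIntegrable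
            (continuousOn_conv_integrand hk ((hit m).continuousOn n) ht.1).intervalIntegrable]
          simp only [mul_sub]
        rw [this, hvz n t ht.1]
        simp only [volterraIter]
        ring
      simp only [e]
      rw [trigSum_sub, show trigSum w ω (fun _ => 0) N y = 0 by simp [trigSum], zero_sub, abs_neg]
      refine h1.trans (le_of_eq ?_)
      rw [pow_succ]
      field_simp
  refine ⟨hz, fun T => ?_, fun y t ht => ?_⟩
  · obtain ⟨ρ, hρ, h, -⟩ := param T
    refine ⟨2 * B * Real.exp (ρ * T), fun N y s hs => (h N s hs y).trans ?_⟩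
    gcongr
    exact hs.2
  · obtain ⟨ρ, hρ, -, h⟩ := param t
    refine cauchySeq_tendsto_of_complete (Metric.cauchySeq_iff'.2 fun ε hε => ?_)
    have l0 : Tendsto (fun m : ℕ => 3 * B / 2 ^ m * Real.exp (ρ * t)) atTop (𝓝 0) := by
      simpa using (tendsto_const_nhds (x := 3 * B).div_atTop
        (tendsto_pow_atTop_atTop_of_one_lt (one_lt_two (α := ℝ)))).mul_const (Real.exp (ρ * t))
    obtain ⟨m, hm⟩ := (l0.eventually (gt_mem_nhds (show (0 : ℝ) < ε / 3 by positivity))).exists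
    obtain ⟨l, hl⟩ := (hit m).tendsto y t ht
    obtain ⟨N₀, hN₀⟩ := Metric.cauchySeq_iff'.1 hl.cauchySeq (ε / 3) (by positivity)
    refine ⟨N₀, fun N hN => ?_⟩
    have h1 := (h m N t ⟨ht, le_rfl⟩ y).trans_lt hm
    have h2 := (h m N₀ t ⟨ht, le_rfl⟩ y).trans_lt hm
    have h3 := hN₀ N hN
    rw [Real.dist_eq] at h3 ⊢
    rw [trigSum_sub] at h1 h2
    rw [abs_lt] at *
    constructor <;> linarith

end TrigFamilies

/-! ### Lebesgue summation of convergent series. -/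

section LebesgueSummation

lemma sum_range_mul_sub_eq (a f : ℕ → ℝ) (s : ℝ) (M : ℕ) :
    ∑ n ∈ Finset.range M, a n * f n - s
      = (∑ j ∈ Finset.range M, a j - s) * f M + s * (f 0 - 1)
        + ∑ n ∈ Finset.range M, (∑ j ∈ Finset.range (n + 1), a j - s) * (f n - f (n + 1)) := by
  induction M with
  | zero => simp; ring
  | succ M ih =>
    rw [Finset.sum_range_succ, Finset.sum_range_succ (fun n => (_ - s) * _)]
    have := Finset.sum_range_succ a M
    rw [this] at *
    linear_combination ih

lemma sum_Ico_le_of_le_inv_mul {b : ℕ → ℝ} {D : ℝ} {M : ℕ} (hM : 0 < M)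
    (hb : ∀ n, 0 < n → b n ≤ D / (n * (n + 1))) (hD : 0 ≤ D) (N : ℕ) :
    ∑ n ∈ Finset.Ico M N, b n ≤ D / M := by
  have hM' : (0 : ℝ) < M := by exact_mod_cast hM
  rcases le_total N M with h | h
  · rw [Finset.Ico_eq_empty_of_le h, Finset.sum_empty]; positivity
  suffices ∑ n ∈ Finset.Ico M N, b n ≤ D / M - D / N by
    have : 0 ≤ D / (N : ℝ) := by positivity
    linarith
  induction N, h using Nat.le_induction with
  | base => simp
  | succ N h ih =>
    rw [Finset.sum_Ico_succ_top h]
    have hN : 0 < N := hM.trans_le h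
    have hN' : (0 : ℝ) < N := by exact_mod_cast hN
    have h1 := hb N hN
    have : D / (N * (N + 1)) = D / N - D / (N + 1 : ℕ) := by
      push_cast; field_simp; ring
    linarith

/-- Lebesgue's theorem on the summation of convergent series. -/
lemma tendsto_of_lebesgue_summation {a : ℕ → ℝ} {s : ℝ} {f : ℝ → ℕ → ℝ} {F : ℝ → ℝ} {h D ε₀ : ℝ}
    (ha : Tendsto (fun N => ∑ n ∈ Finset.range N, a n) atTop (𝓝 s)) (hε₀ : 0 < ε₀)
    (hf1 : ∀ ε n, |f ε n| ≤ 1) (hf0 : Tendsto (f · 0) (𝓝[>] 0) (𝓝 1))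
    (hfs : ∀ ε, 0 < ε → ∀ n, |f ε n - f ε (n + 1)| ≤ h * ε) (hD : 0 ≤ D) (hh : 0 ≤ h)
    (haf : ∀ ε, 0 < ε → ∀ n, 0 < n → |a n * f ε n| ≤ D / ε / (n * (n + 1)))
    (hF : ∀ ε, 0 < ε → ε < ε₀ →
      Tendsto (fun N => ∑ n ∈ Finset.range N, a n * f ε n) atTop (𝓝 (F ε))) :
    Tendsto F (𝓝[>] 0) (𝓝 s) := by
  set t : ℕ → ℝ := fun M => ∑ j ∈ Finset.range M, a j - s with ht
  have ht0 : Tendsto t atTop (𝓝 0) := by simpa using ha.sub_const s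
  rw [Metric.tendsto_nhds]
  intro η hη
  -- Cut the series at M = ⌈K/ε⌉: the tail is at most D/(εM) ≤ D/K, whatever `ε` is.
  obtain ⟨K, hK0, hK⟩ : ∃ K : ℝ, 0 < K ∧ D / K < η / 2 := by
    refine ⟨2 * (D + 1) / η, by positivity, ?_⟩
    rw [div_lt_iff₀ (by positivity)]
    field_simp
    linarith
  have hM : Tendsto (fun ε : ℝ => ⌈K / ε⌉₊) (𝓝[>] 0) atTop :=
    tendsto_nat_ceil_atTop.comp (tendsto_const_nhds.pos_mul_atTop hK0 tendsto_inv_nhdsGT_zero)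
  have hces : Tendsto (fun M : ℕ => (M⁻¹ : ℝ) * ∑ n ∈ Finset.range M, |t (n + 1)|) atTop (𝓝 0) := by
    have := (ht0.comp (tendsto_add_atTop_nat 1)).abs
    rw [abs_zero] at this
    exact this.cesaro
  -- The majorant of the head after summation by parts. The increments of `f` are at most hε and Mε
  -- ≤ K + 1, so the last term is a Cesàro mean of the remainders, which tends to 0.
  have lim : Tendsto (fun ε : ℝ => |t ⌈K / ε⌉₊| + |s| * |f ε 0 - 1| + h * (K + 1) *
      ((⌈K / ε⌉₊⁻¹ : ℝ) * ∑ n ∈ Finset.range ⌈K / ε⌉₊, |t (n + 1)|)) (𝓝[>] 0) (𝓝 0) := by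
    have h1 := (ht0.comp hM).abs
    have h2 := ((hf0.sub_const 1).abs).const_mul |s|
    have h3 := (hces.comp hM).const_mul (h * (K + 1))
    simpa [Function.comp_def] using (h1.add h2).add h3
  have small : ∀ᶠ ε in 𝓝[>] (0 : ℝ), 0 < ε ∧ ε < min ε₀ 1 :=
    Ioo_mem_nhdsGT (lt_min hε₀ one_pos)
  filter_upwards [small, lim.eventually (gt_mem_nhds (half_pos hη))] with ε hε hlim
  obtain ⟨he0, he1⟩ := hε
  have heε := he1.trans_le (min_le_left _ _)
  have he1 := he1.trans_le (min_le_right _ _)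
  set M := ⌈K / ε⌉₊ with hMd
  have hKM : K / ε ≤ M := Nat.le_ceil _
  have hMK : M * ε ≤ K + 1 := by
    have := (Nat.ceil_lt_add_one (div_pos hK0 he0).le).le
    rw [← hMd, div_add_one he0.ne', le_div_iff₀ he0] at this
    linarith
  have hMpos : 0 < M := Nat.ceil_pos.2 (div_pos hK0 he0)
  have hM' : (0 : ℝ) < M := by exact_mod_cast hMpos
  have head : |∑ n ∈ Finset.range M, a n * f ε n - s| < η / 2 := by
    refine lt_of_le_of_lt ?_ hlim
    rw [sum_range_mul_sub_eq]
    refine (abs_add_three _ _ _).trans (add_le_add (add_le_add ?_ (abs_mul _ _).le) ?_)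
    · rw [abs_mul]
      exact mul_le_of_le_one_right (abs_nonneg _) (hf1 _ _)
    · refine (Finset.abs_sum_le_sum_abs _ _).trans ?_
      calc ∑ n ∈ Finset.range M, |t (n + 1) * (f ε n - f ε (n + 1))|
          ≤ ∑ n ∈ Finset.range M, |t (n + 1)| * (h * ε) := by
            refine Finset.sum_le_sum fun n _ => ?_
            rw [abs_mul]
            exact mul_le_mul_of_nonneg_left (hfs ε he0 n) (abs_nonneg _)
        _ = h * (M * ε) * ((M : ℝ)⁻¹ * ∑ n ∈ Finset.range M, |t (n + 1)|) := by
            rw [← Finset.sum_mul]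
            field_simp
        _ ≤ _ := by
            have : 0 ≤ (M : ℝ)⁻¹ * ∑ n ∈ Finset.range M, |t (n + 1)| :=
              mul_nonneg (by positivity) (Finset.sum_nonneg fun _ _ => abs_nonneg _)
            gcongr
  have tail : |F ε - ∑ n ∈ Finset.range M, a n * f ε n| ≤ D / K := by
    refine le_of_tendsto ((hF ε he0 heε).sub_const _).abs ?_
    filter_upwards [eventually_ge_atTop M] with N hN
    rw [← Finset.sum_Ico_eq_sub _ hN]
    refine (Finset.abs_sum_le_sum_abs _ _).trans ((sum_Ico_le_of_le_inv_mul hMpos (haf ε he0)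
      (by positivity) N).trans ?_)
    rw [div_div]
    gcongr
    rw [div_le_iff₀ he0] at hKM
    linarith
  rw [Real.dist_eq]
  have := abs_sub_le (F ε) (∑ n ∈ Finset.range M, a n * f ε n) s
  linarith

/-- sinc x is the mean of cos(xτ) over τ in [0,1]. -/
lemma abs_sinc_sub_sinc_le (x y : ℝ) : |Real.sinc x - Real.sinc y| ≤ |x - y| := by
  have e : ∀ x, Real.sinc x = ∫ τ in (0 : ℝ)..1, Real.cos (x * τ) := fun x => by
    rcases eq_or_ne x 0 with rfl | hx
    · simp
    · rw [intervalIntegral.integral_comp_mul_left _ hx, integral_cos, Real.sinc_of_ne_zero hx]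
      simp [div_eq_inv_mul]
  rw [e, e, ← intervalIntegral.integral_sub
    (Continuous.intervalIntegrable (by fun_prop) _ _)
    (Continuous.intervalIntegrable (by fun_prop) _ _), ← Real.norm_eq_abs (∫ _ in (0 : ℝ)..1, _)]
  have := intervalIntegral.norm_integral_le_of_norm_le_const (a := (0 : ℝ)) (b := 1)
    (f := fun τ => Real.cos (x * τ) - Real.cos (y * τ)) (C := |x - y|) fun τ hτ => ?_
  · simpa using this
  · rw [uIoc_of_le zero_le_one] at hτ
    have h1 := Real.abs_cos_sub_cos_le (x * τ) (y * τ)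
    rw [← sub_mul, abs_mul, abs_of_pos hτ.1] at h1
    exact h1.trans (mul_le_of_le_one_right (abs_nonneg _) hτ.2)

end LebesgueSummation

/-! ### Boundary values at x = L as Lebesgue sums. -/

section RightValue

open HeatMemory

variable {L : ℝ}

lemma gamma0_pos (hL : 0 < L) : 0 < gamma0 L := Real.sqrt_pos.2 (by positivity)

lemma gamma0_sq (hL : 0 < L) : gamma0 L ^ 2 = 2 / L := Real.sq_sqrt (by positivity)

lemma integrable_L2 (u : L2 L) : Integrable u (volume.restrict (Ioo 0 L)) :=
  (Lp.memLp u).integrable (by norm_num)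

lemma sum_sin_mul_sin (N : ℕ) (x ε : ℝ) :
    ∑ n ∈ Finset.range N, (-1 : ℝ) ^ n / lam L n * Real.sin (lam L n * ε) * Real.sin (lam L n * x)
      = (squareWave L N (x - ε) - squareWave L N (x + ε)) / 2 := by
  rw [squareWave, squareWave, ← Finset.sum_sub_distrib, Finset.sum_div]
  refine Finset.sum_congr rfl fun n _ => ?_
  rw [mul_sub, mul_add, Real.cos_sub, Real.cos_add]
  ring

lemma integrable_mul_of_continuous_of_bounded (u : L2 L) {φ : ℝ → ℝ} (hφ : Continuous φ) {C : ℝ}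
    (hC : ∀ x, |φ x| ≤ C) : Integrable (fun x => u x * φ x) (volume.restrict (Ioo 0 L)) := by
  refine ((integrable_L2 u).bdd_mul (c := C) hφ.aestronglyMeasurable
    (Eventually.of_forall hC)).congr (Eventually.of_forall fun x => mul_comm _ _)

/-- The mean of φₙ over (L-ε, L) is γ₀(-1)ⁿ sinc(λₙε). The sine series of the indicator of this
interval is half the difference of two translated square waves and converges boundedly, so it may be
integrated against `u` by dominated convergence. -/
lemma tendsto_sum_pairing_integral_end (hL : 0 < L) (u : L2 L) {ε : ℝ} (hε : 0 < ε) (hεL : ε < L) :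
    Tendsto (fun N => ∑ n ∈ Finset.range N,
        (-1 : ℝ) ^ n * pairing L u (phi L n) * Real.sinc (lam L n * ε)) atTop
      (𝓝 ((gamma0 L)⁻¹ * ((1 / ε) * ∫ x in Ioo (L - ε) L, u x))) := by
  obtain ⟨B, hB0, hB⟩ := exists_abs_squareWave_le hL
  have hg := gamma0_pos hL
  have hg2 := gamma0_sq hL
  have hu := integrable_L2 u
  have hmain : Tendsto (fun N => ∫ x in Ioo 0 L,
      u x * ((squareWave L N (x - ε) - squareWave L N (x + ε)) / 2)) atTop
      (𝓝 (∫ x in Ioo 0 L, (Ioi (L - ε)).indicator (fun x => u x * (L / 2)) x)) := by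
    refine tendsto_integral_of_dominated_convergence (fun x => |u x| * B) (fun N => ?_)
      (hu.abs.mul_const B) (fun N => Eventually.of_forall fun x => ?_) ?_
    · refine hu.aestronglyMeasurable.mul (Continuous.aestronglyMeasurable ?_)
      unfold squareWave
      fun_prop
    · rw [norm_mul, Real.norm_eq_abs, Real.norm_eq_abs]
      refine mul_le_mul_of_nonneg_left ?_ (abs_nonneg _)
      rw [abs_div, abs_two, div_le_iff₀ two_pos]
      linarith [abs_sub (squareWave L N (x - ε)) (squareWave L N (x + ε)), hB N (x - ε),
        hB N (x + ε)]
    · have hne : ∀ᵐ x ∂(volume.restrict (Ioo 0 L)), x ≠ L - ε :=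
        ae_restrict_of_ae (Measure.ae_ne volume (L - ε))
      filter_upwards [hne, ae_restrict_mem measurableSet_Ioo] with x hx hx'
      have h1 := tendsto_squareWave hL (y := x - ε) (abs_lt.2 ⟨by linarith [hx'.1], by
        linarith [hx'.2]⟩)
      rcases lt_or_gt_of_ne hx with h | h
      · have h2 := tendsto_squareWave hL (y := x + ε) (abs_lt.2 ⟨by linarith [hx'.1], by
          linarith [hx'.2]⟩)
        rw [indicator_of_notMem (by simpa using h.le)]
        simpa using ((h1.sub h2).div_const 2).const_mul (u x)
      · have h2 := tendsto_squareWave_of_gt hL (y := x + ε) (by linarith) (by linarith [hx'.2])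
        rw [indicator_of_mem (by simpa using h)]
        convert! ((h1.sub h2).div_const 2).const_mul (u x) using 2
        ring
  have hlim : ∫ x in Ioo 0 L, (Ioi (L - ε)).indicator (fun x => u x * (L / 2)) x
      = L / 2 * ∫ x in Ioo (L - ε) L, u x := by
    rw [setIntegral_indicator measurableSet_Ioi, integral_mul_const, mul_comm]
    congr 3
    ext x
    simp only [mem_inter_iff, mem_Ioo, mem_Ioi]
    exact ⟨fun h => ⟨h.2, h.1.2⟩, fun h => ⟨⟨by linarith [h.1], h.2⟩, h.1⟩⟩
  rw [hlim] at hmain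
  have hL0 := hL.ne'
  have hgne := hg.ne'
  have hεne := hε.ne'
  convert! hmain.const_mul (gamma0 L / ε) using 2 with N
  · simp only [← sum_sin_mul_sin, Finset.mul_sum]
    rw [integral_finsetSum]
    · rw [Finset.mul_sum]
      refine Finset.sum_congr rfl fun n _ => ?_
      have hl := (lam_pos hL n).ne'
      rw [Real.sinc_of_ne_zero (mul_ne_zero hl hεne), pairing]
      have e1 : ∀ x, u x * phi L n x = gamma0 L * (u x * Real.sin (lam L n * x)) := fun x => by
        unfold phi; ring
      have e2 : ∀ x, u x * ((-1 : ℝ) ^ n / lam L n * Real.sin (lam L n * ε)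
          * Real.sin (lam L n * x))
          = (-1 : ℝ) ^ n / lam L n * Real.sin (lam L n * ε) * (u x * Real.sin (lam L n * x)) :=
        fun x => by ring
      simp only [e1, e2, integral_const_mul]
      field_simp
    · intro n _
      refine integrable_mul_of_continuous_of_bounded u (by fun_prop)
        (C := |(-1 : ℝ) ^ n / lam L n * Real.sin (lam L n * ε)|) fun x => ?_
      rw [abs_mul]
      exact mul_le_of_le_one_right (abs_nonneg _) (Real.abs_sin_le_one _)
  · have : (gamma0 L)⁻¹ = gamma0 L * (L / 2) := by
      rw [inv_eq_iff_eq_inv]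
      field_simp
      field_simp at hg2
      linarith
    rw [this]
    ring

/-- Lebesgue summation with multipliers sinc(λₙε). The O(1/λₙ) hypothesis controls the tail:
together with |sinc x| ≤ 1/x it gives terms of size C/(λₙ²ε), and (n + 1/2)² ≥ n(n+1). -/
lemma isRightValue_of_tendsto (hL : 0 < L) (u : L2 L) {C s : ℝ}
    (hC : ∀ n, |pairing L u (phi L n)| ≤ C / lam L n)
    (hs : Tendsto (fun N => ∑ n ∈ Finset.range N, (-1 : ℝ) ^ n * pairing L u (phi L n)) atTop
      (𝓝 s)) :
    IsRightValue L u (gamma0 L * s) := by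
  have hpi := Real.pi_pos
  have hg := (gamma0_pos hL).ne'
  have hC0 : 0 ≤ C := by
    have := (abs_nonneg _).trans (hC 0)
    rwa [le_div_iff₀ (lam_pos hL 0), zero_mul] at this
  have key := tendsto_of_lebesgue_summation (f := fun ε n => Real.sinc (lam L n * ε))
    (F := fun ε => (gamma0 L)⁻¹ * ((1 / ε) * ∫ x in Ioo (L - ε) L, u x)) (ε₀ := L)
    (h := Real.pi / L) (D := C / (Real.pi / L) ^ 2) hs hL (fun ε n => ?_) ?_ (fun ε hε n => ?_)
    (by positivity) (by positivity) (fun ε hε n hn => ?_)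
    fun ε h0 h1 => tendsto_sum_pairing_integral_end hL u h0 h1
  · have := key.const_mul (gamma0 L)
    simpa only [IsRightValue, ← mul_assoc, mul_inv_cancel₀ hg, one_mul] using this
  · exact abs_le.2 ⟨Real.neg_one_le_sinc _, Real.sinc_le_one _⟩
  · have : Tendsto (fun ε => Real.sinc (lam L 0 * ε)) (𝓝 0) (𝓝 (Real.sinc (lam L 0 * 0))) :=
      (Real.continuous_sinc.comp (continuous_const_mul _)).tendsto 0
    rw [mul_zero, Real.sinc_zero] at this
    exact this.mono_left nhdsWithin_le_nhds
  · refine (abs_sinc_sub_sinc_le _ _).trans (le_of_eq ?_)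
    rw [← sub_mul, abs_mul, abs_of_pos hε, ← abs_neg,
      show -(lam L n - lam L (n + 1)) = Real.pi / L by unfold lam; push_cast; ring,
      abs_of_pos (by positivity)]
  · have hn' : (0 : ℝ) < n := by exact_mod_cast hn
    have hl := lam_pos hL n
    rw [Real.sinc_of_ne_zero (by positivity), abs_mul, abs_mul, abs_pow, abs_neg, abs_one, one_pow,
      one_mul, abs_div, abs_of_pos (mul_pos hl hε)]
    calc |pairing L u (phi L n)| * (|Real.sin (lam L n * ε)| / (lam L n * ε))
        ≤ C / lam L n * (1 / (lam L n * ε)) := by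
          gcongr
          · exact hC n
          · exact Real.abs_sin_le_one _
      _ = C / (Real.pi / L) ^ 2 / ε / ((n + 1 / 2 : ℝ) ^ 2) := by
          unfold lam
          field_simp
      _ ≤ _ := by
          gcongr
          nlinarith

end RightValue

/-! ### Convolution with bounded limits, and uniqueness of the deconvolution. -/

section ConvolutionLimits

open HeatMemory

lemma eq_zero_of_forall_integral_eq_zero {v : ℝ → ℝ} {A : ℝ} (hA : 0 < A)
    (hv : ContinuousOn v (Icc 0 A)) (h : ∀ x ∈ Icc 0 A, ∫ s in (0 : ℝ)..x, v s = 0) {x : ℝ}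
    (hx : x ∈ Icc 0 A) : v x = 0 := by
  let v' := IccExtend hA.le (domRestrict (Icc 0 A) v)
  have hc : Continuous v' := (continuousOn_iff_continuous_domRestrict.1 hv).Icc_extend'
  have e : ∀ s ∈ Icc 0 A, v' s = v s := fun s hs => IccExtend_of_mem _ _ hs
  have h' : ∀ x ∈ Icc 0 A, ∫ s in (0 : ℝ)..x, v' s = 0 := fun x hx => by
    refine Eq.trans (intervalIntegral.integral_congr fun s hs => e s ?_) (h x hx)
    rw [uIcc_of_le hx.1] at hs
    exact ⟨hs.1, hs.2.trans hx.2⟩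
  have d : HasDerivWithinAt (fun x => ∫ s in (0 : ℝ)..x, v' s) (v' x) (Icc 0 A) x :=
    (hc.integral_hasStrictDerivAt 0 x).hasDerivAt.hasDerivWithinAt
  have d0 : HasDerivWithinAt (fun x => ∫ s in (0 : ℝ)..x, v' s) 0 (Icc 0 A) x :=
    (hasDerivWithinAt_const x _ (0 : ℝ)).congr h' (h' x hx)
  rw [← e x hx]
  exact ((uniqueDiffOn_Icc hA) x hx).eq_deriv _ d d0

lemma abs_conv_le {k x : ℝ → ℝ} {K A T : ℝ} (hk : ∀ r ∈ Icc 0 T, |k r| ≤ K)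
    (hx : ∀ r ∈ Icc 0 T, |x r| ≤ A) {t : ℝ} (ht : t ∈ Icc 0 T) : |conv k x t| ≤ K * A * T := by
  have hK := (abs_nonneg _).trans (hk t ht)
  have hA := (abs_nonneg _).trans (hx t ht)
  have := intervalIntegral.norm_integral_le_of_norm_le_const (a := (0 : ℝ)) (b := t)
    (f := fun s => k (t - s) * x s) (C := K * A) fun s hs => ?_
  · refine this.trans ?_
    rw [sub_zero, abs_of_nonneg ht.1]
    gcongr
    exact ht.2
  · rw [uIoc_of_le ht.1] at hs
    rw [norm_mul]
    exact mul_le_mul (hk _ ⟨by linarith [hs.2], by linarith [hs.1, ht.2]⟩)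
      (hx s ⟨hs.1.le, hs.2.trans ht.2⟩) (abs_nonneg _) hK

/-- Bounded pointwise limits of continuous functions on `[0,∞)`. -/
structure BoundedLimit (p : ℕ → ℝ → ℝ) (h : ℝ → ℝ) : Prop where
  continuousOn : ∀ N, ContinuousOn (p N) (Ici 0)
  bounded : ∀ T, ∃ A, ∀ N, ∀ s ∈ Icc 0 T, |p N s| ≤ A
  tendsto : ∀ t, 0 ≤ t → Tendsto (fun N => p N t) atTop (𝓝 (h t))

namespace BoundedLimit

variable {p : ℕ → ℝ → ℝ} {h k : ℝ → ℝ}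

lemma intervalIntegrable (hp : BoundedLimit p h) {t : ℝ} (ht : 0 ≤ t) :
    IntervalIntegrable h volume 0 t := by
  obtain ⟨A, hA⟩ := hp.bounded t
  rw [intervalIntegrable_iff_integrableOn_Ioc_of_le ht]
  have hb : ∀ᵐ s ∂(volume.restrict (Ioc 0 t)), ‖h s‖ ≤ A := by
    filter_upwards [ae_restrict_mem measurableSet_Ioc] with s hs
    exact le_of_tendsto (hp.tendsto s hs.1.le).norm
      (Eventually.of_forall fun N => hA N s ⟨hs.1.le, hs.2⟩)
  refine Integrable.mono' (integrable_const A) ?_ hb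
  refine aestronglyMeasurable_of_tendsto_ae atTop (f := p) (fun N => ?_) ?_
  · exact ((hp.continuousOn N).mono fun s hs => hs.1.le).aestronglyMeasurable measurableSet_Ioc
  · filter_upwards [ae_restrict_mem measurableSet_Ioc] with s hs
    exact hp.tendsto s hs.1.le

lemma conv (hp : BoundedLimit p h) (hk : ContinuousOn k (Ici 0)) :
    BoundedLimit (fun N => HeatMemory.conv k (p N)) (HeatMemory.conv k h) := by
  refine ⟨fun N => continuousOn_conv hk (hp.continuousOn N), fun T => ?_, fun t ht => ?_⟩
  · obtain ⟨A, hA⟩ := hp.bounded T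
    obtain ⟨K, hK⟩ := hk.exists_abs_le_Icc T
    exact ⟨K * A * T, fun N s hs => abs_conv_le hK (hA N) hs⟩
  · obtain ⟨A, hA⟩ := hp.bounded t
    obtain ⟨K, hK⟩ := hk.exists_abs_le_Icc t
    refine intervalIntegral.tendsto_integral_filter_of_dominated_convergence
      (fun _ => K * A) (Eventually.of_forall fun N => ?_)
      (Eventually.of_forall fun N => Eventually.of_forall fun s hs => ?_)
      intervalIntegrable_const (Eventually.of_forall fun s hs => ?_)
    · exact (intervalIntegrable_iff.1 (continuousOn_conv_integrand hk (hp.continuousOn N)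
        ht).intervalIntegrable).aestronglyMeasurable
    · rw [uIoc_of_le ht] at hs
      rw [norm_mul]
      have hts : t - s ∈ Icc 0 t := ⟨by linarith [hs.2], by linarith [hs.1]⟩
      exact mul_le_mul (hK _ hts) (hA N s ⟨hs.1.le, hs.2⟩) (abs_nonneg _)
        ((abs_nonneg _).trans (hK _ hts))
    · rw [uIoc_of_le ht] at hs
      exact (hp.tendsto s hs.1.le).const_mul _

/-- The primitive of a convolution is the convolution with the primitive. -/
lemma integral_conv (hp : BoundedLimit p h) (hk : ContinuousOn k (Ici 0)) {t : ℝ} (ht : 0 ≤ t) :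
    ∫ s in (0 : ℝ)..t, HeatMemory.conv k h s
      = HeatMemory.conv (HeatMemory.conv (fun _ => 1) k) h t := by
  have h1 : ContinuousOn (fun _ : ℝ => (1 : ℝ)) (Ici 0) := continuousOn_const
  rw [← conv_one]
  refine tendsto_nhds_unique (((hp.conv hk).conv h1).tendsto t ht) ?_
  refine ((hp.conv (continuousOn_conv h1 hk)).tendsto t ht).congr fun N => ?_
  -- For the continuous approximants the claim is associativity in the convolution algebra; both
  -- sides pass to the limit.
  have hN := hp.continuousOn N
  refine eq_of_toConv_eq (continuousOn_conv (continuousOn_conv h1 hk) hN)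
    (continuousOn_conv h1 (continuousOn_conv hk hN)) ?_ ht
  rw [toConv_conv (continuousOn_conv h1 hk) hN, toConv_conv h1 (continuousOn_conv hk hN),
    toConv_conv h1 hk, toConv_conv hk hN, mul_assoc]

lemma const_mul (hp : BoundedLimit p h) (c : ℝ) :
    BoundedLimit (fun N s => c * p N s) (fun s => c * h s) := by
  refine ⟨fun N => continuousOn_const.mul (hp.continuousOn N), fun T => ?_,
    fun t ht => (hp.tendsto t ht).const_mul c⟩
  obtain ⟨A, hA⟩ := hp.bounded T
  refine ⟨|c| * A, fun N s hs => ?_⟩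
  rw [abs_mul]
  exact mul_le_mul_of_nonneg_left (hA N s hs) (abs_nonneg _)

end BoundedLimit

lemma conv_const_mul (k u : ℝ → ℝ) (c t : ℝ) : conv k (fun s => c * u s) t = c * conv k u t := by
  unfold conv
  rw [← intervalIntegral.integral_const_mul]
  exact intervalIntegral.integral_congr fun s _ => by ring

lemma const_mul_conv (k u : ℝ → ℝ) (c t : ℝ) : conv (fun s => c * k s) u t = c * conv k u t := by
  rw [conv_comm, conv_const_mul, conv_comm]

lemma conv_sum {k : ℝ → ℝ} {x : ℕ → ℝ → ℝ} (hk : ContinuousOn k (Ici 0))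
    (hx : ∀ n, ContinuousOn (x n) (Ici 0)) (w : ℕ → ℝ) (N : ℕ) {t : ℝ} (ht : 0 ≤ t) :
    conv k (fun s => ∑ n ∈ Finset.range N, w n * x n s) t
      = ∑ n ∈ Finset.range N, w n * conv k (x n) t := by
  unfold conv
  simp only [Finset.mul_sum]
  rw [intervalIntegral.integral_finsetSum]
  · refine Finset.sum_congr rfl fun n _ => ?_
    rw [← intervalIntegral.integral_const_mul]
    exact intervalIntegral.integral_congr fun s _ => by ring
  · exact fun n _ => (continuousOn_conv_integrand hk
      (u := fun s => w n * x n s) (continuousOn_const.mul (hx n)) ht).intervalIntegrable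

/-- Uniqueness for the deconvolution equation. -/
lemma eq_of_conv_conv_eq {g H b β : ℝ → ℝ} {p : ℕ → ℝ → ℝ} (hg : ContinuousOn g (Ici 0))
    (hp : BoundedLimit p H) {δ c : ℝ} (hδ : 0 < δ) (hc : 0 < c) (hH : ∀ t ∈ Icc 0 δ, c ≤ H t)
    {τ : ℝ} (hτ : 0 ≤ τ) (hgτ : g τ ≠ 0) {T : ℝ} (hT : 0 < T) (hb : ContinuousOn b (Icc 0 T))
    (hβ : ContinuousOn β (Icc 0 T))
    (heq : ∀ t ∈ Icc 0 T, conv (conv g H) b t = conv (conv g H) β t) {t : ℝ}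
    (ht : t ∈ Icc 0 (T - τ)) : b t = β t := by
  have hk := hp.conv hg
  have hbβ : ContinuousOn (fun s => b s - β s) (Icc 0 T) := hb.sub hβ
  have h0 : ∀ t ∈ Icc 0 T, conv (conv g H) (fun s => b s - β s) t = 0 := by
    intro t ht
    have hi : IntervalIntegrable (fun s => conv g H (t - s)) volume 0 t := by
      have := (hk.intervalIntegrable ht.1).comp_sub_left t
      simpa using this.symm
    have hm : uIcc 0 t ⊆ Icc 0 T := by
      rw [uIcc_of_le ht.1]; exact Icc_subset_Icc_right ht.2
    have : conv (conv g H) (fun s => b s - β s) t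
        = conv (conv g H) b t - conv (conv g H) β t := by
      rw [conv, conv, conv, ← intervalIntegral.integral_sub
        (hi.mul_continuousOn (hb.mono hm)) (hi.mul_continuousOn (hβ.mono hm))]
      simp only [mul_sub]
    rw [this, heq t ht, sub_self]
  obtain ⟨α, hα, hα1, hα2⟩ := titchmarsh hT.le (hk.intervalIntegrable hT.le)
    (hbβ.intervalIntegrable_of_Icc hT.le) h0
  -- The strict inequality is restricted to α > 0, since τ = 0 and α = 0 may occur together.
  have hαlt : 0 < α → α < τ := by
    intro hα0
    by_contra! hle
    have h1 : ContinuousOn (conv (fun _ => 1) g) (Ici 0) := continuousOn_conv continuousOn_const hg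
    -- The first application makes the primitive of g*H vanish, and that primitive is (1*g)*H, so
    -- Titchmarsh applies again to 1*g and `H`.
    obtain ⟨α', hα', hβ1, hβ2⟩ := titchmarsh hα0.le
      ((h1.mono Icc_subset_Ici_self).intervalIntegrable_of_Icc hα0.le)
      (hp.intervalIntegrable hα0.le) (f := conv (fun _ => 1) g) (g := H) fun t ht => by
        rw [← hp.integral_conv hg ht.1]; exact hα1 t ht
    -- If α' < α, the integral of `H` over a short interval at 0 would vanish, against the lower
    -- bound `c`. So 1*g, hence g, vanishes on [0,α], which contains `τ`.
    have hαα : α' = α := by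
      by_contra hne
      have hlt : α' < α := lt_of_le_of_ne hα'.2 hne
      set x := min δ (α - α') with hx
      have hx0 : 0 < x := lt_min hδ (sub_pos.2 hlt)
      have hxz := hβ2 x ⟨hx0.le, min_le_right _ _⟩
      have := intervalIntegral.integral_mono_on hx0.le (intervalIntegrable_const (c := c))
        (hp.intervalIntegrable hx0.le) fun s hs => hH s ⟨hs.1, hs.2.trans (min_le_left _ _)⟩
      rw [hxz, intervalIntegral.integral_const, sub_zero, smul_eq_mul] at this
      exact absurd this (not_le.2 (mul_pos hx0 hc))
    rw [hαα] at hβ1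
    have h2 : ∀ x ∈ Icc 0 α, ∫ s in (0 : ℝ)..x, g s = 0 := fun x hx => by
      rw [← conv_one]
      exact eq_zero_of_forall_integral_eq_zero hα0 (h1.mono Icc_subset_Ici_self) hβ1 hx
    exact hgτ (eq_zero_of_forall_integral_eq_zero hα0 (hg.mono Icc_subset_Ici_self) h2 ⟨hτ, hle⟩)
  have hατ : α ≤ τ := by
    rcases hα.1.eq_or_lt with h | h
    · rwa [← h]
    · exact (hαlt h).le
  -- For α > 0 this needs α < τ strictly; τ ≤ T holds because [0, T-τ] contains `t`.
  have hpos : 0 < T - α := by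
    rcases hα.1.eq_or_lt with h | h
    · rwa [← h, sub_zero]
    · linarith [hαlt h, ht.1, ht.2]
  have := eq_zero_of_forall_integral_eq_zero hpos
    (hbβ.mono (Icc_subset_Icc_right (by linarith [hα.1]))) hα2 (x := t)
    ⟨ht.1, by linarith [ht.2]⟩
  linarith

end ConvolutionLimits

/-! ### Fourier coefficients of solutions and the mode series at the insulated end. -/

section HeatEquation

open HeatMemory

lemma ContDiffOn.eq_add_integral_derivWithin {u : ℝ → ℝ} (hu : ContDiffOn ℝ 1 u (Ici 0)) :
    ContinuousOn (derivWithin u (Ici 0)) (Ici 0) ∧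
      ∀ t, 0 ≤ t → u t = u 0 + ∫ s in (0 : ℝ)..t, derivWithin u (Ici 0) s := by
  have hc := hu.continuousOn_derivWithin (uniqueDiffOn_Ici 0) le_rfl
  refine ⟨hc, fun t ht => ?_⟩
  have hi := (hc.mono Icc_subset_Ici_self).intervalIntegrable_of_Icc (μ := volume) ht
  have := intervalIntegral.integral_eq_sub_of_hasDeriv_right_of_le ht
    (hu.continuousOn.mono Icc_subset_Ici_self)
    (fun s hs => (((hu.differentiableOn one_ne_zero) s hs.1.le).hasDerivWithinAt).mono
      (Ioi_subset_Ici hs.1.le)) hi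
  rw [this]
  ring

/-- Take σ = a'/a(0), and let μ₀ and μ be the initial value and the derivative of β - σ. The second
derivative of `a` enters through μ. -/
lemma exists_kernel_data {a β : ℝ → ℝ} (ha : ContDiffOn ℝ 2 a (Ici 0))
    (hβ : ContDiffOn ℝ 2 β (Ici 0)) (ha0 : 0 < a 0) :
    ∃ (σ μ : ℝ → ℝ) (μ₀ : ℝ), ContinuousOn σ (Ici 0) ∧ ContinuousOn μ (Ici 0) ∧
      (∀ t, 0 ≤ t → a t = a 0 * (1 + ∫ s in (0 : ℝ)..t, σ s)) ∧
      ∀ t, 0 ≤ t → β t = σ t + (μ₀ + ∫ s in (0 : ℝ)..t, μ s) := by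
  have ha' : ContDiffOn ℝ 1 (derivWithin a (Ici 0)) (Ici 0) :=
    ha.derivWithin (uniqueDiffOn_Ici 0) (by norm_num)
  let σ : ℝ → ℝ := fun t => (a 0)⁻¹ * derivWithin a (Ici 0) t
  have hσ : ContDiffOn ℝ 1 σ (Ici 0) := contDiffOn_const.mul ha'
  have hν : ContDiffOn ℝ 1 (fun t => β t - σ t) (Ici 0) := (hβ.of_le (by norm_num)).sub hσ
  obtain ⟨hμ, e⟩ := hν.eq_add_integral_derivWithin
  refine ⟨σ, _, β 0 - σ 0, hσ.continuousOn, hμ, fun t ht => ?_, fun t ht => ?_⟩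
  · rw [(ha.of_le (by norm_num)).eq_add_integral_derivWithin.2 t ht,
      intervalIntegral.integral_const_mul]
    field_simp
  · rw [← e t ht]
    ring

lemma continuous_pairing (L : ℝ) {φ : ℝ → ℝ} (hφ : Continuous φ) :
    Continuous fun u : L2 L => pairing L u φ := by
  obtain ⟨C, hC⟩ := isCompact_Icc.exists_bound_of_continuousOn (s := Icc 0 L) hφ.continuousOn
  have hm : MemLp φ 2 (volume.restrict (Ioo 0 L)) := by
    refine MemLp.of_bound hφ.aestronglyMeasurable C ?_
    filter_upwards [ae_restrict_mem measurableSet_Ioo] with x hx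
    exact hC x (Ioo_subset_Icc_self hx)
  have e : (fun u : L2 L => pairing L u φ) = fun u => inner ℝ (hm.toLp φ) u := by
    funext u
    rw [MeasureTheory.L2.inner_def, pairing]
    refine integral_congr_ae ?_
    filter_upwards [hm.coeFn_toLp] with x hx
    rw [hx]
    simp
  rw [e]
  fun_prop

lemma pairing_zero (L : ℝ) (φ : ℝ → ℝ) : pairing L 0 φ = 0 := by
  rw [pairing]
  refine integral_eq_zero_of_ae ?_
  filter_upwards [Lp.coeFn_zero ℝ 2 (volume.restrict (Ioo 0 L))] with x hx
  simp only [hx, Pi.zero_apply, zero_mul]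

variable {L : ℝ}

lemma contDiff_phi (L : ℝ) (n : ℕ) : ContDiff ℝ 2 (phi L n) := by
  unfold phi
  fun_prop

lemma deriv_phi (L : ℝ) (n : ℕ) :
    deriv (phi L n) = fun x => gamma0 L * lam L n * Real.cos (lam L n * x) := by
  funext x
  have := ((((hasDerivAt_id x).const_mul (lam L n)).sin).const_mul (gamma0 L)).deriv
  simp only [id, mul_one] at this
  unfold phi
  rw [this]
  ring

lemma deriv_deriv_phi (L : ℝ) (n : ℕ) :
    deriv (deriv (phi L n)) = fun x => -(lam L n ^ 2) * phi L n x := by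
  rw [deriv_phi]
  funext x
  have := ((((hasDerivAt_id x).const_mul (lam L n)).cos).const_mul (gamma0 L * lam L n)).deriv
  simp only [id, mul_one] at this
  rw [this, phi]
  ring

lemma deriv_phi_end (hL : 0 < L) (n : ℕ) : deriv (phi L n) L = 0 := by
  rw [deriv_phi]
  simp only
  rw [show lam L n * L = Real.pi / 2 + n * Real.pi by unfold lam; field_simp; ring,
    Real.cos_add_nat_mul_pi, Real.cos_pi_div_two]
  simp

variable {a β f : ℝ → ℝ} {ξ : L2 L} {θ : ℝ → L2 L}

lemma HeatMemory.IsSolution.continuousOn_pairing (hθ : IsSolution L a β f ξ θ) (n : ℕ) :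
    ContinuousOn (fun t => pairing L (θ t) (phi L n)) (Ici 0) :=
  (continuous_pairing L (contDiff_phi L n).continuous).comp_continuousOn hθ.continuousOn

/-- The equations for the Fourier coefficients of a solution. -/
lemma HeatMemory.IsSolution.hasDerivWithinAt_pairing (hL : 0 < L) (hθ : IsSolution L a β f ξ θ)
    (n : ℕ) {t : ℝ} (ht : 0 ≤ t) :
    HasDerivWithinAt
      (fun τ => pairing L (θ τ) (phi L n) + conv β (fun s => pairing L (θ s) (phi L n)) τ)
      (conv a (fun s => -(lam L n ^ 2) * pairing L (θ s) (phi L n)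
        + gamma0 L * lam L n * f s) t) (Ici 0) t := by
  have h := hθ.equation (phi L n) (contDiff_phi L n) (by simp [phi]) (deriv_phi_end hL n) t ht
  have e : ∀ u : L2 L, pairing L u (deriv (deriv (phi L n)))
      = -(lam L n ^ 2) * pairing L u (phi L n) := fun u => by
    rw [deriv_deriv_phi, pairing, pairing, ← integral_const_mul]
    congr 1
    funext x
    ring
  have e0 : deriv (phi L n) 0 = gamma0 L * lam L n := by rw [deriv_phi]; simp
  simpa only [e, e0] using h

lemma HeatMemory.IsSolution.isMode (hL : 0 < L) (hθ : IsSolution L a β (fun _ => 0) ξ θ)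
    (hξ : ∀ n, pairing L ξ (phi L n) = 1 / lam L n) (n : ℕ) :
    IsMode a β (lam L n) fun t => lam L n * pairing L (θ t) (phi L n) := by
  have hl := (lam_pos hL n).ne'
  refine ⟨continuousOn_const.mul (hθ.continuousOn_pairing n), ?_, fun t ht => ?_⟩
  · rw [hθ.initial, hξ, mul_one_div_cancel hl]
  · have h := (hθ.hasDerivWithinAt_pairing hL n ht).const_mul (lam L n)
    simp only [mul_zero, add_zero, conv_const_mul] at h ⊢
    convert! h using 1
    · funext τ; ring
    · ring

/-- The series of the modes at the insulated end. -/
lemma exists_boundedLimit_modes (hL : 0 < L) (ha : ContDiffOn ℝ 2 a (Ici 0))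
    (hβ : ContDiffOn ℝ 2 β (Ici 0)) (ha0 : 0 < a 0) {z : ℕ → ℝ → ℝ}
    (hz : ∀ n, IsMode a β (lam L n) (z n)) :
    ∃ h : ℝ → ℝ, BoundedLimit
        (fun N t => ∑ n ∈ Finset.range N, (-1 : ℝ) ^ n / lam L n * z n t) h ∧
      (∀ T, ∃ C, ∀ n, ∀ t ∈ Icc 0 T, |z n t| ≤ C) ∧
      ∃ δ > 0, ∀ t ∈ Icc 0 δ, L / 4 ≤ h t := by
  obtain ⟨σ, μ, μ₀, hσ, hμ, haσ, hβμ⟩ := exists_kernel_data ha hβ ha0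
  set ω : ℕ → ℝ := fun n => Real.sqrt (a 0) * lam L n with hω
  set w : ℕ → ℝ := fun n => (-1 : ℝ) ^ n / lam L n with hw
  have hzc := fun n => (hz n).continuousOn
  have hvz : ∀ n t, 0 ≤ t → z n t = Real.cos (ω n * t) - conv (modeKernel σ μ μ₀ (ω n)) (z n) t :=
    fun n t ht => (hz n).volterra ha.continuousOn hβ.continuousOn hσ hμ
      (by rw [hω, mul_pow, Real.sq_sqrt ha0.le]) haσ hβμ ht
  have hW : ∀ N y, trigSum w ω (fun _ => 1) N y = squareWave L N (Real.sqrt (a 0) * y) :=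
    fun N y => by
      refine Finset.sum_congr rfl fun n _ => ?_
      rw [hω, mul_one, show Real.sqrt (a 0) * lam L n * y = lam L n * (Real.sqrt (a 0) * y) by ring]
  obtain ⟨B, hB0, hB⟩ := exists_abs_squareWave_le hL
  have hts : TrigSummable w ω z := TrigSummable.volterra hσ hμ hzc hvz (B := B)
    (fun N y => by rw [hW]; exact hB _ _)
    (fun y => by simp only [hW]; exact exists_tendsto_squareWave hL _)
  have hsum : ∀ N t, ∑ n ∈ Finset.range N, (-1 : ℝ) ^ n / lam L n * z n t
      = trigSum w ω (z · t) N 0 := fun N t => by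
    simp [trigSum, hw]
  simp only [hsum]
  have hlim : ∀ t, ∃ l, 0 ≤ t → Tendsto (fun N => trigSum w ω (z · t) N 0) atTop (𝓝 l) := by
    intro t
    by_cases ht : 0 ≤ t
    · obtain ⟨l, hl⟩ := hts.tendsto 0 t ht
      exact ⟨l, fun _ => hl⟩
    · exact ⟨0, fun h => absurd h ht⟩
  choose h hh using hlim
  refine ⟨h, ⟨fun N => ?_, fun T => ?_, hh⟩, exists_abs_volterra_le hσ hμ hzc hvz, ?_⟩
  · unfold trigSum
    exact continuousOn_finsetSum _ fun n _ => continuousOn_const.mul (hzc n)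
  · obtain ⟨A, hA⟩ := hts.bounded T
    exact ⟨A, fun N s hs => hA N 0 s hs⟩
  · obtain ⟨S, hS⟩ := hσ.exists_abs_le_Icc 1
    obtain ⟨M, hM⟩ := hμ.exists_abs_le_Icc 1
    obtain ⟨A, hA⟩ := hts.bounded 1
    -- Near t = 0 the cosine part of the series is a square wave with sum L/2, and the Volterra part
    -- is at most tK. The three terms of `δ` keep t ≤ 1, √a(0)·t ≤ L/2 < L and tK ≤ L/4.
    set K := |(S + |μ₀| + M * 1) * A| with hK
    have hsq : 0 < Real.sqrt (a 0) := Real.sqrt_pos.2 ha0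
    have hd0 : 0 < L / (2 * Real.sqrt (a 0)) := by positivity
    have hd1 : 0 < L / (4 * (K + 1)) := by positivity
    refine ⟨min 1 (min (L / (2 * Real.sqrt (a 0))) (L / (4 * (K + 1)))),
      lt_min one_pos (lt_min hd0 hd1), fun t ht => ?_⟩
    have ht1 : t ≤ 1 := ht.2.trans (min_le_left _ _)
    have ht2 : t ≤ L / (2 * Real.sqrt (a 0)) :=
      ht.2.trans ((min_le_right _ _).trans (min_le_left _ _))
    have ht3 : t ≤ L / (4 * (K + 1)) := ht.2.trans ((min_le_right _ _).trans (min_le_right _ _))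
    rw [le_div_iff₀ (by positivity)] at ht2 ht3
    have l1 : Tendsto (fun N => squareWave L N (Real.sqrt (a 0) * t)) atTop (𝓝 (L / 2)) := by
      refine tendsto_squareWave hL ?_
      rw [abs_of_nonneg (mul_nonneg hsq.le ht.1)]
      linarith
    have l2 := (hh t ht.1).sub l1
    have bd : ∀ N, |trigSum w ω (z · t) N 0 - squareWave L N (Real.sqrt (a 0) * t)| ≤ t * K := by
      intro N
      have e : trigSum w ω (fun n => Real.cos (ω n * t)) N 0
          = squareWave L N (Real.sqrt (a 0) * t) := by
        rw [← hW]
        simp [trigSum]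
      have h1 := abs_trigSum_conv_le (w := w) (ω := ω) (μ₀ := μ₀) hσ hμ hzc (N := N) hS hM
        (φ := fun _ => A) continuous_const ⟨ht.1, ht1⟩
        (fun s hs y => hA N y s ⟨hs.1, hs.2.trans ht1⟩) 0
      have e2 : trigSum w ω (z · t) N 0 = trigSum w ω (fun n => Real.cos (ω n * t)) N 0
          - trigSum w ω (fun n => conv (modeKernel σ μ μ₀ (ω n)) (z n) t) N 0 := by
        rw [← trigSum_sub]
        simp only [← hvz _ t ht.1]
      rw [e2, e, sub_sub_cancel_left, abs_neg]
      refine h1.trans ?_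
      rw [intervalIntegral.integral_const, sub_zero, smul_eq_mul]
      exact mul_le_mul_of_nonneg_left (le_abs_self _) ht.1
    have := le_of_tendsto' l2.abs bd
    rw [abs_le] at this
    nlinarith [this.1, ht.1]

end HeatEquation

/-! ### Assembly of the boundary measurements and the deconvolution equation. -/

theorem mainTheorem3
    (L : ℝ) (hL : 0 < L)
    (a β : ℝ → ℝ) (ha : ContDiffOn ℝ 2 a (Ici 0)) (hβ : ContDiffOn ℝ 2 β (Ici 0))
    (ha0 : 0 < a 0)
    (ξ : HeatMemory.L2 L)
    (hξ : ∀ n : ℕ, HeatMemory.pairing L ξ (HeatMemory.phi L n) = 1 / HeatMemory.lam L n)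
    (g : ℝ → ℝ) (hg : ContinuousOn g (Ici 0))
    (θ₁ θ₂ : ℝ → HeatMemory.L2 L)
    (hθ₁ : HeatMemory.IsSolution L a β (fun _ => 0) ξ θ₁)
    (hθ₂ : HeatMemory.IsSolution L a β (fun t => ∫ s in (0 : ℝ)..t, g s) 0 θ₂) :
    ∃ (H Y : ℝ → ℝ) (S : ℝ),
      -- `H` and `Y` are the boundary temperatures at `x = L` in the two experiments
      (∀ t : ℝ, 0 ≤ t → HeatMemory.IsRightValue L (θ₁ t) (H t)) ∧
      (∀ t : ℝ, 0 ≤ t → HeatMemory.IsRightValue L (θ₂ t) (Y t)) ∧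
      (∀ t : ℝ, 0 ≤ t → IntervalIntegrable H volume 0 t) ∧
      (∀ z : ℕ → ℝ → ℝ, (∀ n, HeatMemory.IsMode a β (HeatMemory.lam L n) (z n)) →
        ∀ t : ℝ, 0 ≤ t →
          Tendsto (fun N : ℕ => HeatMemory.gamma0 L *
              ∑ n ∈ Finset.range N, (-1 : ℝ) ^ n / HeatMemory.lam L n * z n t)
            atTop (𝓝 (H t))) ∧
      -- the constant in the equation
      Tendsto (fun N : ℕ => ∑ n ∈ Finset.range N, (-1 : ℝ) ^ n / HeatMemory.lam L n)
        atTop (𝓝 S) ∧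
      Tendsto (fun N : ℕ => ∑ n ∈ Finset.Icc 1 N, (-1 : ℝ) ^ n / ((n : ℝ) + 1 / 2))
        atTop (𝓝 (Real.pi / 2 - 2)) ∧
      S = L / Real.pi * (2 + (Real.pi / 2 - 2)) ∧
      -- `β` solves the deconvolution equation
      (∀ t : ℝ, 0 ≤ t → HeatMemory.Deconvolution L S g H Y β t) ∧
      -- and is determined by it
      (∀ τ : ℝ, 0 ≤ τ → g τ ≠ 0 → ∀ T : ℝ, 0 < T →
        ∀ b : ℝ → ℝ, ContinuousOn b (Icc 0 T) →
          (∀ t ∈ Icc 0 T, HeatMemory.Deconvolution L S g H Y b t) →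
          ∀ t ∈ Icc 0 (T - τ), b t = β t) := by
  have hac := ha.continuousOn
  have hβc := hβ.continuousOn
  have hγ := gamma0_pos hL
  let z : ℕ → ℝ → ℝ := fun n t =>
    HeatMemory.lam L n * HeatMemory.pairing L (θ₁ t) (HeatMemory.phi L n)
  have hz : ∀ n, HeatMemory.IsMode a β (HeatMemory.lam L n) (z n) := hθ₁.isMode hL hξ
  have hzc := fun n => (hz n).continuousOn
  obtain ⟨h, hh, hzb, δ, hδ, hhδ⟩ := exists_boundedLimit_modes hL ha hβ ha0 hz
  let w : ℕ → ℝ := fun n => (-1 : ℝ) ^ n / HeatMemory.lam L n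
  -- The series of the constant is the square wave at y = 0.
  have hS : Tendsto (fun N : ℕ => ∑ n ∈ Finset.range N, w n) atTop (𝓝 (L / 2)) := by
    refine (tendsto_squareWave hL (y := 0) (by simpa using hL)).congr fun N => ?_
    simp [squareWave, w]
  have hgz : ∀ n, ContinuousOn (HeatMemory.conv g (z n)) (Ici 0) := fun n =>
    continuousOn_conv hg (hzc n)
  let y : ℕ → ℝ → ℝ := fun n t => (∫ s in (0 : ℝ)..t, g s) - HeatMemory.conv g (z n) t
    - HeatMemory.conv (HeatMemory.conv g (z n)) β t
  have hy : ∀ n t, 0 ≤ t → HeatMemory.pairing L (θ₂ t) (HeatMemory.phi L n)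
      = HeatMemory.gamma0 L * (y n t / HeatMemory.lam L n) := fun n t ht => by
    have hl := (lam_pos hL n).ne'
    -- Duhamel with l = λₙ and c = φₙ'(0) = γ₀λₙ, the boundary term left by the test function.
    have := (hz n).duhamel hac hβc hg (hθ₂.continuousOn_pairing n)
      (by rw [hθ₂.initial, pairing_zero])
      (fun t ht => hθ₂.hasDerivWithinAt_pairing hL n ht) ht
    field_simp
    refine mul_left_cancel₀ hl ?_
    linear_combination this
  have hconv : BoundedLimit (fun N => HeatMemory.conv g fun t => ∑ n ∈ Finset.range N, w n * z n t)
      (HeatMemory.conv g h) := hh.conv hg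
  have hYlim : ∀ t, 0 ≤ t → Tendsto (fun N => ∑ n ∈ Finset.range N,
      (-1 : ℝ) ^ n * HeatMemory.pairing L (θ₂ t) (HeatMemory.phi L n)) atTop
      (𝓝 (HeatMemory.gamma0 L * (L / 2 * (∫ s in (0 : ℝ)..t, g s) - HeatMemory.conv g h t
        - HeatMemory.conv (HeatMemory.conv g h) β t))) := by
    intro t ht
    rw [conv_comm (HeatMemory.conv g h) β]
    refine ((((hS.mul_const _).sub (hconv.tendsto t ht)).sub
      ((hconv.conv hβc).tendsto t ht)).const_mul (HeatMemory.gamma0 L)).congr fun N => ?_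
    have e : HeatMemory.conv β (HeatMemory.conv g fun t => ∑ n ∈ Finset.range N, w n * z n t) t
        = ∑ n ∈ Finset.range N, w n * HeatMemory.conv β (HeatMemory.conv g (z n)) t := by
      rw [← conv_sum hβc hgz w N ht]
      exact conv_congr ht (fun _ _ => rfl) fun s hs => conv_sum hg hzc w N hs.1
    rw [conv_sum hg hzc w N ht, e, Finset.sum_mul, ← Finset.sum_sub_distrib,
      ← Finset.sum_sub_distrib, Finset.mul_sum]
    refine Finset.sum_congr rfl fun n _ => ?_
    rw [hy n t ht]
    simp only [y, w, conv_comm (HeatMemory.conv g (z n)) β]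
    ring
  have hY : ∀ t, 0 ≤ t → HeatMemory.IsRightValue L (θ₂ t) (HeatMemory.gamma0 L
      * (HeatMemory.gamma0 L * (L / 2 * (∫ s in (0 : ℝ)..t, g s) - HeatMemory.conv g h t
        - HeatMemory.conv (HeatMemory.conv g h) β t))) := by
    intro t ht
    obtain ⟨G, hG⟩ := hg.exists_abs_le_Icc t
    obtain ⟨B, hB⟩ := hβc.exists_abs_le_Icc t
    obtain ⟨C, hC⟩ := hzb t
    have htt : t ∈ Icc 0 t := ⟨ht, le_rfl⟩
    -- The modes are bounded uniformly in n on [0,t], so the bracket in Duhamel's formula is too,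
    -- and the coefficients are O(1/λₙ).
    refine isRightValue_of_tendsto hL _ (C := HeatMemory.gamma0 L
      * (|∫ s in (0 : ℝ)..t, g s| + G * C * t + G * C * t * B * t)) (fun n => ?_) (hYlim t ht)
    have hl := lam_pos hL n
    rw [hy n t ht, abs_mul, abs_div, abs_of_pos hγ, abs_of_pos hl, mul_div_assoc]
    gcongr
    have h1 : ∀ s ∈ Icc 0 t, |HeatMemory.conv g (z n) s| ≤ G * C * t := fun s hs =>
      abs_conv_le hG (hC n) hs
    exact (abs_sub _ _).trans (add_le_add ((abs_sub _ _).trans (add_le_add le_rfl (h1 t htt)))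
      (abs_conv_le h1 hB htt))
  have hH : BoundedLimit _ fun t => HeatMemory.gamma0 L * h t := hh.const_mul (HeatMemory.gamma0 L)
  have hkH : ∀ t, HeatMemory.conv g (fun t => HeatMemory.gamma0 L * h t) t
      = HeatMemory.gamma0 L * HeatMemory.conv g h t := conv_const_mul g h _
  have hpi := Real.pi_pos
  -- The second temperature is defined by the formula in `hY`, so the deconvolution equation becomes
  -- an algebraic rearrangement.
  refine ⟨fun t => HeatMemory.gamma0 L * h t, _, L / 2, fun t ht => ?_, hY,
    fun t ht => hH.intervalIntegrable ht, fun z' hz' t ht => ?_, hS, tendsto_sum_Icc_alternating,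
    by field_simp; ring, ?_, ?_⟩
  · obtain ⟨C, hC⟩ := hzb t
    refine isRightValue_of_tendsto hL _ (C := C) (fun n => ?_)
      ((hh.tendsto t ht).congr fun N => Finset.sum_congr rfl fun n _ => ?_)
    · have hl := lam_pos hL n
      have := hC n t ⟨ht, le_rfl⟩
      rw [abs_mul, abs_of_pos hl] at this
      rwa [le_div_iff₀ hl, mul_comm]
    · have hl := (lam_pos hL n).ne'
      simp only [z]
      field_simp
  · refine (hH.tendsto t ht).congr fun N => ?_
    simp only [fun n => (hz n).unique (hz' n) hac hβc ht]
  · intro t ht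
    change HeatMemory.gamma0 L * HeatMemory.conv (HeatMemory.conv g _) β t
      = _ - HeatMemory.gamma0 L * HeatMemory.conv g _ t - _
    simp only [funext hkH, const_mul_conv]
    ring
  · intro τ hτ hgτ T hT b hb hbeq t ht
    refine eq_of_conv_conv_eq hg hH hδ (c := HeatMemory.gamma0 L * (L / 4)) (by positivity)
      (fun t ht => mul_le_mul_of_nonneg_left (hhδ t ht) hγ.le) hτ hgτ hT hb
      (hβc.mono Icc_subset_Ici_self) (fun t ht => ?_) ht
    -- The double integral in the equation is (g*H)*b, and the right side is the same for `b` and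
    -- `β`.
    have h1 : HeatMemory.gamma0 L * HeatMemory.conv
        (HeatMemory.conv g fun t => HeatMemory.gamma0 L * h t) b t
      = _ - HeatMemory.gamma0 L * HeatMemory.conv g (fun t => HeatMemory.gamma0 L * h t) t - _ :=
      hbeq t ht
    refine mul_left_cancel₀ hγ.ne' (h1.trans ?_)
    simp only [funext hkH, const_mul_conv]
    ring
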